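/- Let $\tfrac13<\alpha<2$ and $c>0$. With $\hat f(\xi)=\int_{\mathbb R}f(x)e^{-ix\xi}\,dx$, let $D^s$ be the Fourier multiplier with symbol $|\xi|^s$, and let $H^s(\mathbb R)$ carry the norm $\|u\|_{H^s}=\|(1-\partial_x^2)^{s/2}u\|_{L^2}$. Let $Q\in H^{\alpha/2}(\mathbb R)$ be a ground state of $$D^\alpha Q+Q-Q^2=0,$$ that is, an even, positive solution which minimizes $$J^\alpha(u)=\Big(\int_{\mathbb R}|u|^3\,dx\Big)^{-1}\Big(\int_{\mathbb R}|D^{\alpha/2}u|^2\,dx\Big)^{\frac1{2\alpha}}\Big(\int_{\mathbb R}|u|^2\,dx\Big)^{\frac{\alpha-1}{2\alpha}+1}$$ over all real-valued $u\in H^{\alpha/2}(\mathbb R)\setminus\{0\}$. Put $Q_c(x)=2c\,Q(c^{1/\alpha}x)$, so that $D^\alpha Q_c+cQ_c-\tfrac12Q_c^2=0$, and $$L=-\partial_x(D^\alpha-Q_c+c)\partial_x\colon H^{2+\alpha}(\mathbb R)\subset L^2(\mathbb R)\to L^2(\mathbb R).$$ Let $\lambda<0$ be the negative eigenvalue of $L$.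 Let the subscript "odd" denote the subspace of odd functions, let $$X=L^2_{\rm odd}(\mathbb R)\times H^{1+\alpha/2}_{\rm odd}(\mathbb R),\qquad Z=H^{1+\alpha/2}_{\rm odd}(\mathbb R)\times H^{2+\alpha}_{\rm odd}(\mathbb R)$$ (spaces of complex-valued functions) with norms $\|W\|_X=\|W_1\|_{L^2}+\|W_2\|_{H^{1+\alpha/2}}$ and $\|W\|_Z=\|W_1\|_{H^{1+\alpha/2}}+\|W_2\|_{H^{2+\alpha}}$, and let $$\mathcal L=\begin{pmatrix}0&L\\1&0\end{pmatrix},\qquad \mathcal L(W_1,W_2)=(LW_2,W_1),$$ regarded as an unbounded operator on $X$. Then the domain of $\mathcal L$ is $Z$, and there is a constant $C$, independent of $n$, such that for every integer $n$ with $|n|>1$ the number $in\sqrt{|\lambda|}$ belongs to the resolvent set of $\mathcal L$ and $$\big\|(\mathcal L-in\sqrt{|\lambda|}\,I)^{-1}\big\|_{X\to X}\le\frac{C}{|n|},\qquad \big\|(\mathcal L-in\sqrt{|\lambda|}\,I)^{-1}\big\|_{X\to Z}\le C.$$ -/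

import Mathlib

open MeasureTheory FourierTransform

noncomputable section

namespace FKP

/-! ### Operators on `L²(ℝ; ℂ)` -/

/-- The complex Hilbert space `L²(ℝ)`. -/
abbrev L2 : Type := Lp ℂ 2 (volume : Measure ℝ)

/-- Multiplication by the function `q`, with its maximal domain in `L²(ℝ)`. -/
def mulOp (q : ℝ → ℂ) : L2 →ₗ.[ℂ] L2 where
  domain :=
    { carrier := {u | MemLp (fun x : ℝ => q x * u x) 2 volume}
      zero_mem' := by
        refine (MemLp.zero : MemLp (0 : ℝ → ℂ) 2 volume).ae_eq ?_
        filter_upwards [Lp.coeFn_zero ℂ 2 (volume : Measure ℝ)] with η hη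
        simp only [hη, Pi.zero_apply, mul_zero]
      add_mem' := by
        intro u v hu hv
        refine (MemLp.add hu hv).ae_eq ?_
        filter_upwards [Lp.coeFn_add u v] with η hη
        simp only [Pi.add_apply] at hη ⊢
        rw [hη, mul_add]
      smul_mem' := by
        intro a u hu
        refine (MemLp.const_smul hu a).ae_eq ?_
        filter_upwards [Lp.coeFn_smul a u] with η hη
        simp only [Pi.smul_apply, smul_eq_mul] at hη ⊢
        rw [hη, mul_left_comm] }
  toFun :=
    { toFun := fun u => MemLp.toLp _ u.2
      map_add' := by
        intro u v
        rw [← MemLp.toLp_add]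
        refine MemLp.toLp_congr _ _ ?_
        filter_upwards [Lp.coeFn_add (u : L2) (v : L2)] with η hη
        simp only [Submodule.coe_add, Pi.add_apply] at hη ⊢
        rw [hη, mul_add]
      map_smul' := by
        intro a u
        simp only [RingHom.id_apply]
        rw [← MemLp.toLp_const_smul]
        refine MemLp.toLp_congr _ _ ?_
        filter_upwards [Lp.coeFn_smul a (u : L2)] with η hη
        simp only [Submodule.coe_smul, Pi.smul_apply, smul_eq_mul] at hη ⊢
        rw [hη, mul_left_comm] }

/-- The conjugate `F⁻¹ A F` of an unbounded operator, on `{u | F u ∈ D(A)}`. -/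
def conjOp (F : L2 ≃ₗᵢ[ℂ] L2) (A : L2 →ₗ.[ℂ] L2) : L2 →ₗ.[ℂ] L2 where
  domain := A.domain.comap F.toLinearEquiv.toLinearMap
  toFun := F.symm.toLinearEquiv.toLinearMap ∘ₗ A.toFun ∘ₗ
    F.toLinearEquiv.toLinearMap.restrict fun _ h => h

lemma norm_conjOp (F : L2 ≃ₗᵢ[ℂ] L2) (A : L2 →ₗ.[ℂ] L2) (u : L2) (hu : F u ∈ A.domain) :
    ‖conjOp F A ⟨u, hu⟩‖ = ‖A ⟨F u, hu⟩‖ :=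
  F.symm.norm_map _

/-- The Fourier transform on `L²(ℝ)` (Plancherel), `𝓕 u (η) = ∫ u(x) exp(-2π i x η) dx`. -/
def fourierL2 : L2 ≃ₗᵢ[ℂ] L2 := Lp.fourierTransformₗᵢ ℝ ℂ

/-- The Fourier multiplier `m(D)` as an unbounded operator on `L²(ℝ)` with its maximal domain.
The symbol `m` is written for the convention `û(ξ) = ∫ u(x) exp(-i x ξ) dx`.  Since
`𝓕 u (η) = û(2πη)`, the operator acts on `𝓕 u` as multiplication by `m(2πη)`. -/
def multiplier (m : ℝ → ℂ) : L2 →ₗ.[ℂ] L2 :=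
  conjOp fourierL2 (mulOp fun η => m (2 * Real.pi * η))

/-- The derivative `∂ₓ`, with symbol `iξ`. -/
def deriv : L2 →ₗ.[ℂ] L2 := multiplier fun ξ => Complex.I * ξ

/-- The operator `D^s`, with symbol `|ξ|^s`. -/
def riesz (s : ℝ) : L2 →ₗ.[ℂ] L2 := multiplier fun ξ => ((|ξ| ^ s : ℝ) : ℂ)

/-- The Bessel potential `(1 - ∂ₓ²)^(s/2)`, with symbol `(1 + ξ²)^(s/2)`. -/
def bessel (s : ℝ) : L2 →ₗ.[ℂ] L2 := multiplier fun ξ => (((1 + ξ ^ 2) ^ (s / 2) : ℝ) : ℂ)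

/-- The composition `g ∘ f` of unbounded operators, on `{u ∈ D(f) | f u ∈ D(g)}`. -/
def pcomp (g f : L2 →ₗ.[ℂ] L2) : L2 →ₗ.[ℂ] L2 where
  domain :=
    { carrier := {u | ∃ h : u ∈ f.domain, f ⟨u, h⟩ ∈ g.domain}
      zero_mem' := by
        refine ⟨Submodule.zero_mem _, ?_⟩
        have := g.domain.zero_mem
        rwa [← LinearPMap.map_zero f] at this
      add_mem' := by
        rintro u v ⟨hu, hu'⟩ ⟨hv, hv'⟩
        refine ⟨Submodule.add_mem _ hu hv, ?_⟩
        have := Submodule.add_mem _ hu' hv'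
        rwa [← LinearPMap.map_add] at this
      smul_mem' := by
        rintro a u ⟨hu, hu'⟩
        refine ⟨Submodule.smul_mem _ a hu, ?_⟩
        have := Submodule.smul_mem _ a hu'
        rwa [← LinearPMap.map_smul] at this }
  toFun :=
    { toFun := fun u => g ⟨f ⟨u, u.2.1⟩, u.2.2⟩
      map_add' := by
        intro u v
        rw [← LinearPMap.map_add]
        exact congrArg _ (Subtype.ext (LinearPMap.map_add f ⟨u, u.2.1⟩ ⟨v, v.2.1⟩))
      map_smul' := by
        intro a u
        rw [RingHom.id_apply, ← LinearPMap.map_smul]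
        exact congrArg _ (Subtype.ext (LinearPMap.map_smul f a ⟨u, u.2.1⟩)) }

/-! ### Sobolev spaces -/

/-- The Sobolev space `H^s(ℝ)`, for `s ≥ 0`, as a subspace of `L²(ℝ)`. -/
def sobolev (s : ℝ) : Submodule ℂ L2 := (bessel s).domain

/-- The subspace `L²_odd` of odd functions. -/
def oddL2 : Submodule ℂ L2 where
  carrier := {u | ∀ᵐ x : ℝ, u (-x) = -u x}
  zero_mem' := by
    have h := Lp.coeFn_zero ℂ 2 (volume : Measure ℝ)
    filter_upwards [h, (Measure.measurePreserving_neg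
      (volume : Measure ℝ)).quasiMeasurePreserving.ae h] with x hx hx'
    simp only [hx, hx', Pi.zero_apply, neg_zero]
  add_mem' := by
    intro u v hu hv
    have h := Lp.coeFn_add u v
    filter_upwards [hu, hv, h, (Measure.measurePreserving_neg
      (volume : Measure ℝ)).quasiMeasurePreserving.ae h] with x h1 h2 h3 h4
    simp only [Pi.add_apply] at h3 h4
    rw [h3, h4, h1, h2]; ring
  smul_mem' := by
    intro a u hu
    have h := Lp.coeFn_smul a u
    filter_upwards [hu, h, (Measure.measurePreserving_neg
      (volume : Measure ℝ)).quasiMeasurePreserving.ae h] with x h1 h3 h4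
    simp only [Pi.smul_apply] at h3 h4
    rw [h3, h4, h1, smul_neg]

/-- The space `H^s_odd(ℝ)`, for `s ≥ 0`. -/
def HOdd (s : ℝ) : Type := ↥(sobolev s ⊓ oddL2)

instance (s : ℝ) : AddCommGroup (HOdd s) :=
  inferInstanceAs (AddCommGroup ↥(sobolev s ⊓ oddL2))

instance (s : ℝ) : Module ℂ (HOdd s) :=
  inferInstanceAs (Module ℂ ↥(sobolev s ⊓ oddL2))

/-- The inclusion of `H^s_odd` in `L²`. -/
def HOdd.toL2 (s : ℝ) : HOdd s →ₗ[ℂ] L2 := (sobolev s ⊓ oddL2).subtype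

/-- The map `u ↦ (1 - ∂ₓ²)^(s/2) u` from `H^s_odd` to `L²`. -/
def HOdd.bessel (s : ℝ) : HOdd s →ₗ[ℂ] L2 :=
  (FKP.bessel s).toFun ∘ₗ Submodule.inclusion (inf_le_left : sobolev s ⊓ oddL2 ≤ sobolev s)

/-- The weight `(1 + (2πη)²)^(s/2)` in the definition of `bessel`. -/
lemma norm_weight (s η : ℝ) : ‖(((1 + (2 * Real.pi * η) ^ 2) ^ (s / 2) : ℝ) : ℂ)‖
    = (1 + (2 * Real.pi * η) ^ 2) ^ (s / 2) := by
  rw [Complex.norm_real, Real.norm_of_nonneg (by positivity)]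

lemma weight_mono {s t : ℝ} (hst : s ≤ t) (η : ℝ) :
    (1 + (2 * Real.pi * η) ^ 2) ^ (s / 2) ≤ (1 + (2 * Real.pi * η) ^ 2) ^ (t / 2) :=
  Real.rpow_le_rpow_of_exponent_le (by nlinarith [sq_nonneg (2 * Real.pi * η)]) (by linarith)

lemma mem_sobolev {s : ℝ} {u : L2} : u ∈ sobolev s ↔ MemLp (fun η : ℝ =>
    (((1 + (2 * Real.pi * η) ^ 2) ^ (s / 2) : ℝ) : ℂ) * fourierL2 u η) 2 volume := Iff.rfl

lemma norm_bessel (s : ℝ) (u : L2) (hu : u ∈ sobolev s) :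
    ‖FKP.bessel s ⟨u, hu⟩‖ = ‖(MemLp.toLp _ (mem_sobolev.mp hu) : L2)‖ :=
  norm_conjOp fourierL2 _ u hu

lemma norm_bessel_mono {s t : ℝ} (hst : s ≤ t) (u : L2) (hs : u ∈ sobolev s)
    (ht : u ∈ sobolev t) : ‖FKP.bessel s ⟨u, hs⟩‖ ≤ ‖FKP.bessel t ⟨u, ht⟩‖ := by
  rw [norm_bessel, norm_bessel]
  refine Lp.norm_le_norm_of_ae_le ?_
  filter_upwards [MemLp.coeFn_toLp (mem_sobolev.mp hs),
    MemLp.coeFn_toLp (mem_sobolev.mp ht)] with η h1 h2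
  rw [h1, h2, norm_mul, norm_mul, norm_weight, norm_weight]
  exact mul_le_mul_of_nonneg_right (weight_mono hst η) (norm_nonneg _)

lemma sobolev_mono {s t : ℝ} (hst : s ≤ t) : sobolev t ≤ sobolev s := by
  intro u hu
  rw [mem_sobolev] at hu ⊢
  refine hu.of_le ?_ ?_
  · refine AEStronglyMeasurable.mul ?_ (Lp.aestronglyMeasurable _)
    refine Measurable.aestronglyMeasurable ?_
    fun_prop
  · filter_upwards with η
    rw [norm_mul, norm_mul, norm_weight, norm_weight]
    exact mul_le_mul_of_nonneg_right (weight_mono hst η) (norm_nonneg _)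

lemma norm_le_norm_bessel {s : ℝ} (hs : 0 ≤ s) (u : L2) (hu : u ∈ sobolev s) :
    ‖u‖ ≤ ‖FKP.bessel s ⟨u, hu⟩‖ := by
  rw [norm_bessel, ← fourierL2.norm_map u]
  refine Lp.norm_le_norm_of_ae_le ?_
  filter_upwards [MemLp.coeFn_toLp (mem_sobolev.mp hu)] with η h1
  rw [h1, norm_mul, norm_weight]
  refine le_mul_of_one_le_left (norm_nonneg _) ?_
  exact Real.one_le_rpow (by nlinarith [sq_nonneg (2 * Real.pi * η)]) (by linarith)

lemma HOdd.bessel_injective (s : ℝ) : Function.Injective (HOdd.bessel s) := by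
  rw [injective_iff_map_eq_zero]
  intro u hu
  have h0 : ‖FKP.bessel s ⟨u.1, u.2.1⟩‖ = 0 := norm_eq_zero.mpr hu
  rw [norm_bessel, norm_eq_zero] at h0
  have h1 : fourierL2 u.1 = 0 := by
    refine Lp.ext ?_
    have h2 := MemLp.coeFn_toLp (mem_sobolev.mp u.2.1)
    rw [h0] at h2
    filter_upwards [h2, Lp.coeFn_zero ℂ 2 (volume : Measure ℝ)] with η h3 h4
    rw [h4] at h3 ⊢
    have h5 : (((1 + (2 * Real.pi * η) ^ 2) ^ (s / 2) : ℝ) : ℂ) ≠ 0 := by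
      have : 0 < (1 + (2 * Real.pi * η) ^ 2) ^ (s / 2) := by positivity
      exact_mod_cast this.ne'
    exact (mul_eq_zero.mp h3.symm).resolve_left h5
  exact Subtype.ext ((map_eq_zero_iff fourierL2 fourierL2.injective).mp h1)

/-- The norm `‖u‖_{H^s} = ‖(1 - ∂ₓ²)^(s/2) u‖_{L²}`. -/
instance (s : ℝ) : NormedAddCommGroup (HOdd s) :=
  NormedAddCommGroup.induced (HOdd s) L2 (HOdd.bessel s) (HOdd.bessel_injective s)

instance (s : ℝ) : NormedSpace ℂ (HOdd s) :=
  NormedSpace.induced ℂ (HOdd s) L2 (HOdd.bessel s)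

/-- `X = L²_odd × H^{1+α/2}_odd` with `‖W‖_X = ‖W₁‖_{L²} + ‖W₂‖_{H^{1+α/2}}`. -/
abbrev X (α : ℝ) : Type := WithLp 1 (↥oddL2 × HOdd (1 + α / 2))

/-- `Z = H^{1+α/2}_odd × H^{2+α}_odd` with `‖W‖_Z = ‖W₁‖_{H^{1+α/2}} + ‖W₂‖_{H^{2+α}}`. -/
abbrev Z (α : ℝ) : Type := WithLp 1 (HOdd (1 + α / 2) × HOdd (2 + α))

/-- The inclusion of `Z` in `X`, as a linear map. -/
def ZtoXₗ {α : ℝ} (hα : 0 < α) : Z α →ₗ[ℂ] X α where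
  toFun W := WithLp.toLp 1
    (⟨HOdd.toL2 _ W.fst, W.fst.2.2⟩,
      ⟨HOdd.toL2 _ W.snd, sobolev_mono (by linarith) W.snd.2.1, W.snd.2.2⟩)
  map_add' _ _ := rfl
  map_smul' _ _ := rfl

/-- The continuous inclusion of `Z` in `X`. -/
def ZtoX {α : ℝ} (hα : 0 < α) : Z α →L[ℂ] X α :=
  (ZtoXₗ hα).mkContinuous 1 (by
    intro W
    rw [one_mul, WithLp.prod_norm_eq_of_L1, WithLp.prod_norm_eq_of_L1]
    refine add_le_add ?_ ?_
    · exact norm_le_norm_bessel (by linarith) _ W.fst.2.1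
    · exact norm_bessel_mono (by linarith) _ _ W.snd.2.1)

/-! ### The ground state -/

/-- The class in `L²(ℝ)` of a real function (zero if the function is not square integrable). -/
def classL2 (f : ℝ → ℝ) : L2 :=
  open Classical in
  if h : MemLp (fun x => (f x : ℂ)) 2 volume then h.toLp else 0

/-- The real function `f` belongs to `H^s(ℝ)`, for `s ≥ 0`. -/
def MemH (s : ℝ) (f : ℝ → ℝ) : Prop :=
  MemLp (fun x => (f x : ℂ)) 2 volume ∧ classL2 f ∈ sobolev s

/-- `∫ |D^s f|²`, computed on the Fourier side by Plancherel's identity. -/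
def rieszEnergy (s : ℝ) (f : ℝ → ℝ) : ℝ :=
  ∫ η : ℝ, (|2 * Real.pi * η| ^ s * ‖fourierL2 (classL2 f) η‖) ^ 2

/-- The Weinstein functional
`J(u) = (∫|u|³)⁻¹ (∫|D^{α/2}u|²)^{1/(2α)} (∫|u|²)^{(α-1)/(2α)+1}`. -/
def weinstein (α : ℝ) (u : ℝ → ℝ) : ℝ :=
  (∫ x, |u x| ^ 3)⁻¹ * (rieszEnergy (α / 2) u) ^ (1 / (2 * α))
    * (∫ x, |u x| ^ 2) ^ ((α - 1) / (2 * α) + 1)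

/-- `Q ∈ H^{α/2}(ℝ)` is a ground state of `D^α Q + Q - Q² = 0`: an even, positive solution that
minimizes the Weinstein functional over `H^{α/2}(ℝ) \ {0}`.  The equation is understood in the
sense of tempered distributions, and is written for the Fourier transforms of both sides
(where `Q² ∈ L¹`). -/
structure IsGroundState (α : ℝ) (Q : ℝ → ℝ) : Prop where
  mem : MemH (α / 2) Q
  even : ∀ᵐ x, Q (-x) = Q x
  pos : ∀ᵐ x, 0 < Q x
  solves : ∀ᵐ η : ℝ, ((|2 * Real.pi * η| ^ α + 1 : ℝ) : ℂ) * fourierL2 (classL2 Q) η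
    = 𝓕 (fun x : ℝ => ((Q x ^ 2 : ℝ) : ℂ)) η
  minimizes : ∀ u : ℝ → ℝ, MemH (α / 2) u → ¬ (∀ᵐ x, u x = 0) → weinstein α Q ≤ weinstein α u

/-- The solitary wave profile `Q_c(x) = 2c Q(c^{1/α} x)` of speed `c`. -/
def solitaryWave (α c : ℝ) (Q : ℝ → ℝ) (x : ℝ) : ℝ := 2 * c * Q (c ^ (1 / α) * x)

/-! ### The linearized operators -/

/-- `M_c = D^α - Q_c + c`. -/
def opM (α c : ℝ) (Qc : ℝ → ℝ) : L2 →ₗ.[ℂ] L2 :=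
  riesz α - mulOp (fun x => (Qc x : ℂ)) + mulOp (fun _ => (c : ℂ))

/-- `L = -∂ₓ M_c ∂ₓ` on `H^{2+α}(ℝ)` (more precisely, on those elements of `H^{2+α}(ℝ)` at which
the composition of the three operators is defined in `L²(ℝ)`). -/
def opL (α c : ℝ) (Qc : ℝ → ℝ) : L2 →ₗ.[ℂ] L2 :=
  (-(pcomp deriv (pcomp (opM α c Qc) deriv))).domRestrict (sobolev (2 + α))

/-- The unbounded operator `(W₁, W₂) ↦ (A W₂, W₁)` on `X`, i.e. the matrix `[[0, A], [1, 0]]`,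
defined where `W₁ ∈ H^{1+α/2}` and `W₂ ∈ D(A)` with `A W₂` odd. -/
def blockOp (α : ℝ) (A : L2 →ₗ.[ℂ] L2) : X α →ₗ.[ℂ] X α where
  domain :=
    { carrier := {W | (W.fst : L2) ∈ sobolev (1 + α / 2) ∧
        ∃ h : HOdd.toL2 _ W.snd ∈ A.domain, A ⟨_, h⟩ ∈ oddL2}
      zero_mem' := by
        refine ⟨Submodule.zero_mem _, Submodule.zero_mem _, ?_⟩
        have := oddL2.zero_mem
        rwa [← LinearPMap.map_zero A] at this
      add_mem' := by
        rintro U V ⟨hU, hU', hU''⟩ ⟨hV, hV', hV''⟩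
        refine ⟨Submodule.add_mem _ hU hV, Submodule.add_mem _ hU' hV', ?_⟩
        have := Submodule.add_mem _ hU'' hV''
        rwa [← LinearPMap.map_add] at this
      smul_mem' := by
        rintro a U ⟨hU, hU', hU''⟩
        refine ⟨Submodule.smul_mem _ a hU, Submodule.smul_mem _ a hU', ?_⟩
        have := Submodule.smul_mem _ a hU''
        rwa [← LinearPMap.map_smul] at this }
  toFun :=
    { toFun := fun W => WithLp.toLp 1
        (⟨A ⟨HOdd.toL2 _ W.1.snd, W.2.2.1⟩, W.2.2.2⟩, ⟨(W.1.fst : L2), W.2.1, W.1.fst.2⟩)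
      map_add' := by
        intro U V
        refine congrArg (WithLp.toLp 1) (Prod.ext (Subtype.ext ?_) rfl)
        exact LinearPMap.map_add A ⟨_, U.2.2.1⟩ ⟨_, V.2.2.1⟩
      map_smul' := by
        intro a U
        refine congrArg (WithLp.toLp 1) (Prod.ext (Subtype.ext ?_) rfl)
        exact LinearPMap.map_smul A a ⟨_, U.2.2.1⟩ }

/-- The operator `𝓛 = [[0, L], [1, 0]]` on `X`. -/
def opCalL (α c : ℝ) (Qc : ℝ → ℝ) : X α →ₗ.[ℂ] X α := blockOp α (opL α c Qc)

/-- `μ` is an eigenvalue of the unbounded operator `A`. -/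
def IsEigenvalue (A : L2 →ₗ.[ℂ] L2) (μ : ℂ) : Prop :=
  ∃ w : A.domain, (w : L2) ≠ 0 ∧ A w = μ • (w : L2)

/-- The bounded operator `R : X → Z` is the two-sided inverse of `A - μ I : D(A) ⊆ X → X`. -/
def IsResolvent {α : ℝ} (hα : 0 < α) (A : X α →ₗ.[ℂ] X α) (μ : ℂ) (R : X α →L[ℂ] Z α) : Prop :=
  (∀ F : X α, ∃ h : ZtoX hα (R F) ∈ A.domain, A ⟨_, h⟩ - μ • ZtoX hα (R F) = F) ∧
    ∀ W : A.domain, ZtoX hα (R (A W - μ • (W : X α))) = W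

end FKP

end

/-! Write W = (W₁, u) and μ = n√|λ|. The equation (𝓛 - iμ)W = F means W₁ = F₂ + iμu and Lu = F₁ +
iμW₁; eliminating W₁ leaves (L + μ²)u = F₁ + iμF₂. If L ≥ λ, then |n| ≥ 2 gives μ² ≥ 4|λ|, so L + μ²
is bounded below by ¾μ². It remains to prove L ≥ λ, to solve the equation in odd H^{2+α}, and to
find the right power of n.

Lower bound. The form of L at u is the form of M_c = D^α - Q_c + c at u'. Since Q minimizes the
Weinstein functional, the second variation there is nonnegative; once its coefficients are
identified, it says that M_c ≥ 0 on the orthogonal complement of Q_c² (`IsGroundState.variation`,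
`IsGroundState.normalization`, `IsGroundState.solitaryWave_form_nonneg`). So the form of L is
nonnegative under one linear condition. Given an eigenvector w for λ < 0, subtracting a multiple of
w enforces that condition, and symmetry gives L ≥ λ (`lower_bound_opLH`).

Regularity. These arguments need Q bounded, and L acts on all of H^{2+α} because Q is smooth. On the
Fourier side the equation bounds (1+|η|)^α |Q̂| by four times the autocorrelation of |Q̂|. Young's
and Hölder's inequalities then improve the integrability of Q̂ up to L¹, which is possible exactly
because α > 1/3 lets the iteration start (`SubSolution.lintegral_ne_top`); afterwards any polynomial
weight can be added.

Solvability. For large t the potential is a small perturbation of |D|^{2+α} - c∂ₓ² + t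
(`exists_surjective_opLH`), and one Neumann series lowers t to any value above |λ|
(`surjective_shift`). Since Q_c is even, L commutes with reflections, so odd data have odd
solutions.

Estimates. Computing ⟨W₁, (L + k)u⟩ from each of the two equations gives an identity for -iμ(⟨u, (L
+ k)u⟩ + ‖W₁‖²) (`energy_le`). With k from Gårding's inequality the bracket controls the square of
the X-norm of W, whence |μ|‖W‖_X ≲ ‖F‖_X; the term k⟨W₁, u⟩ is handled by the L² bound on u from L +
μ² ≥ ¾μ². The Z-bound follows from W₁ = F₂ + iμu and elliptic regularity
(`exists_elliptic_estimate`), both of which cost one factor |μ|. -/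

open MeasureTheory FourierTransform
open scoped ContDiff ENNReal

noncomputable section

namespace FKP

/-! ### The Fourier transform on `L²` tested against smooth functions -/

/-- A real smooth function with compact support. -/
structure IsTest (g : ℝ → ℝ) : Prop where
  smooth : ContDiff ℝ ∞ g
  compact : HasCompactSupport g

/-- A test function as a complex Schwartz function. -/
def IsTest.schwartz {g : ℝ → ℝ} (hg : IsTest g) : SchwartzMap ℝ ℂ :=
  HasCompactSupport.toSchwartzMap (f := fun x => (g x : ℂ))
    (hg.compact.comp_left (g := fun x : ℝ => (x : ℂ)) Complex.ofReal_zero)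
    (Complex.ofRealCLM.contDiff.comp hg.smooth)

lemma IsTest.schwartz_apply {g : ℝ → ℝ} (hg : IsTest g) (x : ℝ) : hg.schwartz x = g x := rfl

lemma IsTest.coe_schwartz {g : ℝ → ℝ} (hg : IsTest g) :
    (hg.schwartz : ℝ → ℂ) = fun x => (g x : ℂ) := rfl

lemma IsTest.coe_fourier_schwartz {g : ℝ → ℝ} (hg : IsTest g) :
    ((𝓕 hg.schwartz : SchwartzMap ℝ ℂ) : ℝ → ℂ) = 𝓕 (fun x => (g x : ℂ)) := by
  rw [SchwartzMap.fourier_coe, hg.coe_schwartz]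

lemma IsTest.comp_mul {g : ℝ → ℝ} (hg : IsTest g) {k : ℝ} (hk : k ≠ 0) :
    IsTest (fun x => g (k * x)) where
  smooth := hg.smooth.comp (by fun_prop)
  compact := hg.compact.comp_homeomorph (Homeomorph.mulLeft₀ k hk)

lemma IsTest.comp_add {g : ℝ → ℝ} (hg : IsTest g) (a : ℝ) : IsTest (fun x => g (x + a)) where
  smooth := hg.smooth.comp (by fun_prop)
  compact := hg.compact.comp_homeomorph (Homeomorph.addRight a)

lemma locallyIntegrable_L2 (u : L2) : LocallyIntegrable u volume :=
  (Lp.memLp u).locallyIntegrable (by norm_num)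

/-- The Fourier transform of a tempered distribution is defined by duality and extends the one on
L², so evaluating it at g is the multiplication formula. -/
lemma integral_schwartz_mul_fourierL2 (g : SchwartzMap ℝ ℂ) (u : L2) :
    ∫ η, g η * fourierL2 u η = ∫ x, (𝓕 g : SchwartzMap ℝ ℂ) x * u x := by
  have h := congrArg (fun T => T g) (Lp.fourier_toTemperedDistribution_eq u)
  simp only [TemperedDistribution.fourier_apply, Lp.toTemperedDistribution_apply,
    smul_eq_mul] at h
  exact h.symm

lemma integral_test_mul_fourierL2 {g : ℝ → ℝ} (hg : IsTest g) (u : L2) :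
    ∫ η, (g η : ℂ) * fourierL2 u η = ∫ x, 𝓕 (fun y => (g y : ℂ)) x * u x := by
  have h := integral_schwartz_mul_fourierL2 hg.schwartz u
  rwa [hg.coe_schwartz, hg.coe_fourier_schwartz] at h

/-- The Fourier transform on `L²` is characterized by its pairings with test functions. -/
lemma fourierL2_ae_eq_of_test {u : L2} {w : ℝ → ℂ} (hw : LocallyIntegrable w volume)
    (h : ∀ g : ℝ → ℝ, IsTest g →
      ∫ η, (g η : ℂ) * w η = ∫ x, 𝓕 (fun y => (g y : ℂ)) x * u x) :
    fourierL2 u =ᵐ[volume] w := by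
  refine ae_eq_of_integral_contDiff_smul_eq (locallyIntegrable_L2 _) hw fun g hg hg' => ?_
  simp only [Complex.real_smul]
  rw [h g ⟨hg, hg'⟩, integral_test_mul_fourierL2 ⟨hg, hg'⟩]

/-- On `L¹ ∩ L²` the two Fourier transforms agree. -/
lemma fourierL2_ae_eq_fourier {u : L2} (hu : Integrable u volume) :
    fourierL2 u =ᵐ[volume] 𝓕 (u : ℝ → ℂ) := by
  have hc : Continuous (𝓕 (u : ℝ → ℂ)) := by
    have := VectorFourier.fourierIntegral_continuous (L := (innerₗ ℝ)) (μ := volume)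
      Real.continuous_fourierChar (by simp only [innerₗ_apply_apply]; fun_prop) hu
    exact this
  refine fourierL2_ae_eq_of_test hc.locallyIntegrable fun g hg => ?_
  have h := VectorFourier.integral_fourierIntegral_smul_eq_flip (L := (innerₗ ℝ)) (μ := volume)
    (ν := volume) (f := fun y => (g y : ℂ)) (g := (u : ℝ → ℂ)) Real.continuous_fourierChar
    (by simp only [innerₗ_apply_apply]; fun_prop) (by
      rw [← hg.coe_schwartz]; exact hg.schwartz.integrable) hu
  simp only [smul_eq_mul] at h
  rw [flip_innerₗ] at h
  exact h.symm

lemma fourierL2_toLp_ae_eq {f : ℝ → ℂ} (hf : MemLp f 2 volume) (hf' : Integrable f volume) :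
    fourierL2 hf.toLp =ᵐ[volume] 𝓕 f := by
  have h1 := hf.coeFn_toLp
  refine (fourierL2_ae_eq_fourier (hf'.congr h1.symm)).trans ?_
  exact Filter.Eventually.of_forall fun x => Real.fourier_congr_ae h1 x

lemma fourier_comp_mul (f : ℝ → ℂ) {k : ℝ} (hk : k ≠ 0) (x : ℝ) :
    𝓕 (fun y => f (k * y)) x = (|k|⁻¹ : ℝ) * 𝓕 f (k⁻¹ * x) := by
  rw [Real.fourier_real_eq, Real.fourier_real_eq]
  have h := Measure.integral_comp_mul_left (fun y => Real.fourierChar (-(y * (k⁻¹ * x))) • f y) k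
  rw [abs_inv, Complex.real_smul] at h
  rw [← h]
  refine integral_congr_ae (Filter.Eventually.of_forall fun y => ?_)
  simp only
  congr 3
  field_simp

lemma aeeq_comp_mul {u v : ℝ → ℂ} (h : u =ᵐ[volume] v) {k : ℝ} (hk : k ≠ 0) :
    (fun x => u (k * x)) =ᵐ[volume] fun x => v (k * x) := by
  have hq : Measure.QuasiMeasurePreserving (fun x : ℝ => k * x) volume volume := by
    refine ⟨by fun_prop, ?_⟩
    rw [Real.map_volume_mul_left hk]
    exact Measure.smul_absolutelyContinuous
  exact hq.ae_eq h

lemma MemLp.comp_mul {f : ℝ → ℂ} (hf : MemLp f 2 volume) {k : ℝ} (hk : k ≠ 0) :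
    MemLp (fun x => f (k * x)) 2 volume := by
  have h : MemLp f 2 (Measure.map (fun x : ℝ => k * x) volume) := by
    rw [Real.map_volume_mul_left hk]
    exact hf.smul_measure ENNReal.ofReal_ne_top
  exact (memLp_map_measure_iff h.1 (by fun_prop)).mp h

/-- The Fourier transform of a dilated function. -/
lemma fourierL2_comp_mul {u v : L2} {k : ℝ} (hk : k ≠ 0)
    (h : v =ᵐ[volume] fun x => u (k * x)) :
    fourierL2 v =ᵐ[volume] fun η => (|k|⁻¹ : ℝ) * fourierL2 u (k⁻¹ * η) := by
  refine fourierL2_ae_eq_of_test ?_ fun g hg => ?_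
  · have := MemLp.comp_mul (Lp.memLp (fourierL2 u)) (inv_ne_zero hk)
    exact (this.const_mul ((|k|⁻¹ : ℝ) : ℂ)).locallyIntegrable (by norm_num)
  have h1 := integral_test_mul_fourierL2 (hg.comp_mul hk) u
  have h2 := Measure.integral_comp_mul_left
    (fun η => (g (k * η) : ℂ) * fourierL2 u η) k⁻¹
  rw [inv_inv] at h2
  have h3 := Measure.integral_comp_mul_left
    (fun x => 𝓕 (fun y => (g y : ℂ)) (k⁻¹ * x) * u x) k
  have e1 : ∫ x, 𝓕 (fun y => (g y : ℂ)) x * v x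
      = ∫ x, 𝓕 (fun y => (g y : ℂ)) (k⁻¹ * (k * x)) * u (k * x) := by
    refine integral_congr_ae ?_
    filter_upwards [h] with x hx
    rw [hx, inv_mul_cancel_left₀ hk]
  have e2 : ∫ η, (g η : ℂ) * ((|k|⁻¹ : ℝ) * fourierL2 u (k⁻¹ * η))
      = (|k|⁻¹ : ℝ) * ∫ η, (g (k * (k⁻¹ * η)) : ℂ) * fourierL2 u (k⁻¹ * η) := by
    rw [← integral_const_mul]
    refine integral_congr_ae (Filter.Eventually.of_forall fun η => ?_)
    simp only
    rw [mul_inv_cancel_left₀ hk]; ring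
  rw [e1, e2, h2, h3, h1]
  simp_rw [fun x => fourier_comp_mul (fun y => (g y : ℂ)) hk x, mul_assoc]
  rw [integral_const_mul, abs_inv, Complex.real_smul, Complex.real_smul]
  have : ((|k| : ℝ) : ℂ) ≠ 0 := by exact_mod_cast abs_ne_zero.mpr hk
  push_cast
  field_simp

lemma fourierL2_comp_neg {u v : L2} (h : ∀ᵐ x, v x = u (-x)) :
    ∀ᵐ η, fourierL2 v η = fourierL2 u (-η) := by
  have := fourierL2_comp_mul (u := u) (v := v) (k := -1) (by norm_num) (by
    filter_upwards [h] with x hx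
    rw [hx]; simp)
  filter_upwards [this] with η hη
  rw [hη]; norm_num

lemma star_fourier_ofReal (g : ℝ → ℝ) (x : ℝ) :
    star (𝓕 (fun y => (g y : ℂ)) x) = 𝓕 (fun y => (g y : ℂ)) (-x) := by
  rw [Real.fourier_real_eq_integral_exp_smul, Real.fourier_real_eq_integral_exp_smul,
    ← starRingEnd_apply, ← integral_conj]
  congr 1
  ext y
  simp only [smul_eq_mul, map_mul, Complex.conj_ofReal, ← Complex.exp_conj, Complex.conj_I]
  congr 2
  push_cast; ring

lemma locallyIntegrable_star_comp_neg (u : L2) :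
    LocallyIntegrable (fun η => star (u (-η))) volume := by
  have := MemLp.comp_mul (Lp.memLp u) (k := -1) (by norm_num)
  have h2 : MemLp (fun η => star (u (-1 * η))) 2 volume := this.star
  simp only [neg_mul, one_mul] at h2
  exact h2.locallyIntegrable (by norm_num)

/-- The Fourier transform of the complex conjugate. -/
lemma fourierL2_star {u v : L2} (h : ∀ᵐ x, v x = star (u x)) :
    ∀ᵐ η, fourierL2 v η = star (fourierL2 u (-η)) := by
  refine fourierL2_ae_eq_of_test (locallyIntegrable_star_comp_neg _) fun g hg => ?_
  have h1 := integral_test_mul_fourierL2 (hg.comp_mul (k := -1) (by norm_num)) u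
  have h2 : ∫ η, (g η : ℂ) * star (fourierL2 u (-η))
      = star (∫ η, (g (-1 * η) : ℂ) * fourierL2 u η) := by
    rw [← integral_neg_eq_self (fun η => (g η : ℂ) * star (fourierL2 u (-η))),
      ← starRingEnd_apply, ← integral_conj]
    simp
  have h3 : ∀ x, 𝓕 (fun y => (g (-1 * y) : ℂ)) x = star (𝓕 (fun y => (g y : ℂ)) x) := fun x => by
    rw [fourier_comp_mul (fun y => (g y : ℂ)) (by norm_num : (-1 : ℝ) ≠ 0), star_fourier_ofReal]
    norm_num
  rw [h2, h1, ← starRingEnd_apply, ← integral_conj]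
  refine integral_congr_ae ?_
  filter_upwards [h] with x hx
  rw [h3, hx]
  simp

/-- The Fourier transform of a modulated function. -/
lemma fourierL2_modulation {u v : L2} (a : ℝ)
    (h : ∀ᵐ x, v x = Real.fourierChar (-(x * a)) * u x) :
    ∀ᵐ η, fourierL2 v η = fourierL2 u (η + a) := by
  refine fourierL2_ae_eq_of_test ?_ fun g hg => ?_
  · have : MemLp (fun η => fourierL2 u (η + a)) 2 volume :=
      (Lp.memLp (fourierL2 u)).comp_measurePreserving (measurePreserving_add_right volume a)
    exact this.locallyIntegrable (by norm_num)
  have h1 := integral_test_mul_fourierL2 (hg.comp_add (-a)) u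
  rw [← integral_sub_right_eq_self (fun η => (g η : ℂ) * fourierL2 u (η + a)) a]
  simp only [sub_add_cancel]
  simp only [← sub_eq_add_neg] at h1
  rw [h1]
  refine integral_congr_ae ?_
  filter_upwards [h] with x hx
  rw [hx, Real.fourier_real_eq, Real.fourier_real_eq,
    ← integral_sub_right_eq_self (fun y => Real.fourierChar (-(y * x)) • (g y : ℂ)) a,
    ← mul_assoc, mul_comm _ (Real.fourierChar _ : ℂ), ← integral_const_mul]
  congr 1
  refine integral_congr_ae (Filter.Eventually.of_forall fun y => ?_)
  simp only [Circle.smul_def, smul_eq_mul]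
  rw [← mul_assoc, ← Circle.coe_mul, ← AddChar.map_add_eq_mul]
  congr 3
  ring

/-! ### Convolution inequalities -/

/-- The autocorrelation `η ↦ ∫ G(ζ) G(ζ + η) dζ`. -/
def autocorr (G : ℝ → ℝ≥0∞) (η : ℝ) : ℝ≥0∞ := ∫⁻ ζ, G ζ * G (ζ + η)

lemma measurable_autocorr {G : ℝ → ℝ≥0∞} (hG : Measurable G) : Measurable (autocorr G) := by
  unfold autocorr
  exact Measurable.lintegral_prod_right' (f := fun p : ℝ × ℝ => G p.2 * G (p.2 + p.1))
    (by fun_prop)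

lemma lintegral_autocorr {G : ℝ → ℝ≥0∞} (hG : Measurable G) :
    ∫⁻ η, autocorr G η = (∫⁻ ζ, G ζ) * ∫⁻ ζ, G ζ := by
  unfold autocorr
  rw [lintegral_lintegral_swap (by fun_prop)]
  have h : ∀ ζ, ∫⁻ η, G ζ * G (ζ + η) = G ζ * ∫⁻ η, G η := fun ζ => by
    rw [lintegral_const_mul _ (by fun_prop), lintegral_add_left_eq_self]
  simp_rw [h]
  rw [lintegral_mul_const _ hG]

/-- Young's inequality for the autocorrelation. -/
lemma lintegral_autocorr_rpow_ne_top {G : ℝ → ℝ≥0∞} (hG : Measurable G) {x : ℝ} (hx : 1 / 2 < x)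
    (hx1 : x ≤ 1) (h : ∫⁻ ζ, G ζ ^ (1 / x) ≠ ⊤) :
    ∫⁻ η, autocorr G η ^ (1 / (2 * x - 1)) ≠ ⊤ := by
  set H : ℝ → ℝ≥0∞ := fun ζ => G ζ ^ (1 / x) with hH
  have hHm : Measurable H := hG.pow_const _
  have hx0 : 0 < x := by linarith
  have hy : 0 < 2 * x - 1 := by linarith
  -- With H = G^{1/x}, Hölder for three factors is applied to G(ζ)G(ζ+η) = (H(ζ)H(ζ+η))^{2x-1} ·
  -- H(ζ)^{1-x} · H(ζ+η)^{1-x}. Raised to the power 1/(2x-1), the bound is linear in the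
  -- autocorrelation of H, whose integral is (∫H)².
  have hpt : ∀ η, autocorr G η ≤ autocorr H η ^ (2 * x - 1) * (∫⁻ ζ, H ζ) ^ (2 * (1 - x)) := by
    intro η
    have := ENNReal.lintegral_prod_norm_pow_le (μ := (volume : Measure ℝ)) (Finset.univ : Finset (Fin 3))
      (f := ![fun ζ => H ζ * H (ζ + η), H, fun ζ => H (ζ + η)])
      (p := ![2 * x - 1, 1 - x, 1 - x])
      (by
        intro i _
        fin_cases i
        · exact (hHm.mul (hHm.comp (measurable_add_const η))).aemeasurable
        · exact hHm.aemeasurable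
        · exact (hHm.comp (measurable_add_const η)).aemeasurable)
      (by simp [Fin.sum_univ_three]; ring)
      (by intro i _; fin_cases i <;> simp <;> linarith)
    simp only [Fin.prod_univ_three, Matrix.cons_val_zero, Matrix.cons_val_one,
      Matrix.cons_val] at this
    have e1 : ∀ ζ, (H ζ * H (ζ + η)) ^ (2 * x - 1) * H ζ ^ (1 - x) * H (ζ + η) ^ (1 - x)
        = G ζ * G (ζ + η) := by
      intro ζ
      rw [ENNReal.mul_rpow_of_nonneg _ _ hy.le]
      have key : ∀ a : ℝ≥0∞, (a ^ (1 / x)) ^ (2 * x - 1) * (a ^ (1 / x)) ^ (1 - x) = a := by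
        intro a
        rw [← ENNReal.rpow_add_of_nonneg _ _ hy.le (by linarith), ← ENNReal.rpow_mul]
        have : 1 / x * (2 * x - 1 + (1 - x)) = 1 := by field_simp; ring
        rw [this, ENNReal.rpow_one]
      calc _ = (H ζ ^ (2 * x - 1) * H ζ ^ (1 - x))
            * (H (ζ + η) ^ (2 * x - 1) * H (ζ + η) ^ (1 - x)) := by ring
        _ = _ := by simp only [hH]; rw [key, key]
    simp_rw [e1] at this
    refine this.trans_eq ?_
    rw [lintegral_add_right_eq_self H η, mul_assoc,
      ← ENNReal.rpow_add_of_nonneg _ _ (by linarith) (by linarith), ← two_mul]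
    rfl
  have h2 : ∀ η, autocorr G η ^ (1 / (2 * x - 1))
      ≤ autocorr H η * (∫⁻ ζ, H ζ) ^ (2 * (1 - x) * (1 / (2 * x - 1))) := by
    intro η
    refine (ENNReal.rpow_le_rpow (hpt η) (by positivity)).trans_eq ?_
    rw [ENNReal.mul_rpow_of_nonneg _ _ (by positivity), ← ENNReal.rpow_mul, ← ENNReal.rpow_mul,
      mul_one_div_cancel hy.ne', ENNReal.rpow_one]
  refine ne_top_of_le_ne_top ?_ (lintegral_mono h2)
  rw [lintegral_mul_const _ (measurable_autocorr hHm), lintegral_autocorr hHm]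
  refine ENNReal.mul_ne_top (ENNReal.mul_ne_top h h) (ENNReal.rpow_ne_top_of_nonneg ?_ h)
  have : 0 ≤ 1 - x := by linarith
  positivity

/-- Multiplication by a decaying weight improves integrability. -/
lemma lintegral_weight_mul_rpow_ne_top {h : ℝ → ℝ≥0∞} (hh : Measurable h) {β y z : ℝ}
    (hy : 0 < y) (hyz : y < z) (hz : z < y + β) (hfin : ∫⁻ η, h η ^ (1 / y) ≠ ⊤) :
    ∫⁻ η, (ENNReal.ofReal ((1 + |η|) ^ (-β)) * h η) ^ (1 / z) ≠ ⊤ := by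
  have hz0 : 0 < z := hy.trans hyz
  -- Hölder with the weights y/z and 1 - y/z. The factor left to the decaying weight is integrable
  -- because β/(z - y) > 1.
  set w : ℝ → ℝ≥0∞ := fun η => ENNReal.ofReal ((1 + |η|) ^ (-(β / (z - y)))) with hw
  have hwm : Measurable w := by fun_prop
  have hwfin : ∫⁻ η, w η ≠ ⊤ := by
    have := finite_integral_one_add_norm (E := ℝ) (μ := volume) (r := β / (z - y)) (by
      rw [Module.finrank_self, Nat.cast_one, lt_div_iff₀ (by linarith)]; linarith)
    simpa using this.ne
  have key := ENNReal.lintegral_mul_norm_pow_le (μ := (volume : Measure ℝ))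
    (f := fun η => h η ^ (1 / y)) (g := w) (hh.pow_const _).aemeasurable hwm.aemeasurable
    (p := y / z) (q := 1 - y / z) (by positivity)
    (by rw [sub_nonneg, div_le_one hz0]; exact hyz.le) (by ring)
  refine ne_top_of_le_ne_top ?_ ((lintegral_congr fun η => ?_).trans_le key)
  · refine ENNReal.mul_ne_top (ENNReal.rpow_ne_top_of_nonneg (by positivity) hfin)
      (ENNReal.rpow_ne_top_of_nonneg ?_ hwfin)
    rw [sub_nonneg, div_le_one hz0]; exact hyz.le
  · rw [ENNReal.mul_rpow_of_nonneg _ _ (by positivity), mul_comm, ← ENNReal.rpow_mul]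
    congr 1
    · congr 1; field_simp
    · have h1 : 0 < 1 + |η| := by positivity
      simp only [hw]
      rw [ENNReal.ofReal_rpow_of_pos (by positivity), ENNReal.ofReal_rpow_of_pos (by positivity),
        ← Real.rpow_mul h1.le, ← Real.rpow_mul h1.le]
      congr 2
      have : z - y ≠ 0 := by linarith
      field_simp

/-! ### Bootstrapping on the Fourier side -/

section Bootstrap

variable {G : ℝ → ℝ≥0∞} {α C : ℝ}

/-- The inequality satisfied by the modulus of the Fourier transform of a solution. -/
def SubSolution (α C : ℝ) (G : ℝ → ℝ≥0∞) : Prop :=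
  ∀ᵐ η : ℝ, ENNReal.ofReal ((1 + |η|) ^ α) * G η ≤ ENNReal.ofReal C * autocorr G η

lemma SubSolution.le (hs : SubSolution α C G) :
    ∀ᵐ η : ℝ, G η ≤ ENNReal.ofReal ((1 + |η|) ^ (-α)) * (ENNReal.ofReal C * autocorr G η) := by
  filter_upwards [hs] with η hη
  refine le_trans ?_ (mul_le_mul_right hη _)
  rw [← mul_assoc, ← ENNReal.ofReal_mul (by positivity), ← Real.rpow_add (by positivity)]
  simp

/-- Integrability is measured by the reciprocal x of the Lebesgue exponent, the goal being x = 1.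
Young's inequality lowers x to 2x - 1, and dividing by the weight (1+|η|)^α raises it by anything
less than α; the net effect is a gain when x > 1 - α. -/
lemma SubSolution.improve_integrability (hs : SubSolution α C G) (hG : Measurable G) {x z : ℝ} (hx : 1 / 2 < x)
    (hx1 : x ≤ 1) (h1 : 2 * x - 1 < z) (h2 : z < 2 * x - 1 + α)
    (h : ∫⁻ ζ, G ζ ^ (1 / x) ≠ ⊤) : ∫⁻ ζ, G ζ ^ (1 / z) ≠ ⊤ := by
  have hz : 0 < z := by linarith
  have hy : 0 < 1 / (2 * x - 1) := by apply one_div_pos.mpr; linarith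
  have hm := measurable_autocorr hG
  have := lintegral_weight_mul_rpow_ne_top (h := fun η => ENNReal.ofReal C * autocorr G η)
    (hm.const_mul _) (β := α) (y := 2 * x - 1) (z := z) (by linarith) h1 h2 (by
      simp_rw [ENNReal.mul_rpow_of_nonneg _ _ hy.le]
      rw [lintegral_const_mul _ (hm.pow_const _)]
      exact ENNReal.mul_ne_top (ENNReal.rpow_ne_top_of_nonneg hy.le ENNReal.ofReal_ne_top)
        (lintegral_autocorr_rpow_ne_top hG hx hx1 h))
  refine ne_top_of_le_ne_top this (lintegral_mono_ae ?_)
  filter_upwards [hs.le] with η hη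
  exact ENNReal.rpow_le_rpow hη (by positivity)

/-- The hypothesis `h0` and Hölder give the reciprocal exponents between 1/2 and (1+α)/2, while the
iteration gains only above 1 - α. The two ranges meet precisely when α > 1/3. -/
lemma SubSolution.lintegral_ne_top (hs : SubSolution α C G) (hG : Measurable G)
    (hα : 1 / 3 < α)
    (h0 : ∫⁻ η, (ENNReal.ofReal ((1 + |η|) ^ (α / 2)) * G η) ^ (2 : ℝ) ≠ ⊤) :
    ∫⁻ η, G η ≠ ⊤ := by
  obtain ⟨x₀, hx₀, hx₀'⟩ : ∃ x, max (1 / 2) (1 - α) < x ∧ x < min 1 ((1 + α) / 2) :=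
    exists_between (by rw [max_lt_iff, lt_min_iff, lt_min_iff]; refine ⟨⟨?_, ?_⟩, ?_, ?_⟩ <;> linarith)
  rw [max_lt_iff] at hx₀
  rw [lt_min_iff] at hx₀'
  have hstart : ∫⁻ ζ, G ζ ^ (1 / x₀) ≠ ⊤ := by
    have := lintegral_weight_mul_rpow_ne_top
      (h := fun η => ENNReal.ofReal ((1 + |η|) ^ (α / 2)) * G η) (by fun_prop) (β := α / 2)
      (y := 1 / 2) (z := x₀) (by norm_num) hx₀.1 (by linarith [hx₀'.2])
      (by simpa using h0)
    refine ne_top_of_le_ne_top this (lintegral_mono fun η => ?_)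
    refine ENNReal.rpow_le_rpow ?_ (by have := hx₀.1; positivity)
    rw [← mul_assoc, ← ENNReal.ofReal_mul (by positivity), ← Real.rpow_add (by positivity)]
    simp
  -- From any x ≥ x₀ the admissible z reach up to x + (x - (1 - α)) ≥ x + δ. Steps of fixed length
  -- δ/2 are therefore allowed, and finitely many of them reach 1.
  set δ := x₀ - (1 - α) with hδ
  have hδ0 : 0 < δ := by linarith [hx₀.2]
  have hiter : ∀ k : ℕ, ∫⁻ ζ, G ζ ^ (1 / min 1 (x₀ + k * (δ / 2))) ≠ ⊤ := by
    intro k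
    induction k with
    | zero => simpa [min_eq_right hx₀'.1.le] using hstart
    | succ k ih =>
      rcases le_or_gt 1 (x₀ + k * (δ / 2)) with h | h
      · rw [min_eq_left h] at ih
        rwa [min_eq_left]
        push_cast; linarith
      · rw [min_eq_right h.le] at ih
        have hk : 0 ≤ (k : ℝ) * (δ / 2) := by positivity
        refine hs.improve_integrability hG (by linarith [hx₀.1]) h.le ?_ ?_ ih
        · rw [lt_min_iff]; push_cast; constructor <;> linarith
        · rw [min_lt_iff]; push_cast; right; linarith
  obtain ⟨k, hk⟩ := exists_nat_gt ((1 - x₀) / (δ / 2))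
  have := hiter k
  rw [div_lt_iff₀ (by linarith)] at hk
  rw [min_eq_left (by linarith)] at this
  simpa using this

/-- The weight is submultiplicative: 1 + |η| ≤ (1+|ζ|)(1+|ζ+η|). It can thus be moved inside the
autocorrelation, whose integral is a product of weighted L¹ norms, and the inequality for G yields α
further powers. -/
lemma SubSolution.lintegral_weight_step (hs : SubSolution α C G) (hG : Measurable G) {s : ℝ}
    (hs0 : 0 ≤ s) (h : ∫⁻ η, ENNReal.ofReal ((1 + |η|) ^ s) * G η ≠ ⊤) :
    ∫⁻ η, ENNReal.ofReal ((1 + |η|) ^ (s + α)) * G η ≠ ⊤ := by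
  set W : ℝ → ℝ≥0∞ := fun η => ENNReal.ofReal ((1 + |η|) ^ s) * G η with hW
  have hWm : Measurable W := by fun_prop
  have key : ∀ᵐ η, ENNReal.ofReal ((1 + |η|) ^ (s + α)) * G η
      ≤ ENNReal.ofReal C * autocorr W η := by
    filter_upwards [hs] with η hη
    rw [Real.rpow_add (by positivity), ENNReal.ofReal_mul (by positivity), mul_assoc]
    refine (mul_le_mul_right hη _).trans ?_
    rw [mul_left_comm]
    refine mul_le_mul_right ?_ _
    unfold autocorr
    rw [← lintegral_const_mul _ (by fun_prop)]
    refine lintegral_mono fun ζ => ?_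
    simp only [hW]
    rw [mul_mul_mul_comm, ← ENNReal.ofReal_mul (by positivity),
      ← Real.mul_rpow (by positivity) (by positivity)]
    refine mul_le_mul_left (ENNReal.ofReal_le_ofReal ?_) _
    refine Real.rpow_le_rpow (by positivity) ?_ hs0
    have h1 : |η| ≤ |ζ| + |ζ + η| := by
      calc |η| = |(ζ + η) - ζ| := by ring_nf
        _ ≤ _ := (abs_sub _ _).trans_eq (add_comm _ _)
    nlinarith [abs_nonneg ζ, abs_nonneg (ζ + η)]
  refine ne_top_of_le_ne_top ?_ (lintegral_mono_ae key)
  rw [lintegral_const_mul _ (measurable_autocorr hWm), lintegral_autocorr hWm]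
  exact ENNReal.mul_ne_top ENNReal.ofReal_ne_top (ENNReal.mul_ne_top h h)

lemma SubSolution.lintegral_weight_ne_top (hs : SubSolution α C G) (hG : Measurable G)
    (hα : 1 / 3 < α)
    (h0 : ∫⁻ η, (ENNReal.ofReal ((1 + |η|) ^ (α / 2)) * G η) ^ (2 : ℝ) ≠ ⊤) (s : ℝ) :
    ∫⁻ η, ENNReal.ofReal ((1 + |η|) ^ s) * G η ≠ ⊤ := by
  have hk : ∀ k : ℕ, ∫⁻ η, ENNReal.ofReal ((1 + |η|) ^ (k * α)) * G η ≠ ⊤ := by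
    intro k
    induction k with
    | zero => simpa using hs.lintegral_ne_top hG hα h0
    | succ k ih =>
      have := hs.lintegral_weight_step hG (by positivity) ih
      simpa [add_mul] using this
  obtain ⟨k, hk'⟩ := exists_nat_gt (s / α)
  rw [div_lt_iff₀ (by linarith)] at hk'
  refine ne_top_of_le_ne_top (hk k) (lintegral_mono fun η => ?_)
  refine mul_le_mul_left (ENNReal.ofReal_le_ofReal ?_) _
  exact Real.rpow_le_rpow_of_exponent_le (by linarith [abs_nonneg η]) hk'.le

/-- Cauchy–Schwarz and translation invariance. -/
lemma autocorr_le (hG : Measurable G) (η : ℝ) : autocorr G η ≤ ∫⁻ ζ, G ζ ^ (2 : ℝ) := by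
  have := ENNReal.lintegral_mul_le_Lp_mul_Lq (volume : Measure ℝ) Real.HolderConjugate.two_two
    (f := G) (g := fun ζ => G (ζ + η)) hG.aemeasurable
    (hG.comp (measurable_add_const η)).aemeasurable
  rw [lintegral_add_right_eq_self (fun ζ => G ζ ^ (2 : ℝ)) η,
    ← ENNReal.rpow_add_of_nonneg _ _ (by norm_num) (by norm_num)] at this
  norm_num at this
  simpa [autocorr] using this

/-- The autocorrelation of an L² function is bounded, so G ≤ M almost everywhere, and G² ≤ M·G
reduces the weighted L² norm to the weighted L¹ norm with twice the exponent. -/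
lemma SubSolution.lintegral_weight_sq_ne_top (hs : SubSolution α C G) (hG : Measurable G)
    (hα : 1 / 3 < α)
    (h0 : ∫⁻ η, (ENNReal.ofReal ((1 + |η|) ^ (α / 2)) * G η) ^ (2 : ℝ) ≠ ⊤) (s : ℝ) :
    ∫⁻ η, (ENNReal.ofReal ((1 + |η|) ^ s) * G η) ^ (2 : ℝ) ≠ ⊤ := by
  set M := ENNReal.ofReal C * ∫⁻ ζ, G ζ ^ (2 : ℝ) with hM
  have hMfin : M ≠ ⊤ := by
    refine ENNReal.mul_ne_top ENNReal.ofReal_ne_top (ne_top_of_le_ne_top h0 ?_)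
    refine lintegral_mono fun η => ENNReal.rpow_le_rpow ?_ (by norm_num)
    refine le_mul_of_one_le_left zero_le ?_
    rw [ENNReal.one_le_ofReal]
    exact Real.one_le_rpow (by linarith [abs_nonneg η]) (by linarith)
  have hb : ∀ᵐ η, G η ≤ M := by
    filter_upwards [hs] with η hη
    refine le_trans ?_ (hη.trans (mul_le_mul_right (autocorr_le hG η) _))
    refine le_mul_of_one_le_left zero_le ?_
    rw [ENNReal.one_le_ofReal]
    exact Real.one_le_rpow (by linarith [abs_nonneg η]) (by linarith)
  have := ENNReal.mul_ne_top hMfin (hs.lintegral_weight_ne_top hG hα h0 (s * 2))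
  rw [← lintegral_const_mul _ (by fun_prop)] at this
  refine ne_top_of_le_ne_top this (lintegral_mono_ae ?_)
  filter_upwards [hb] with η hη
  rw [ENNReal.mul_rpow_of_nonneg _ _ (by norm_num), ENNReal.ofReal_rpow_of_pos (by positivity),
    ← Real.rpow_mul (by positivity), mul_left_comm]
  refine mul_le_mul_right ?_ _
  rw [ENNReal.rpow_two, sq]
  exact mul_le_mul_left hη _

end Bootstrap

/-! ### Regularity of ground states -/

lemma classL2_ae_eq {f : ℝ → ℝ} (hf : MemLp (fun x => (f x : ℂ)) 2 volume) :
    classL2 f =ᵐ[volume] fun x => (f x : ℂ) := by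
  rw [classL2, dif_pos hf]
  exact hf.coeFn_toLp

lemma inner_L2 (u v : L2) : inner ℂ u v = ∫ x, star (u x) * v x := by
  rw [L2.inner_def]
  refine integral_congr_ae (Filter.Eventually.of_forall fun x => ?_)
  simp only [RCLike.inner_apply, starRingEnd_apply]
  ring

lemma MemLp.mul_fourierChar {f : ℝ → ℂ} (hf : MemLp f 2 volume) (a : ℝ) :
    MemLp (fun x => (Real.fourierChar (-(x * a)) : ℂ) * f x) 2 volume := by
  refine hf.of_le ?_ (Filter.Eventually.of_forall fun x => by
    rw [norm_mul, Circle.norm_coe, one_mul])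
  refine AEStronglyMeasurable.mul ?_ hf.1
  have : Continuous fun x : ℝ => (Real.fourierChar (-(x * a)) : ℂ) := by fun_prop
  exact this.aestronglyMeasurable

/-- The transform of f² at η is the inner product of f with f modulated by η. By Plancherel it can
be computed from the transforms, where the modulation is a translation by η. -/
lemma enorm_fourier_sq_le {f : ℝ → ℝ} (hf : MemLp (fun x => (f x : ℂ)) 2 volume) (η : ℝ) :
    ‖𝓕 (fun x : ℝ => ((f x ^ 2 : ℝ) : ℂ)) η‖ₑ
      ≤ autocorr (fun ζ => ‖fourierL2 (classL2 f) ζ‖ₑ) η := by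
  set u := classL2 f with hu
  have hu' := classL2_ae_eq hf
  have hm := MemLp.mul_fourierChar (Lp.memLp u) η
  set v : L2 := hm.toLp with hv
  have hv' : ∀ᵐ x, v x = Real.fourierChar (-(x * η)) * u x := hm.coeFn_toLp
  have h1 : 𝓕 (fun x : ℝ => ((f x ^ 2 : ℝ) : ℂ)) η = inner ℂ u v := by
    rw [inner_L2, Real.fourier_real_eq]
    refine integral_congr_ae ?_
    filter_upwards [hu', hv'] with x hx hx'
    rw [hx', hx, Circle.smul_def]
    simp only [smul_eq_mul, Complex.star_def, Complex.conj_ofReal]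
    push_cast; ring
  rw [h1, ← fourierL2.inner_map_map, inner_L2]
  refine (enorm_integral_le_lintegral_enorm _).trans_eq ?_
  unfold autocorr
  refine lintegral_congr_ae ?_
  filter_upwards [fourierL2_modulation η hv'] with ζ hζ
  rw [hζ, enorm_mul]
  congr 1
  simp [enorm_eq_nnnorm]

lemma one_add_abs_rpow_le {s : ℝ} (hs : 0 ≤ s) (η : ℝ) :
    (1 + |η|) ^ s ≤ 2 ^ (s / 2) * (1 + (2 * Real.pi * η) ^ 2) ^ (s / 2) := by
  rw [← Real.mul_rpow (by norm_num) (by positivity)]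
  have h1 : (1 + |η|) ^ s = ((1 + |η|) ^ 2) ^ (s / 2) := by
    rw [← Real.rpow_natCast, ← Real.rpow_mul (by positivity)]
    congr 1; push_cast; ring
  rw [h1]
  refine Real.rpow_le_rpow (by positivity) ?_ (by linarith)
  have h2 : |η| ^ 2 = η ^ 2 := sq_abs η
  have h3 : 1 ≤ 2 * Real.pi := by linarith [Real.pi_gt_three]
  have h4 : η ^ 2 ≤ (2 * Real.pi * η) ^ 2 := by
    rw [mul_pow]
    exact le_mul_of_one_le_left (sq_nonneg _) (one_le_pow₀ h3)
  nlinarith [sq_nonneg (1 - |η|)]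

lemma bessel_weight_le {s : ℝ} (hs : 0 ≤ s) (η : ℝ) :
    (1 + (2 * Real.pi * η) ^ 2) ^ (s / 2) ≤ (2 * Real.pi) ^ s * (1 + |η|) ^ s := by
  have hpi := Real.pi_gt_three
  rw [← Real.mul_rpow (by positivity) (by positivity)]
  have h1 : (2 * Real.pi * (1 + |η|)) ^ s = ((2 * Real.pi * (1 + |η|)) ^ 2) ^ (s / 2) := by
    rw [← Real.rpow_natCast, ← Real.rpow_mul (by positivity)]
    congr 1; push_cast; ring
  rw [h1]
  refine Real.rpow_le_rpow (by positivity) ?_ (by linarith)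
  have h2 : |η| ^ 2 = η ^ 2 := sq_abs η
  have h3 : 1 ≤ (2 * Real.pi) ^ 2 := one_le_pow₀ (by linarith)
  have h4 : 0 ≤ (2 * Real.pi) ^ 2 * |η| := by positivity
  calc 1 + (2 * Real.pi * η) ^ 2 ≤ (2 * Real.pi) ^ 2 * 1 + (2 * Real.pi) ^ 2 * |η| ^ 2 := by
        rw [h2, mul_pow]; linarith
    _ ≤ _ := by rw [mul_pow]; nlinarith

lemma one_add_abs_rpow_le_riesz {α : ℝ} (h0 : 0 ≤ α) (h2 : α ≤ 2) (η : ℝ) :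
    (1 + |η|) ^ α ≤ 4 * (|2 * Real.pi * η| ^ α + 1) := by
  have hm : 1 + |η| ≤ 2 * max 1 |η| := by
    have := le_max_left 1 |η|
    have := le_max_right 1 |η|
    linarith
  have h2π : |η| ≤ |2 * Real.pi * η| := by
    rw [abs_mul, abs_of_pos (by positivity : 0 < 2 * Real.pi)]
    exact le_mul_of_one_le_left (abs_nonneg _) (by linarith [Real.pi_gt_three])
  have h4 : (2 : ℝ) ^ α ≤ 4 := by
    calc (2 : ℝ) ^ α ≤ 2 ^ (2 : ℝ) := Real.rpow_le_rpow_of_exponent_le (by norm_num) h2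
      _ = 4 := by norm_num
  calc (1 + |η|) ^ α ≤ (2 * max 1 |η|) ^ α := Real.rpow_le_rpow (by positivity) hm h0
    _ = 2 ^ α * (max 1 |η|) ^ α := Real.mul_rpow (by norm_num) (by positivity)
    _ ≤ 4 * (|2 * Real.pi * η| ^ α + 1) := by
      refine mul_le_mul h4 ?_ (by positivity) (by norm_num)
      rcases max_choice 1 |η| with h | h
      · rw [h, Real.one_rpow]
        have : 0 ≤ |2 * Real.pi * η| ^ α := by positivity
        linarith
      · rw [h]
        have := Real.rpow_le_rpow (abs_nonneg _) h2π h0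
        linarith

/-- The Fourier transform of `u` is integrable against all polynomial weights, and `u` belongs to
all Sobolev spaces. -/
structure FourierDecay (u : L2) : Prop where
  integrable : ∀ s : ℝ, Integrable (fun η => (1 + |η|) ^ s * ‖fourierL2 u η‖) volume
  memSobolev : ∀ s : ℝ, u ∈ sobolev s

/-- The constant 4 comes from (1+|η|)^α ≤ 4(|2πη|^α + 1), where α ≤ 2 is used. -/
lemma IsGroundState.subSolution {α : ℝ} {Q : ℝ → ℝ} (hQ : IsGroundState α Q) (h0 : 0 ≤ α)
    (h2 : α ≤ 2) : SubSolution α 4 (fun η => ‖fourierL2 (classL2 Q) η‖ₑ) := by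
  filter_upwards [hQ.solves] with η hη
  have h1 := enorm_fourier_sq_le hQ.mem.1 η
  rw [← hη, enorm_mul] at h1
  refine le_trans ?_ (mul_le_mul_right h1 _)
  rw [← mul_assoc]
  refine mul_le_mul_left ?_ _
  rw [← ofReal_norm, ← ENNReal.ofReal_mul (by norm_num), Complex.norm_real,
    Real.norm_of_nonneg (by positivity)]
  exact ENNReal.ofReal_le_ofReal (one_add_abs_rpow_le_riesz h0 h2 η)

lemma lintegral_weight_sq_ne_top_of_mem_sobolev {u : L2} {s : ℝ} (hs : 0 ≤ s)
    (hu : u ∈ sobolev s) :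
    ∫⁻ η, (ENNReal.ofReal ((1 + |η|) ^ s) * ‖fourierL2 u η‖ₑ) ^ (2 : ℝ) ≠ ⊤ := by
  have h := ((mem_sobolev.mp hu).const_mul ((2 ^ (s / 2) : ℝ) : ℂ)).2
  rw [eLpNorm_lt_top_iff_lintegral_rpow_enorm_lt_top (by norm_num) (by norm_num)] at h
  refine ne_top_of_le_ne_top h.ne (lintegral_mono fun η => ?_)
  rw [ENNReal.toReal_ofNat]
  refine ENNReal.rpow_le_rpow ?_ (by norm_num)
  rw [enorm_mul, enorm_mul, ← mul_assoc]
  refine mul_le_mul_left ?_ _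
  rw [← enorm_mul, ← ofReal_norm, norm_mul, norm_weight, Complex.norm_real,
    Real.norm_of_nonneg (by positivity)]
  exact ENNReal.ofReal_le_ofReal (one_add_abs_rpow_le hs η)

lemma mem_sobolev_of_lintegral {u : L2} {s : ℝ} (hs : 0 ≤ s)
    (h : ∫⁻ η, (ENNReal.ofReal ((1 + |η|) ^ s) * ‖fourierL2 u η‖ₑ) ^ (2 : ℝ) ≠ ⊤) :
    u ∈ sobolev s := by
  have hm : MemLp (fun η => (((1 + |η|) ^ s : ℝ) : ℂ) * fourierL2 u η) 2 volume := by
    refine ⟨AEStronglyMeasurable.mul (Measurable.aestronglyMeasurable (by fun_prop))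
      (Lp.aestronglyMeasurable _), ?_⟩
    rw [eLpNorm_lt_top_iff_lintegral_rpow_enorm_lt_top (by norm_num) (by norm_num)]
    refine lt_of_le_of_lt (lintegral_mono fun η => ?_) h.lt_top
    rw [ENNReal.toReal_ofNat, enorm_mul, ← ofReal_norm, Complex.norm_real,
      Real.norm_of_nonneg (by positivity)]
  rw [mem_sobolev]
  refine (hm.const_mul (((2 * Real.pi) ^ s : ℝ) : ℂ)).of_le
    (AEStronglyMeasurable.mul (Measurable.aestronglyMeasurable (by fun_prop))
      (Lp.aestronglyMeasurable _)) (Filter.Eventually.of_forall fun η => ?_)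
  rw [norm_mul, norm_weight, norm_mul, norm_mul, ← mul_assoc, Complex.norm_real,
    Complex.norm_real, Real.norm_of_nonneg (by positivity), Real.norm_of_nonneg (by positivity)]
  exact mul_le_mul_of_nonneg_right (bessel_weight_le hs η) (norm_nonneg _)

lemma IsGroundState.fourierDecay {α : ℝ} {Q : ℝ → ℝ} (hQ : IsGroundState α Q) (hα : 1 / 3 < α)
    (h2 : α ≤ 2) : FourierDecay (classL2 Q) := by
  have hs := hQ.subSolution (by linarith) h2
  have hG : Measurable fun η => ‖fourierL2 (classL2 Q) η‖ₑ :=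
    (Lp.stronglyMeasurable _).measurable.enorm
  have h0 := lintegral_weight_sq_ne_top_of_mem_sobolev (by linarith) hQ.mem.2
  constructor
  · intro s
    refine ⟨(Measurable.aestronglyMeasurable (by fun_prop)).mul
      (Lp.aestronglyMeasurable _).norm, ?_⟩
    rw [hasFiniteIntegral_iff_enorm]
    refine lt_of_eq_of_lt (lintegral_congr fun η => ?_)
      (hs.lintegral_weight_ne_top hG hα h0 s).lt_top
    rw [enorm_mul, enorm_norm, Real.enorm_of_nonneg (by positivity)]
  · intro s
    refine sobolev_mono (le_max_left s 0) (mem_sobolev_of_lintegral (le_max_right s 0) ?_)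
    exact hs.lintegral_weight_sq_ne_top hG hα h0 _

lemma continuous_fourier {f : ℝ → ℂ} (hf : Integrable f volume) : Continuous (𝓕 f) :=
  VectorFourier.fourierIntegral_continuous (L := (innerₗ ℝ)) (μ := volume)
    Real.continuous_fourierChar (by simp only [innerₗ_apply_apply]; fun_prop) hf

/-- Fourier inversion for `L²` functions with integrable Fourier transform. -/
lemma ae_eq_fourierInv {u : L2} (hu : Integrable (fourierL2 u) volume) :
    u =ᵐ[volume] 𝓕⁻ (fourierL2 u : ℝ → ℂ) := by
  have hneg : Integrable (fun η => fourierL2 u (-η)) volume := hu.comp_neg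
  have hc : Continuous (𝓕⁻ (fourierL2 u : ℝ → ℂ)) := by
    rw [Real.fourierInv_eq_fourier_comp_neg]
    exact continuous_fourier hneg
  refine ae_eq_of_integral_contDiff_smul_eq (locallyIntegrable_L2 _) hc.locallyIntegrable
    fun g hg hg' => ?_
  simp only [Complex.real_smul]
  have ht : IsTest g := ⟨hg, hg'⟩
  have h1 := congrArg (fun T => T ht.schwartz)
    (Lp.fourierInv_toTemperedDistribution_eq (fourierL2 u))
  have e : 𝓕⁻ (fourierL2 u) = u := fourierL2.symm_apply_apply u
  simp only [TemperedDistribution.fourierInv_apply, Lp.toTemperedDistribution_apply,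
    smul_eq_mul, e, ht.schwartz_apply] at h1
  rw [← h1, SchwartzMap.fourierInv_coe, ht.coe_schwartz]
  have h2 := VectorFourier.integral_fourierIntegral_smul_eq_flip (L := (innerₗ ℝ)) (μ := volume)
    (ν := volume) (f := fun y => (g y : ℂ)) (g := fun η => fourierL2 u (-η))
    Real.continuous_fourierChar (by simp only [innerₗ_apply_apply]; fun_prop) (by
      rw [← ht.coe_schwartz]; exact ht.schwartz.integrable) hneg
  simp only [smul_eq_mul] at h2
  rw [flip_innerₗ] at h2
  rw [Real.fourierInv_eq_fourier_comp_neg (fourierL2 u : ℝ → ℂ)]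
  refine Eq.trans ?_ h2
  rw [← integral_neg_eq_self]
  refine integral_congr_ae (Filter.Eventually.of_forall fun x => ?_)
  simp only [Real.fourierInv_eq_fourier_neg, neg_neg]
  rfl

/-- A smooth real function, bounded together with its first derivative, of temperate growth. -/
structure SmoothPotential (q : ℝ → ℝ) (B : ℝ) : Prop where
  growth : q.HasTemperateGrowth
  bound : ∀ x, |q x| ≤ B
  bound_deriv : ∀ x, |_root_.deriv q x| ≤ B

lemma SmoothPotential.nonneg {q : ℝ → ℝ} {B : ℝ} (hq : SmoothPotential q B) : 0 ≤ B :=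
  (abs_nonneg _).trans (hq.bound 0)

lemma SmoothPotential.differentiable {q : ℝ → ℝ} {B : ℝ} (hq : SmoothPotential q B) :
    Differentiable ℝ q := hq.growth.1.differentiable (by simp)

lemma SmoothPotential.dilate {q : ℝ → ℝ} {B : ℝ} (hq : SmoothPotential q B) (a k : ℝ) :
    SmoothPotential (fun x => a * q (k * x)) (|a| * B * max 1 |k|) where
  growth := by
    have h1 : Function.HasTemperateGrowth (fun x : ℝ => k * x) :=
      (Function.HasTemperateGrowth.const k).mul .id'
    exact (Function.HasTemperateGrowth.const a).mul (hq.growth.comp h1)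
  bound x := by
    have hB := hq.nonneg
    rw [abs_mul]
    calc |a| * |q (k * x)| ≤ |a| * B := mul_le_mul_of_nonneg_left (hq.bound _) (abs_nonneg _)
      _ ≤ _ := le_mul_of_one_le_right (by positivity) (le_max_left _ _)
  bound_deriv x := by
    have hB := hq.nonneg
    have h1 : HasDerivAt (fun x => a * q (k * x)) (a * (_root_.deriv q (k * x) * (k * 1))) x :=
      ((hq.differentiable (k * x)).hasDerivAt.comp x ((hasDerivAt_id x).const_mul k)).const_mul a
    rw [h1.deriv, abs_mul, abs_mul, mul_one, mul_assoc]
    refine mul_le_mul_of_nonneg_left ?_ (abs_nonneg _)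
    exact mul_le_mul (hq.bound_deriv _) (le_max_right _ _) (abs_nonneg _) hB

/-- Fourier inversion writes f as the transform of a function with all moments integrable. Such a
transform is smooth with every derivative bounded; its real part is the required representative,
because f is real. -/
lemma FourierDecay.exists_smoothPotential {f : ℝ → ℝ} (hf : MemLp (fun x => (f x : ℂ)) 2 volume)
    (hd : FourierDecay (classL2 f)) :
    ∃ (q : ℝ → ℝ) (B : ℝ), SmoothPotential q B ∧ f =ᵐ[volume] q := by
  set w : ℝ → ℂ := ((fourierL2 (classL2 f) : L2) : ℝ → ℂ) with hw
  have hwm : AEStronglyMeasurable w volume := Lp.aestronglyMeasurable _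
  have hint : ∀ n : ℕ, Integrable (fun η : ℝ => η ^ n • w (-η)) volume := by
    intro n
    have h1 : Integrable (fun η : ℝ => (-η) ^ n • w η) volume := by
      refine (hd.integrable n).mono' ?_ (Filter.Eventually.of_forall fun η => ?_)
      · exact (show Measurable fun η : ℝ => (-η) ^ n by fun_prop).aestronglyMeasurable.smul hwm
      · rw [norm_smul, norm_pow, norm_neg, Real.rpow_natCast]
        refine mul_le_mul_of_nonneg_right ?_ (norm_nonneg _)
        exact pow_le_pow_left₀ (norm_nonneg _) (by rw [Real.norm_eq_abs]; linarith) n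
    simpa using h1.comp_neg
  have hw0 : Integrable w volume := by
    have := (hint 0).comp_neg
    simpa using this
  set p : ℝ → ℂ := 𝓕 (fun η => w (-η)) with hp
  have hpd : ContDiff ℝ ∞ p := by
    refine Real.contDiff_fourier fun n _ => ?_
    simpa [norm_smul] using (hint n).norm
  have hpb : ∀ n : ℕ, ∃ C, ∀ x, ‖iteratedDeriv n p x‖ ≤ C := by
    intro n
    have := Real.iteratedDeriv_fourier (N := ⊤) (n := n) (fun n _ => hint n) (by simp)
    rw [hp, this]
    refine ⟨∫ η : ℝ, ‖(-2 * (Real.pi : ℂ) * Complex.I * η) ^ n • w (-η)‖, fun x => ?_⟩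
    rw [Real.fourier_real_eq]
    exact norm_integral_le_integral_norm _ |>.trans_eq (by simp only [Circle.norm_smul])
  choose C hC using hpb
  have hpg : p.HasTemperateGrowth := by
    refine ⟨hpd, fun n => ⟨0, C n, fun x => ?_⟩⟩
    rw [norm_iteratedFDeriv_eq_norm_iteratedDeriv]
    simpa using hC n x
  have hre : Function.HasTemperateGrowth (fun z : ℂ => z.re) :=
    Complex.reCLM.hasTemperateGrowth
  refine ⟨fun x => (p x).re, max (C 0) (C 1), ⟨hre.comp hpg, fun x => ?_, fun x => ?_⟩, ?_⟩
  · refine (Complex.abs_re_le_norm _).trans (le_trans ?_ (le_max_left _ _))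
    simpa using hC 0 x
  · have hdp : HasDerivAt p (_root_.deriv p x) x :=
      (hpd.differentiable (by simp) x).hasDerivAt
    have : HasDerivAt (fun x => (p x).re) (_root_.deriv p x).re x :=
      Complex.reCLM.hasFDerivAt.comp_hasDerivAt x hdp
    rw [this.deriv]
    refine (Complex.abs_re_le_norm _).trans (le_trans ?_ (le_max_right _ _))
    simpa using hC 1 x
  · have h1 := ae_eq_fourierInv hw0
    rw [Real.fourierInv_eq_fourier_comp_neg] at h1
    filter_upwards [h1, classL2_ae_eq hf] with x hx hx'
    have : p x = f x := by rw [hp, ← hx', hx]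
    rw [this, Complex.ofReal_re]

/-! ### Fourier multipliers -/

lemma mem_multiplier {m : ℝ → ℂ} {u : L2} : u ∈ (multiplier m).domain ↔
    MemLp (fun η : ℝ => m (2 * Real.pi * η) * fourierL2 u η) 2 volume := Iff.rfl

lemma fourierL2_multiplier (m : ℝ → ℂ) (u : (multiplier m).domain) :
    fourierL2 (multiplier m u) =ᵐ[volume] fun η => m (2 * Real.pi * η) * fourierL2 (u : L2) η := by
  have h1 : fourierL2 (multiplier m u) = MemLp.toLp _ (mem_multiplier.mp u.2) :=
    fourierL2.apply_symm_apply _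
  rw [h1]
  exact MemLp.coeFn_toLp _

/-- A multiplier with measurable symbol of order at most `s` is defined on `H^s`. -/
lemma sobolev_le_multiplier {m : ℝ → ℂ} (hm : Measurable m) {s C : ℝ}
    (h : ∀ ξ, ‖m ξ‖ ≤ C * (1 + ξ ^ 2) ^ (s / 2)) : sobolev s ≤ (multiplier m).domain := by
  intro u hu
  rw [mem_multiplier]
  refine ((mem_sobolev.mp hu).const_mul ((C : ℝ) : ℂ)).of_le ?_
    (Filter.Eventually.of_forall fun η => ?_)
  · exact (hm.comp (measurable_const.mul measurable_id)).aestronglyMeasurable.mul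
      (Lp.aestronglyMeasurable _)
  · have h1 := h (2 * Real.pi * η)
    have hC : 0 ≤ C := by
      have h0 := (norm_nonneg _).trans h1
      exact nonneg_of_mul_nonneg_left h0 (by positivity)
    rw [norm_mul, norm_mul, norm_mul, norm_weight, Complex.norm_real, Real.norm_of_nonneg hC,
      ← mul_assoc]
    exact mul_le_mul_of_nonneg_right h1 (norm_nonneg _)

lemma integral_star_mul_fourierL2 (u v : L2) :
    ∫ η, star (fourierL2 u η) * fourierL2 v η = inner ℂ u v := by
  rw [← inner_L2, fourierL2.inner_map_map]

lemma inner_eq_of_fourier {u v u' v' : L2}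
    (h : ∀ᵐ η, star (fourierL2 u η) * fourierL2 v η = star (fourierL2 u' η) * fourierL2 v' η) :
    inner ℂ u v = inner ℂ u' v' := by
  rw [← integral_star_mul_fourierL2, ← integral_star_mul_fourierL2]
  exact integral_congr_ae h

lemma norm_sq_eq_integral (u : L2) : ‖u‖ ^ 2 = ∫ x, ‖u x‖ ^ 2 := by
  have h := inner_self_eq_norm_sq (𝕜 := ℂ) u
  rw [inner_L2] at h
  have h2 : ∀ x, star (u x) * u x = ((‖u x‖ ^ 2 : ℝ) : ℂ) := fun x => by
    rw [Complex.star_def, ← Complex.normSq_eq_conj_mul_self, Complex.normSq_eq_norm_sq]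
  simp_rw [h2] at h
  rw [integral_complex_ofReal, RCLike.re_to_complex, Complex.ofReal_re] at h
  exact h.symm

lemma integrable_norm_sq (u : L2) : Integrable (fun x => ‖u x‖ ^ 2) volume :=
  (Lp.memLp u).integrable_norm_pow (by norm_num) |>.congr
    (Filter.Eventually.of_forall fun x => by simp)

lemma norm_sq_eq_integral_fourier (u : L2) : ‖u‖ ^ 2 = ∫ η, ‖fourierL2 u η‖ ^ 2 := by
  rw [← norm_sq_eq_integral, fourierL2.norm_map]

lemma fourierL2_injective_ae {u v : L2} (h : fourierL2 u =ᵐ[volume] fourierL2 v) : u = v :=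
  fourierL2.injective (Lp.ext h)

lemma fourierL2_add (u v : L2) :
    fourierL2 (u + v) =ᵐ[volume] fun η => fourierL2 u η + fourierL2 v η := by
  rw [map_add]; exact Lp.coeFn_add _ _

lemma fourierL2_sub (u v : L2) :
    fourierL2 (u - v) =ᵐ[volume] fun η => fourierL2 u η - fourierL2 v η := by
  rw [map_sub]; exact Lp.coeFn_sub _ _

lemma fourierL2_smul (a : ℂ) (u : L2) :
    fourierL2 (a • u) =ᵐ[volume] fun η => a * fourierL2 u η := by
  rw [map_smul]; exact Lp.coeFn_smul _ _

lemma measurable_riesz_symbol (s : ℝ) : Measurable fun ξ : ℝ => ((|ξ| ^ s : ℝ) : ℂ) := by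
  fun_prop

lemma abs_rpow_le_weight {s : ℝ} (hs : 0 ≤ s) (ξ : ℝ) : |ξ| ^ s ≤ (1 + ξ ^ 2) ^ (s / 2) := by
  have h1 : |ξ| ^ s = (ξ ^ 2) ^ (s / 2) := by
    rw [← sq_abs, ← Real.rpow_natCast, ← Real.rpow_mul (abs_nonneg _)]
    congr 1; push_cast; ring
  rw [h1]
  exact Real.rpow_le_rpow (sq_nonneg _) (by linarith) (by linarith)

lemma sobolev_le_riesz {s : ℝ} (hs : 0 ≤ s) : sobolev s ≤ (riesz s).domain := by
  refine sobolev_le_multiplier (measurable_riesz_symbol s) (C := 1) fun ξ => ?_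
  rw [Complex.norm_real, Real.norm_of_nonneg (by positivity), one_mul]
  exact abs_rpow_le_weight hs ξ

/-- The operator `D^s` on `H^s`. -/
def rieszH {s : ℝ} (hs : 0 ≤ s) : sobolev s →ₗ[ℂ] L2 where
  toFun u := riesz s ⟨u, sobolev_le_riesz hs u.2⟩
  map_add' u v := (riesz s).map_add ⟨u, sobolev_le_riesz hs u.2⟩ ⟨v, sobolev_le_riesz hs v.2⟩
  map_smul' a u := (riesz s).map_smul a ⟨u, sobolev_le_riesz hs u.2⟩

lemma rieszH_apply {s : ℝ} (hs : 0 ≤ s) (u : sobolev s) :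
    rieszH hs u = riesz s ⟨u, sobolev_le_riesz hs u.2⟩ := rfl

lemma fourierL2_rieszH {s : ℝ} (hs : 0 ≤ s) (u : sobolev s) :
    fourierL2 (rieszH hs u) =ᵐ[volume]
      fun η => ((|2 * Real.pi * η| ^ s : ℝ) : ℂ) * fourierL2 (u : L2) η := by
  rw [rieszH_apply]
  exact fourierL2_multiplier (fun ξ => ((|ξ| ^ s : ℝ) : ℂ)) ⟨u, sobolev_le_riesz hs u.2⟩

lemma norm_rieszH_sq {s : ℝ} (hs : 0 ≤ s) (u : sobolev s) :
    ‖rieszH hs u‖ ^ 2 = ∫ η, (|2 * Real.pi * η| ^ s * ‖fourierL2 (u : L2) η‖) ^ 2 := by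
  rw [norm_sq_eq_integral_fourier]
  refine integral_congr_ae ?_
  filter_upwards [fourierL2_rieszH hs u] with η hη
  rw [hη, norm_mul, Complex.norm_real, Real.norm_of_nonneg (by positivity)]

lemma rieszEnergy_eq {s : ℝ} (hs : 0 ≤ s) {f : ℝ → ℝ} (hf : MemH s f) :
    rieszEnergy s f = ‖rieszH hs ⟨classL2 f, hf.2⟩‖ ^ 2 := by
  rw [norm_rieszH_sq, rieszEnergy]

/-! ### Classes of real functions -/

lemma memLp_ofReal_iff {f : ℝ → ℝ} :
    MemLp (fun x => (f x : ℂ)) 2 volume ↔ MemLp f 2 volume :=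
  ⟨fun h => h.re, fun h => h.ofReal⟩

lemma classL2_eq_of_ae {f : ℝ → ℝ} {u : L2} (h : ∀ᵐ x, u x = f x) : classL2 f = u := by
  have hf : MemLp (fun x => (f x : ℂ)) 2 volume := (Lp.memLp u).ae_eq h
  refine Lp.ext ((classL2_ae_eq hf).trans ?_)
  filter_upwards [h] with x hx
  rw [hx]

lemma MemH.memLp {s : ℝ} {f : ℝ → ℝ} (hf : MemH s f) : MemLp f 2 volume := memLp_ofReal_iff.mp hf.1

lemma MemH.of_ae {s : ℝ} {f : ℝ → ℝ} {u : L2} (h : ∀ᵐ x, u x = f x) (hu : u ∈ sobolev s) :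
    MemH s f := by
  refine ⟨(Lp.memLp u).ae_eq h, ?_⟩
  rwa [classL2_eq_of_ae h]

lemma classL2_add_smul {f g : ℝ → ℝ} (hf : MemLp f 2 volume) (hg : MemLp g 2 volume) (a b : ℝ) :
    classL2 (fun x => a * f x + b * g x) = (a : ℂ) • classL2 f + (b : ℂ) • classL2 g := by
  refine classL2_eq_of_ae ?_
  filter_upwards [Lp.coeFn_add ((a : ℂ) • classL2 f) ((b : ℂ) • classL2 g),
    Lp.coeFn_smul (a : ℂ) (classL2 f), Lp.coeFn_smul (b : ℂ) (classL2 g),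
    classL2_ae_eq (memLp_ofReal_iff.mpr hf), classL2_ae_eq (memLp_ofReal_iff.mpr hg)]
    with x h1 h2 h3 h4 h5
  rw [h1, Pi.add_apply, h2, h3, Pi.smul_apply, Pi.smul_apply, h4, h5]
  push_cast
  simp

lemma MemH.add_smul {s : ℝ} {f g : ℝ → ℝ} (hf : MemH s f) (hg : MemH s g) (a b : ℝ) :
    MemH s (fun x => a * f x + b * g x) := by
  refine ⟨memLp_ofReal_iff.mpr ((hf.memLp.const_mul a).add (hg.memLp.const_mul b)), ?_⟩
  rw [classL2_add_smul hf.memLp hg.memLp]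
  exact Submodule.add_mem _ (Submodule.smul_mem _ _ hf.2) (Submodule.smul_mem _ _ hg.2)

lemma inner_classL2 {f g : ℝ → ℝ} (hf : MemLp f 2 volume) (hg : MemLp g 2 volume) :
    inner ℂ (classL2 f) (classL2 g) = ((∫ x, f x * g x : ℝ) : ℂ) := by
  rw [inner_L2, ← integral_complex_ofReal]
  refine integral_congr_ae ?_
  filter_upwards [classL2_ae_eq (memLp_ofReal_iff.mpr hf),
    classL2_ae_eq (memLp_ofReal_iff.mpr hg)] with x h1 h2
  rw [h1, h2, Complex.star_def, Complex.conj_ofReal]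
  push_cast; rfl

lemma rieszEnergy_add_smul {s : ℝ} (hs : 0 ≤ s) {f g : ℝ → ℝ} (hf : MemH s f) (hg : MemH s g)
    (t : ℝ) : rieszEnergy s (fun x => f x + t * g x) = rieszEnergy s f
      + 2 * t * (inner ℂ (rieszH hs ⟨_, hf.2⟩) (rieszH hs ⟨_, hg.2⟩) : ℂ).re
      + t ^ 2 * rieszEnergy s g := by
  have h1 := hf.add_smul hg 1 t
  have h2 := classL2_add_smul hf.memLp hg.memLp 1 t
  simp only [one_mul] at h1 h2
  rw [rieszEnergy_eq hs h1, rieszEnergy_eq hs hf, rieszEnergy_eq hs hg]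
  have h3 : (⟨_, h1.2⟩ : sobolev s) = ⟨_, hf.2⟩ + (t : ℂ) • ⟨_, hg.2⟩ := by
    refine Subtype.ext ?_
    simp [h2]
  rw [h3, map_add, map_smul, norm_add_sq (𝕜 := ℂ), inner_smul_right, norm_smul,
    Complex.norm_real, RCLike.re_to_complex, Complex.re_ofReal_mul, mul_pow, Real.norm_eq_abs,
    sq_abs]
  ring

/-! ### The Euler–Lagrange equation -/

lemma memLp_mul_of_bound {f g : ℝ → ℝ} (hf : MemLp f 2 volume)
    (hg : AEStronglyMeasurable g volume) {M : ℝ} (hM : ∀ᵐ x, |g x| ≤ M) :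
    MemLp (fun x => f x * g x) 2 volume := by
  refine (hf.const_mul M).of_le (hf.1.mul hg) ?_
  filter_upwards [hM] with x hx
  rw [norm_mul, norm_mul, mul_comm, Real.norm_eq_abs, Real.norm_eq_abs, Real.norm_eq_abs]
  exact mul_le_mul_of_nonneg_right (hx.trans (le_abs_self M)) (abs_nonneg _)

/-- The equation in `IsGroundState` uses the L¹ transform of Q². Once Q is bounded, Q² also lies in
L², where the two transforms agree. -/
lemma IsGroundState.fourier_sq {α : ℝ} {Q : ℝ → ℝ} (hQ : IsGroundState α Q) {M : ℝ}
    (hM : ∀ᵐ x, |Q x| ≤ M) : fourierL2 (classL2 fun x => Q x ^ 2) =ᵐ[volume]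
      fun η => ((|2 * Real.pi * η| ^ α + 1 : ℝ) : ℂ) * fourierL2 (classL2 Q) η := by
  have hQ2 := hQ.mem.memLp
  have h1 : MemLp (fun x => Q x ^ 2) 2 volume := by
    simpa [sq] using memLp_mul_of_bound hQ2 hQ2.1 hM
  have h2 : classL2 (fun x => Q x ^ 2) = (memLp_ofReal_iff.mpr h1).toLp :=
    classL2_eq_of_ae (memLp_ofReal_iff.mpr h1).coeFn_toLp
  rw [h2]
  refine (fourierL2_toLp_ae_eq _ ?_).trans (Filter.EventuallyEq.symm hQ.solves)
  exact hQ2.integrable_sq.ofReal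

/-- This is the weak form of the equation for Q, not a consequence of minimality: splitting |ξ|^α as
|ξ|^{α/2}·|ξ|^{α/2} distributes D^α over the two arguments. -/
lemma IsGroundState.euler_lagrange {α : ℝ} (hα : 0 ≤ α) {Q : ℝ → ℝ} (hQ : IsGroundState α Q)
    {M : ℝ} (hM : ∀ᵐ x, |Q x| ≤ M) {v : ℝ → ℝ} (hv : MemH (α / 2) v) :
    (inner ℂ (rieszH (by linarith : 0 ≤ α / 2) ⟨_, hQ.mem.2⟩) (rieszH (by linarith) ⟨_, hv.2⟩)
      : ℂ).re = (∫ x, Q x ^ 2 * v x) - ∫ x, Q x * v x := by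
  have hQ2 := hQ.mem.memLp
  have h1 : MemLp (fun x => Q x ^ 2) 2 volume := by
    simpa [sq] using memLp_mul_of_bound hQ2 hQ2.1 hM
  have h2 : inner ℂ (rieszH (by linarith : 0 ≤ α / 2) ⟨_, hQ.mem.2⟩)
      (rieszH (by linarith : 0 ≤ α / 2) ⟨_, hv.2⟩)
      = inner ℂ (classL2 (fun x => Q x ^ 2) - classL2 Q) (classL2 v) := by
    refine inner_eq_of_fourier ?_
    filter_upwards [fourierL2_rieszH (by linarith : 0 ≤ α / 2) ⟨_, hQ.mem.2⟩,
      fourierL2_rieszH (by linarith : 0 ≤ α / 2) ⟨_, hv.2⟩, hQ.fourier_sq hM,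
      fourierL2_sub (classL2 fun x => Q x ^ 2) (classL2 Q)] with η h3 h4 h5 h6
    rw [h3, h4, h6, h5]
    have h7 : |2 * Real.pi * η| ^ α = |2 * Real.pi * η| ^ (α / 2) * |2 * Real.pi * η| ^ (α / 2) := by
      rw [← sq, ← Real.rpow_natCast, ← Real.rpow_mul (abs_nonneg _)]
      congr 1; push_cast; ring
    rw [h7]
    simp only [star_mul', star_sub, Complex.star_def, Complex.conj_ofReal]
    push_cast
    ring
  rw [h2, inner_sub_left, inner_classL2 h1 hv.memLp, inner_classL2 hQ2 hv.memLp]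
  simp

/-! ### Second variation of the Weinstein functional -/

/-- First and second order conditions for a cubic polynomial below an exponential, with contact
at the origin. -/
lemma coeffs_of_cubic_le_exp {p₁ p₂ p₃ e₁ e₂ : ℝ}
    (h : ∀ t : ℝ, 1 + p₁ * t + p₂ * t ^ 2 + p₃ * t ^ 3 ≤ Real.exp (e₁ * t + e₂ * t ^ 2)) :
    e₁ = p₁ ∧ (p₁ = 0 → p₂ ≤ e₂) := by
  have h1 : e₁ = p₁ := by
    -- The difference of the two sides has a minimum at t = 0, where it vanishes; its derivative
    -- there is e₁ - p₁.
    set φ : ℝ → ℝ := fun t =>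
      Real.exp (e₁ * t + e₂ * t ^ 2) - (1 + p₁ * t + p₂ * t ^ 2 + p₃ * t ^ 3) with hφ
    have hmin : IsLocalMin φ 0 := by
      refine Filter.Eventually.of_forall fun t => ?_
      have := h t
      simp [hφ]
      linarith
    have hi := hasDerivAt_id (0 : ℝ)
    have hd : HasDerivAt φ (Real.exp (e₁ * 0 + e₂ * 0 ^ 2) * (e₁ * 1 + e₂ * (2 * 0 ^ 1 * 1))
        - (0 + p₁ * 1 + p₂ * (2 * 0 ^ 1 * 1) + p₃ * (3 * 0 ^ 2 * 1))) 0 := by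
      refine ((hi.const_mul e₁).add ((hi.pow 2).const_mul e₂)).exp.sub
        ((((hasDerivAt_const (0 : ℝ) (1 : ℝ)).add (hi.const_mul p₁)).add
          ((hi.pow 2).const_mul p₂)).add ((hi.pow 3).const_mul p₃))
    have := hmin.hasDerivAt_eq_zero hd
    norm_num at this
    linarith
  refine ⟨h1, fun hp => ?_⟩
  have he : e₁ = 0 := h1.trans hp
  -- When e₁ = p₁ = 0, the estimate exp x ≤ 1 + x + x² for |x| ≤ 1, divided by t², gives p₂ ≤ e₂ +
  -- e₂²t² - p₃t for small t ≠ 0.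
  have hlim : Filter.Tendsto (fun t : ℝ => e₂ + (e₂ ^ 2 * t ^ 2 - p₃ * t)) (nhdsWithin 0 {0}ᶜ)
      (nhds (e₂ + (e₂ ^ 2 * 0 ^ 2 - p₃ * 0))) := by
    refine Filter.Tendsto.mono_left ?_ nhdsWithin_le_nhds
    exact Continuous.tendsto (by fun_prop) 0
  have hlim2 : Filter.Tendsto (fun t : ℝ => |e₂ * t ^ 2|) (nhdsWithin 0 {0}ᶜ) (nhds |e₂ * 0 ^ 2|) := by
    refine Filter.Tendsto.mono_left ?_ nhdsWithin_le_nhds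
    exact Continuous.tendsto (by fun_prop) 0
  have hsmall : ∀ᶠ t : ℝ in nhdsWithin 0 {0}ᶜ, |e₂ * t ^ 2| < 1 :=
    hlim2.eventually_lt_const (by norm_num)
  have := ge_of_tendsto (b := p₂) hlim (by
    filter_upwards [hsmall, self_mem_nhdsWithin] with t ht ht0
    have h2 := h t
    rw [he, hp] at h2
    have h3 := (abs_le.mp (Real.abs_exp_sub_one_sub_id_le ht.le)).2
    have h4 : 0 < t ^ 2 := by
      have : t ≠ 0 := ht0
      positivity
    have h5 : p₂ * t ^ 2 ≤ (e₂ + (e₂ ^ 2 * t ^ 2 - p₃ * t)) * t ^ 2 := by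
      rw [zero_mul, zero_add] at h2
      nlinarith
    exact le_of_mul_le_mul_right h5 h4)
  simpa using this

/-- From 1 + x ≤ exp x, with equality at k = k₀. It turns the real powers in the Weinstein
functional into exponentials of quadratic polynomials in t. The quadratic terms lost at second order
have the favourable sign, so no derivative of a power has to be taken. -/
lemma rpow_le_mul_exp {k₀ k a : ℝ} (hk₀ : 0 < k₀) (hk : 0 ≤ k) (ha : 0 ≤ a) :
    k ^ a ≤ k₀ ^ a * Real.exp (a * (k / k₀ - 1)) := by
  have h1 : k / k₀ ≤ Real.exp (k / k₀ - 1) := by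
    have := Real.add_one_le_exp (k / k₀ - 1)
    linarith
  calc k ^ a = (k₀ * (k / k₀)) ^ a := by rw [mul_div_cancel₀ _ hk₀.ne']
    _ = k₀ ^ a * (k / k₀) ^ a := Real.mul_rpow hk₀.le (by positivity)
    _ ≤ k₀ ^ a * Real.exp (k / k₀ - 1) ^ a := by
        gcongr
    _ = _ := by rw [← Real.exp_mul, mul_comm a]

lemma integrable_mul_of_bound {f g h : ℝ → ℝ} (hf : MemLp f 2 volume) (hg : MemLp g 2 volume)
    (hh : AEStronglyMeasurable h volume) {M : ℝ} (hM : ∀ᵐ x, |h x| ≤ M) :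
    Integrable (fun x => f x * g x * h x) volume := by
  have := (MemLp.integrable_mul hf (memLp_mul_of_bound hg hh hM))
  refine this.congr (Filter.Eventually.of_forall fun x => ?_)
  simp only [Pi.mul_apply]; ring

/-- Essentially bounded elements of `H^s`. -/
structure BddH (s : ℝ) (v : ℝ → ℝ) : Prop where
  mem : MemH s v
  bdd : ∃ M, ∀ᵐ x, |v x| ≤ M

/-- The left side is ∫(Q + tv)³. A lower bound without the absolute value suffices, since the cubic
integral is in the denominator of the functional being minimized. -/
lemma BddH.cubic_le {s : ℝ} {Q v : ℝ → ℝ} (hQ : BddH s Q)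
    (hv : BddH s v) (t : ℝ) :
    (∫ x, Q x ^ 3) + 3 * t * (∫ x, Q x ^ 2 * v x) + 3 * t ^ 2 * (∫ x, Q x * v x ^ 2)
      + t ^ 3 * (∫ x, v x ^ 3) ≤ ∫ x, |Q x + t * v x| ^ 3 := by
  obtain ⟨M, hM⟩ := hQ.bdd
  obtain ⟨N, hN⟩ := hv.bdd
  have hq := hQ.mem.memLp
  have hw := hv.mem.memLp
  have i1 : Integrable (fun x => Q x ^ 3) volume :=
    (integrable_mul_of_bound hq hq hq.1 hM).congr (.of_forall fun x => by simp only; ring)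
  have i2 : Integrable (fun x => Q x ^ 2 * v x) volume :=
    (integrable_mul_of_bound hq hq hw.1 hN).congr (.of_forall fun x => by simp only; ring)
  have i3 : Integrable (fun x => Q x * v x ^ 2) volume :=
    (integrable_mul_of_bound hq hw hw.1 hN).congr (.of_forall fun x => by simp only; ring)
  have i4 : Integrable (fun x => v x ^ 3) volume :=
    (integrable_mul_of_bound hw hw hw.1 hN).congr (.of_forall fun x => by simp only; ring)
  have i12 : Integrable (fun x => Q x ^ 3 + 3 * t * (Q x ^ 2 * v x)) volume :=
    i1.add (i2.const_mul _)
  have i13 : Integrable (fun x => Q x ^ 3 + 3 * t * (Q x ^ 2 * v x)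
      + 3 * t ^ 2 * (Q x * v x ^ 2)) volume := i12.add (i3.const_mul _)
  have e : (∫ x, Q x ^ 3) + 3 * t * (∫ x, Q x ^ 2 * v x) + 3 * t ^ 2 * (∫ x, Q x * v x ^ 2)
      + t ^ 3 * (∫ x, v x ^ 3) = ∫ x, (Q x + t * v x) ^ 3 := by
    rw [← integral_const_mul, ← integral_const_mul, ← integral_const_mul,
      ← integral_add i1 (i2.const_mul _),
      ← integral_add i12 (i3.const_mul _), ← integral_add i13 (i4.const_mul _)]
    refine integral_congr_ae (.of_forall fun x => ?_)
    simp only; ring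
  rw [e]
  have i5 : Integrable (fun x => (Q x + t * v x) ^ 3) volume := by
    refine (i13.add (i4.const_mul (t ^ 3))).congr (.of_forall fun x => ?_)
    simp only [Pi.add_apply]; ring
  refine integral_mono i5 (i5.norm.congr (.of_forall fun x => ?_)) fun x => ?_
  · simp only [norm_pow, Real.norm_eq_abs]
  · simp only
    rw [← abs_pow]
    exact le_abs_self _

lemma integral_sq_add_smul {f g : ℝ → ℝ} (hf : MemLp f 2 volume) (hg : MemLp g 2 volume) (t : ℝ) :
    ∫ x, |f x + t * g x| ^ 2 = (∫ x, f x ^ 2) + 2 * t * (∫ x, f x * g x)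
      + t ^ 2 * ∫ x, g x ^ 2 := by
  have i1 : Integrable (fun x => 2 * t * (f x * g x)) volume :=
    (hf.integrable_mul hg).const_mul _
  have i2 : Integrable (fun x => f x ^ 2 + 2 * t * (f x * g x)) volume := hf.integrable_sq.add i1
  rw [← integral_const_mul, ← integral_const_mul, ← integral_add hf.integrable_sq i1,
    ← integral_add i2 (hg.integrable_sq.const_mul _)]
  refine integral_congr_ae (.of_forall fun x => ?_)
  simp only [sq_abs]; ring

lemma integral_pow_pos {Q : ℝ → ℝ} (hpos : ∀ᵐ x, 0 < Q x) {n : ℕ}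
    (hi : Integrable (fun x => Q x ^ n) volume) : 0 < ∫ x, Q x ^ n := by
  rw [integral_pos_iff_support_of_nonneg_ae (by
    filter_upwards [hpos] with x hx
    exact (pow_pos hx n).le) hi]
  have h1 : (volume : Measure ℝ) (Function.support fun x => Q x ^ n)ᶜ = 0 := by
    refine measure_mono_null (fun x hx => ?_) hpos
    simp only [Set.mem_compl_iff, Function.mem_support, ne_eq, not_not] at hx
    simp only [Set.mem_compl_iff, Set.mem_ofPred_eq]
    intro h
    exact (pow_pos h n).ne' hx
  rw [pos_iff_ne_zero]
  intro h2
  have h3 := measure_union_le (μ := (volume : Measure ℝ)) (Function.support fun x => Q x ^ n)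
    (Function.support fun x => Q x ^ n)ᶜ
  rw [Set.union_compl_self, h1, h2] at h3
  simp at h3

section Variation

variable {α : ℝ} {Q : ℝ → ℝ}

/-- The symbol |ξ|^{α/2} can vanish only at the origin, a null set, so zero energy would force Q =
0, against positivity. -/
lemma IsGroundState.rieszEnergy_pos (hα : 0 ≤ α) (hQ : IsGroundState α Q) :
    0 < rieszEnergy (α / 2) Q := by
  have hs : 0 ≤ α / 2 := by linarith
  rw [rieszEnergy_eq hs hQ.mem]
  refine pow_pos (norm_pos_iff.mpr fun h0 => ?_) 2
  have h1 := fourierL2_rieszH hs ⟨_, hQ.mem.2⟩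
  rw [h0, map_zero] at h1
  have h2 : classL2 Q = 0 := by
    refine fourierL2_injective_ae ?_
    rw [map_zero]
    have hne : ∀ᵐ η : ℝ, η ≠ 0 := by simp [ae_iff]
    filter_upwards [h1, Lp.coeFn_zero ℂ 2 (volume : Measure ℝ), hne] with η h3 h4 h5
    rw [h4] at h3 ⊢
    have h6 : ((|2 * Real.pi * η| ^ (α / 2) : ℝ) : ℂ) ≠ 0 := by
      have : 0 < |2 * Real.pi * η| := abs_pos.mpr (by have := Real.pi_pos; positivity)
      have := Real.rpow_pos_of_pos this (α / 2)
      exact_mod_cast this.ne'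
    exact (mul_eq_zero.mp h3.symm).resolve_left h6
  have h3 := classL2_ae_eq hQ.mem.1
  rw [h2] at h3
  have h4 : ∀ᵐ _ : ℝ, False := by
    filter_upwards [h3, Lp.coeFn_zero ℂ 2 (volume : Measure ℝ), hQ.pos] with x h5 h6 h7
    rw [h6, Pi.zero_apply] at h5
    exact h7.ne (by exact_mod_cast h5)
  rw [Filter.eventually_const] at h4
  exact h4

/-- First and second order optimality conditions for the Weinstein functional. -/
lemma IsGroundState.variation (hα : 1 / 3 < α) (hQ : IsGroundState α Q) (hQb : BddH (α / 2) Q)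
    {v : ℝ → ℝ} (hv : BddH (α / 2) v) :
    (1 / (α * rieszEnergy (α / 2) Q) * ((∫ x, Q x ^ 2 * v x) - ∫ x, Q x * v x)
        + (3 * α - 1) / (α * ∫ x, Q x ^ 2) * (∫ x, Q x * v x)
      = 3 / (∫ x, Q x ^ 3) * ∫ x, Q x ^ 2 * v x) ∧
    ((∫ x, Q x ^ 2 * v x) = 0 → 3 / (∫ x, Q x ^ 3) * (∫ x, Q x * v x ^ 2)
      ≤ 1 / (2 * α * rieszEnergy (α / 2) Q) * rieszEnergy (α / 2) v
        + (3 * α - 1) / (2 * α * ∫ x, Q x ^ 2) * ∫ x, v x ^ 2) := by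
  have hα0 : 0 < α := by linarith
  have hs : 0 ≤ α / 2 := by linarith
  obtain ⟨M, hM⟩ := hQb.bdd
  have hq := hQ.mem.memLp
  have hEL := hQ.euler_lagrange hα0.le hM hv.mem
  set K₁ := (inner ℂ (rieszH hs ⟨_, hQ.mem.2⟩) (rieszH hs ⟨_, hv.mem.2⟩) : ℂ).re with hK₁
  have hK₀ := hQ.rieszEnergy_pos hα0.le
  have hA₀ : 0 < ∫ x, Q x ^ 3 := integral_pow_pos hQ.pos
    ((integrable_mul_of_bound hq hq hq.1 hM).congr (.of_forall fun x => by simp only; ring))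
  have hN₀ : 0 < ∫ x, Q x ^ 2 := integral_pow_pos hQ.pos hq.integrable_sq
  have hK := fun t => rieszEnergy_add_smul hs hQ.mem hv.mem t
  have hN := fun t => integral_sq_add_smul hq hv.mem.memLp t
  have hA := fun t => hQb.cubic_le hv t
  -- Minimality with the cubic integral cleared from the denominator. In this form it also holds
  -- when Q + tv vanishes almost everywhere.
  have hmin : ∀ t : ℝ, weinstein α Q * (∫ x, |Q x + t * v x| ^ 3)
      ≤ rieszEnergy (α / 2) (fun x => Q x + t * v x) ^ (1 / (2 * α))
        * (∫ x, |Q x + t * v x| ^ 2) ^ ((α - 1) / (2 * α) + 1) := by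
    intro t
    have hm : MemH (α / 2) (fun x => Q x + t * v x) := by
      simpa using hQ.mem.add_smul hv.mem 1 t
    have hE : 0 ≤ rieszEnergy (α / 2) (fun x => Q x + t * v x) := by
      unfold rieszEnergy
      exact integral_nonneg fun x => sq_nonneg _
    have hI : 0 ≤ ∫ x, |Q x + t * v x| ^ 2 := integral_nonneg fun x => by positivity
    rcases (integral_nonneg fun x => by positivity : 0 ≤ ∫ x, |Q x + t * v x| ^ 3).eq_or_lt
      with h0 | h0
    · rw [← h0, mul_zero]; positivity
    · have hne : ¬ ∀ᵐ x, Q x + t * v x = 0 := by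
        intro hz
        have : ∫ x, |Q x + t * v x| ^ 3 = 0 := by
          refine integral_eq_zero_of_ae ?_
          filter_upwards [hz] with x hx
          simp [hx]
        exact h0.ne' this
      have h1 := hQ.minimizes _ hm hne
      have h2 := mul_le_mul_of_nonneg_right h1 h0.le
      refine h2.trans_eq ?_
      rw [weinstein, mul_comm, ← mul_assoc, ← mul_assoc, mul_inv_cancel₀ h0.ne', one_mul]
  set K₀ := rieszEnergy (α / 2) Q
  set K₂ := rieszEnergy (α / 2) v
  set N₀ := ∫ x, Q x ^ 2
  set N₁ := ∫ x, Q x * v x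
  set N₂ := ∫ x, v x ^ 2
  set A₀ := ∫ x, Q x ^ 3
  set A₁ := ∫ x, Q x ^ 2 * v x
  set A₂ := ∫ x, Q x * v x ^ 2
  set A₃ := ∫ x, v x ^ 3
  have hJ : weinstein α Q = A₀⁻¹ * K₀ ^ (1 / (2 * α)) * N₀ ^ ((α - 1) / (2 * α) + 1) := by
    have e1 : ∫ x, |Q x| ^ 3 = A₀ := by
      refine integral_congr_ae ?_
      filter_upwards [hQ.pos] with x hx
      rw [abs_of_pos hx]
    have e2 : ∫ x, |Q x| ^ 2 = N₀ := by simp only [sq_abs]; rfl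
    rw [weinstein, e1, e2]
  -- The exponent equals (3α - 1)/(2α), so its sign is another use of α > 1/3.
  have hb : 0 ≤ (α - 1) / (2 * α) + 1 := by
    have : (α - 1) / (2 * α) + 1 = (3 * α - 1) / (2 * α) := by field_simp; ring
    rw [this]
    exact div_nonneg (by linarith) (by linarith)
  -- Both sides are divided by their values at t = 0: a cubic polynomial lies below the exponential
  -- of a quadratic one, with equality at the origin.
  have key : ∀ t : ℝ, 1 + (3 * A₁ / A₀) * t + (3 * A₂ / A₀) * t ^ 2 + (A₃ / A₀) * t ^ 3
      ≤ Real.exp ((1 / (2 * α) * (2 * K₁ / K₀) + ((α - 1) / (2 * α) + 1) * (2 * N₁ / N₀)) * t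
        + (1 / (2 * α) * (K₂ / K₀) + ((α - 1) / (2 * α) + 1) * (N₂ / N₀)) * t ^ 2) := by
    intro t
    have hE : 0 ≤ rieszEnergy (α / 2) (fun x => Q x + t * v x) := by
      unfold rieszEnergy
      exact integral_nonneg fun x => sq_nonneg _
    have hI : 0 ≤ ∫ x, |Q x + t * v x| ^ 2 := integral_nonneg fun x => by positivity
    have h1 := (hmin t).trans (mul_le_mul
      (rpow_le_mul_exp hK₀ hE (by positivity : 0 ≤ 1 / (2 * α))) (rpow_le_mul_exp hN₀ hI hb)
      (by positivity) (by positivity))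
    have hJ0 : 0 < K₀ ^ (1 / (2 * α)) * N₀ ^ ((α - 1) / (2 * α) + 1) := by positivity
    rw [mul_mul_mul_comm, ← Real.exp_add, hJ] at h1
    have h2 : A₀⁻¹ * (∫ x, |Q x + t * v x| ^ 3) ≤ Real.exp
        (1 / (2 * α) * (rieszEnergy (α / 2) (fun x => Q x + t * v x) / K₀ - 1)
        + ((α - 1) / (2 * α) + 1) * ((∫ x, |Q x + t * v x| ^ 2) / N₀ - 1)) := by
      refine le_of_mul_le_mul_left ?_ hJ0
      refine le_trans (le_of_eq ?_) h1
      ring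
    have h3 := (mul_le_mul_of_nonneg_left (hA t) (inv_pos.mpr hA₀).le).trans h2
    rw [hK t, hN t] at h3
    refine le_trans (le_of_eq ?_) (h3.trans_eq ?_)
    · field_simp
    · congr 1; field_simp; ring
  obtain ⟨h1, h2⟩ := coeffs_of_cubic_le_exp key
  constructor
  · rw [← hEL]
    have e : 1 / (α * K₀) * K₁ + (3 * α - 1) / (α * N₀) * N₁
        = 1 / (2 * α) * (2 * K₁ / K₀) + ((α - 1) / (2 * α) + 1) * (2 * N₁ / N₀) := by
      field_simp; ring
    rw [e, h1]; ring
  · intro h0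
    have h3 := h2 (by rw [h0]; simp)
    have e : 1 / (2 * α * K₀) * K₂ + (3 * α - 1) / (2 * α * N₀) * N₂
        = 1 / (2 * α) * (K₂ / K₀) + ((α - 1) / (2 * α) + 1) * (N₂ / N₀) := by
      field_simp; ring
    rw [e]
    refine le_trans (le_of_eq ?_) h3
    ring

end Variation

/-! ### Normalization of the coefficients and nonnegativity orthogonal to Q² -/

section Index

variable {α : ℝ} {Q : ℝ → ℝ}

/-- By the equation the transform of Q² is (|ξ|^α + 1) times that of Q, so the H^{α/2} norm of Q² is
controlled by the H^{3α/2} norm of Q. -/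
lemma IsGroundState.bddH_sq (hα : 0 ≤ α) (hQ : IsGroundState α Q) (hd : FourierDecay (classL2 Q))
    (hb : ∃ M, ∀ᵐ x, |Q x| ≤ M) : BddH (α / 2) (fun x => Q x ^ 2) := by
  obtain ⟨M, hM⟩ := hb
  have hq := hQ.mem.memLp
  have h1 : MemLp (fun x => Q x ^ 2) 2 volume := by
    simpa [sq] using memLp_mul_of_bound hq hq.1 hM
  refine ⟨⟨memLp_ofReal_iff.mpr h1, ?_⟩, M ^ 2, ?_⟩
  · rw [mem_sobolev]
    refine ((mem_sobolev.mp (hd.memSobolev (3 * α / 2))).const_mul 2).of_le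
      ((Measurable.aestronglyMeasurable (by fun_prop)).mul (Lp.aestronglyMeasurable _)) ?_
    filter_upwards [hQ.fourier_sq hM] with η hη
    set w := 1 + (2 * Real.pi * η) ^ 2 with hw
    have hw1 : 1 ≤ w := by rw [hw]; linarith [sq_nonneg (2 * Real.pi * η)]
    have h2 : |2 * Real.pi * η| ^ α + 1 ≤ 2 * w ^ (α / 2) := by
      have := abs_rpow_le_weight hα (2 * Real.pi * η)
      have := Real.one_le_rpow hw1 (by linarith : 0 ≤ α / 2)
      linarith
    have h3 : w ^ (3 * α / 2 / 2) = w ^ (α / 2 / 2) * w ^ (α / 2) := by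
      rw [← Real.rpow_add (by linarith)]; congr 1; ring
    rw [hη, h3]
    simp only [norm_mul, Complex.norm_real, Complex.norm_ofNat]
    rw [Real.norm_of_nonneg (by positivity : 0 ≤ w ^ (α / 2 / 2)),
      Real.norm_of_nonneg (by positivity : 0 ≤ w ^ (α / 2)),
      Real.norm_of_nonneg (by positivity : 0 ≤ |2 * Real.pi * η| ^ α + 1)]
    calc w ^ (α / 2 / 2) * ((|2 * Real.pi * η| ^ α + 1) * ‖fourierL2 (classL2 Q) η‖)
        ≤ w ^ (α / 2 / 2) * ((2 * w ^ (α / 2)) * ‖fourierL2 (classL2 Q) η‖) := by gcongr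
      _ = _ := by ring
  · filter_upwards [hM] with x hx
    rw [abs_pow]
    exact pow_le_pow_left₀ (abs_nonneg _) hx 2

/-- The Pohozaev identities. -/
lemma IsGroundState.normalization (hα : 1 / 3 < α) (hQ : IsGroundState α Q)
    (hd : FourierDecay (classL2 Q)) (hb : ∃ M, ∀ᵐ x, |Q x| ≤ M) :
    3 / (∫ x, Q x ^ 3) = 1 / (α * rieszEnergy (α / 2) Q) ∧
      (3 * α - 1) / (α * ∫ x, Q x ^ 2) = 1 / (α * rieszEnergy (α / 2) Q) := by
  have hQb : BddH (α / 2) Q := ⟨hQ.mem, hb⟩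
  have hS := hQ.bddH_sq (by linarith) hd hb
  set e := 1 / (α * rieszEnergy (α / 2) Q) - 3 / (∫ x, Q x ^ 3) with he
  set f := (3 * α - 1) / (α * ∫ x, Q x ^ 2) - 1 / (α * rieszEnergy (α / 2) Q) with hf
  -- The first-order condition reads ∫(eQ² + fQ)v = 0. Testing it with v = eQ² + fQ itself gives eQ²
  -- + fQ = 0, and then eQ + f = 0 since Q > 0.
  have hv : BddH (α / 2) (fun x => e * Q x ^ 2 + f * Q x) := by
    refine ⟨hS.mem.add_smul hQ.mem e f, ?_⟩
    obtain ⟨M, hM⟩ := hb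
    obtain ⟨N, hN⟩ := hS.bdd
    refine ⟨|e| * N + |f| * M, ?_⟩
    filter_upwards [hM, hN] with x hx hx'
    refine (abs_add_le _ _).trans ?_
    rw [abs_mul, abs_mul]
    gcongr
  have h1 := (hQ.variation hα hQb hv).1
  have hq := hQ.mem.memLp
  have hs := hS.mem.memLp
  have hvm := hv.mem.memLp
  have h2 : ∫ x, (e * Q x ^ 2 + f * Q x) ^ 2 = 0 := by
    have e1 : ∫ x, (e * Q x ^ 2 + f * Q x) ^ 2
        = e * (∫ x, Q x ^ 2 * (e * Q x ^ 2 + f * Q x)) + f * ∫ x, Q x * (e * Q x ^ 2 + f * Q x) := by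
      rw [← integral_const_mul, ← integral_const_mul, ← integral_add]
      · refine integral_congr_ae (.of_forall fun x => ?_)
        simp only; ring
      · exact (hs.integrable_mul hvm).const_mul _
      · exact (hq.integrable_mul hvm).const_mul _
    rw [e1, he, hf]
    linarith
  have h3 : ∀ᵐ x, e * Q x + f = 0 := by
    have h4 := (integral_eq_zero_iff_of_nonneg (fun x => sq_nonneg _) hvm.integrable_sq).mp h2
    filter_upwards [h4, hQ.pos] with x hx hx'
    have h5 : e * Q x ^ 2 + f * Q x = 0 := by simpa using hx
    have h6 : Q x * (e * Q x + f) = 0 := by linarith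
    exact (mul_eq_zero.mp h6).resolve_left hx'.ne'
  -- Otherwise Q would be constant; the only constant in L²(ℝ) is 0, which is not positive.
  have he0 : e = 0 := by
    by_contra hne
    have h4 : Q =ᵐ[volume] fun _ => -f / e := by
      filter_upwards [h3] with x hx
      field_simp
      linarith
    have h5 := hq.ae_eq h4
    rw [memLp_const_iff (by norm_num) (by norm_num)] at h5
    rcases h5 with h5 | h5
    · have h6 : ∀ᵐ _ : ℝ, False := by
        filter_upwards [h4, hQ.pos] with x hx hx'
        rw [hx, h5] at hx'
        exact lt_irrefl _ hx'
      rw [Filter.eventually_const] at h6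
      exact h6
    · simp at h5
  have hf0 : f = 0 := by
    have h4 : ∀ᵐ _ : ℝ, f = 0 := by
      filter_upwards [h3] with x hx
      simpa [he0] using hx
    rwa [Filter.eventually_const] at h4
  constructor <;> linarith

/-- The linearized operator is nonnegative on the orthogonal complement of `Q²`. -/
lemma IsGroundState.form_nonneg (hα : 1 / 3 < α) (hQ : IsGroundState α Q)
    (hd : FourierDecay (classL2 Q)) (hb : ∃ M, ∀ᵐ x, |Q x| ≤ M) {v : ℝ → ℝ}
    (hv : BddH (α / 2) v) (h0 : ∫ x, Q x ^ 2 * v x = 0) :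
    2 * (∫ x, Q x * v x ^ 2) ≤ rieszEnergy (α / 2) v + ∫ x, v x ^ 2 := by
  obtain ⟨h1, h2⟩ := hQ.normalization hα hd hb
  have h3 := (hQ.variation hα ⟨hQ.mem, hb⟩ hv).2 h0
  have hK := hQ.rieszEnergy_pos (by linarith)
  have hα0 : 0 < α := by linarith
  -- After normalization every coefficient in the second-order condition is a multiple of the same
  -- positive number 1/(2αK), with K the energy of Q, and that number cancels.
  have h4 : (3 * α - 1) / (2 * α * ∫ x, Q x ^ 2) = 1 / (2 * α * rieszEnergy (α / 2) Q) := by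
    have e1 : ∀ a b : ℝ, a / (2 * α * b) = a / (α * b) / 2 := fun a b => by
      rw [div_div]; congr 1; ring
    rw [e1, e1, h2]
  rw [h1, h4] at h3
  have h5 : 0 < 1 / (2 * α * rieszEnergy (α / 2) Q) := by positivity
  have h6 : 1 / (α * rieszEnergy (α / 2) Q) = 2 * (1 / (2 * α * rieszEnergy (α / 2) Q)) := by
    field_simp
  rw [h6] at h3
  refine le_of_mul_le_mul_left ?_ h5
  linarith

end Index

/-! ### Conjugation and dilation in Sobolev spaces -/

lemma sobolev_star {s : ℝ} {u v : L2} (hu : u ∈ sobolev s) (h : ∀ᵐ x, v x = star (u x)) :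
    v ∈ sobolev s := by
  rw [mem_sobolev] at hu ⊢
  have h1 := (MemLp.comp_mul hu (k := -1) (by norm_num)).star
  refine h1.ae_eq ?_
  filter_upwards [fourierL2_star h] with η hη
  rw [hη]
  simp

lemma norm_rieszH_star {s : ℝ} (hs : 0 ≤ s) {u v : sobolev s}
    (h : ∀ᵐ x, (v : L2) x = star ((u : L2) x)) : ‖rieszH hs v‖ ^ 2 = ‖rieszH hs u‖ ^ 2 := by
  rw [norm_rieszH_sq, norm_rieszH_sq, ← integral_neg_eq_self]
  have h1 := (Measure.measurePreserving_neg (volume : Measure ℝ)).quasiMeasurePreserving.ae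
    (fourierL2_star h)
  refine integral_congr_ae ?_
  filter_upwards [h1] with η hη
  rw [hη]
  simp

lemma sobolev_comp_mul {s : ℝ} (hs : 0 ≤ s) {u v : L2} (hu : u ∈ sobolev s) {k : ℝ} (hk : k ≠ 0)
    (h : v =ᵐ[volume] fun x => u (k * x)) : v ∈ sobolev s := by
  rw [mem_sobolev] at hu ⊢
  have h1 := (MemLp.comp_mul hu (inv_ne_zero hk)).const_mul
    (((max 1 (k ^ 2)) ^ (s / 2) * |k|⁻¹ : ℝ) : ℂ)
  refine h1.of_le ((Measurable.aestronglyMeasurable (by fun_prop)).mul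
    (Lp.aestronglyMeasurable _)) ?_
  filter_upwards [fourierL2_comp_mul hk h] with η hη
  rw [hη]
  simp only [norm_mul, Complex.norm_real]
  have h2 : (1 + (2 * Real.pi * η) ^ 2) ^ (s / 2)
      ≤ (max 1 (k ^ 2)) ^ (s / 2) * (1 + (2 * Real.pi * (k⁻¹ * η)) ^ 2) ^ (s / 2) := by
    rw [← Real.mul_rpow (by positivity) (by positivity)]
    refine Real.rpow_le_rpow (by positivity) ?_ (by linarith)
    have h3 : (2 * Real.pi * η) ^ 2 = k ^ 2 * (2 * Real.pi * (k⁻¹ * η)) ^ 2 := by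
      field_simp
    rw [h3, mul_add, mul_one]
    exact add_le_add (le_max_left _ _)
      (mul_le_mul_of_nonneg_right (le_max_right _ _) (sq_nonneg _))
  rw [Real.norm_of_nonneg (by positivity : 0 ≤ (1 + (2 * Real.pi * η) ^ 2) ^ (s / 2)),
    Real.norm_of_nonneg (by positivity : 0 ≤ (1 + (2 * Real.pi * (k⁻¹ * η)) ^ 2) ^ (s / 2)),
    Real.norm_of_nonneg (by positivity : 0 ≤ |k|⁻¹),
    Real.norm_of_nonneg (by positivity : 0 ≤ (max 1 (k ^ 2)) ^ (s / 2))]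
  calc _ ≤ ((max 1 (k ^ 2)) ^ (s / 2) * (1 + (2 * Real.pi * (k⁻¹ * η)) ^ 2) ^ (s / 2))
        * (|k|⁻¹ * ‖fourierL2 u (k⁻¹ * η)‖) := by gcongr
    _ = _ := by ring

lemma norm_rieszH_comp_mul {s : ℝ} (hs : 0 ≤ s) {u v : sobolev s} {k : ℝ} (hk : 0 < k)
    (h : (v : L2) =ᵐ[volume] fun x => (u : L2) (k * x)) :
    ‖rieszH hs v‖ ^ 2 = k⁻¹ * k ^ (2 * s) * ‖rieszH hs u‖ ^ 2 := by
  rw [norm_rieszH_sq, norm_rieszH_sq]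
  have h1 := Measure.integral_comp_mul_left
    (fun η => (|2 * Real.pi * η| ^ s * ‖fourierL2 (u : L2) η‖) ^ 2) k⁻¹
  have h2 : ∫ η, (|2 * Real.pi * η| ^ s * ‖fourierL2 (v : L2) η‖) ^ 2
      = (k ^ s * k⁻¹) ^ 2
        * ∫ η, (|2 * Real.pi * (k⁻¹ * η)| ^ s * ‖fourierL2 (u : L2) (k⁻¹ * η)‖) ^ 2 := by
    rw [← integral_const_mul]
    refine integral_congr_ae ?_
    filter_upwards [fourierL2_comp_mul hk.ne' h] with η hη
    rw [hη, norm_mul, Complex.norm_real, abs_of_pos hk, Real.norm_of_nonneg (by positivity)]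
    have h3 : |2 * Real.pi * η| = k * |2 * Real.pi * (k⁻¹ * η)| := by
      rw [← abs_of_pos hk, ← abs_mul, abs_of_pos hk]
      congr 1; field_simp
    rw [h3, Real.mul_rpow hk.le (abs_nonneg _)]
    ring
  rw [h2, h1, inv_inv, abs_of_pos hk, smul_eq_mul]
  have h4 : k ^ (2 * s) = k ^ s * k ^ s := by rw [← Real.rpow_add hk]; ring_nf
  rw [h4]
  field_simp

/-- Elements of `H¹` are bounded. -/
lemma exists_bound_of_mem_sobolev_one {u : L2} (hu : u ∈ sobolev 1) :
    ∃ M, ∀ᵐ x, ‖u x‖ ≤ M := by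
  have h0 := lintegral_weight_sq_ne_top_of_mem_sobolev zero_le_one hu
  have hm : Measurable fun η => ‖fourierL2 u η‖ₑ := (Lp.stronglyMeasurable _).measurable.enorm
  -- Dividing a square integrable function by 1 + |η| leads from reciprocal exponent 1/2 to 1, which
  -- lies in the open interval (1/2, 3/2). Hence the Fourier transform is integrable.
  have h1 := lintegral_weight_mul_rpow_ne_top
      (h := fun η => ENNReal.ofReal ((1 + |η|) ^ (1 : ℝ)) * ‖fourierL2 u η‖ₑ)
      (by fun_prop) (β := 1) (y := 1 / 2) (z := 1) (by norm_num) (by norm_num) (by norm_num)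
      (by simpa using h0)
  have hi : Integrable (fourierL2 u) volume := by
    refine ⟨Lp.aestronglyMeasurable _, ?_⟩
    rw [hasFiniteIntegral_iff_enorm]
    refine lt_of_eq_of_lt (lintegral_congr fun η => ?_) h1.lt_top
    rw [← mul_assoc, ← ENNReal.ofReal_mul (by positivity), ← Real.rpow_add (by positivity)]
    simp
  refine ⟨∫ η, ‖fourierL2 u η‖, ?_⟩
  filter_upwards [ae_eq_fourierInv hi] with x hx
  rw [hx, Real.fourierInv_eq_fourier_neg, Real.fourier_real_eq]
  exact (norm_integral_le_integral_norm _).trans_eq (by simp only [Circle.norm_smul])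

/-! ### Complex-valued functions and dilation to the solitary wave -/

section Index

variable {α : ℝ} {Q : ℝ → ℝ}

/-- The linearized operator is nonnegative on complex functions orthogonal to `Q²`. -/
lemma IsGroundState.complex_form_nonneg (hα : 1 / 3 < α) (hQ : IsGroundState α Q)
    (hd : FourierDecay (classL2 Q)) (hb : ∃ M, ∀ᵐ x, |Q x| ≤ M) (hs : 0 ≤ α / 2)
    (v : sobolev (α / 2)) (hvb : ∃ M, ∀ᵐ x, ‖(v : L2) x‖ ≤ M)
    (h0 : ∫ x, (Q x : ℂ) ^ 2 * (v : L2) x = 0) :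
    2 * (∫ x, Q x * ‖(v : L2) x‖ ^ 2) ≤ ‖rieszH hs v‖ ^ 2 + ‖(v : L2)‖ ^ 2 := by
  obtain ⟨N, hN⟩ := hvb
  obtain ⟨M, hM⟩ := id hb
  set u : L2 := (v : L2) with hu
  have hstar := (Lp.memLp u).star.coeFn_toLp
  set w : L2 := (Lp.memLp u).star.toLp with hw
  have hw' : w ∈ sobolev (α / 2) := sobolev_star v.2 hstar
  set vs : sobolev (α / 2) := ⟨w, hw'⟩ with hvs
  -- The real and imaginary parts of v, built from v and its conjugate so that membership in H^{α/2}
  -- is immediate. Both are orthogonal to Q², which is real.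
  set a : sobolev (α / 2) := (1 / 2 : ℂ) • (v + vs) with ha
  set b : sobolev (α / 2) := (-Complex.I / 2 : ℂ) • (v - vs) with hb'
  have ha' : ∀ᵐ x, (a : L2) x = ((u x).re : ℂ) := by
    filter_upwards [hstar, Lp.coeFn_smul (1 / 2 : ℂ) (u + w), Lp.coeFn_add u w] with x h1 h2 h3
    have : (a : L2) = (1 / 2 : ℂ) • (u + w) := rfl
    rw [this, h2, Pi.smul_apply, h3, Pi.add_apply, h1, Complex.re_eq_add_conj]
    simp; ring
  have hb'' : ∀ᵐ x, (b : L2) x = ((u x).im : ℂ) := by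
    filter_upwards [hstar, Lp.coeFn_smul (-Complex.I / 2 : ℂ) (u - w), Lp.coeFn_sub u w]
      with x h1 h2 h3
    have : (b : L2) = (-Complex.I / 2 : ℂ) • (u - w) := rfl
    rw [this, h2, Pi.smul_apply, h3, Pi.sub_apply, h1, Complex.im_eq_sub_conj]
    simp
    field_simp
    simp
  have m1 : BddH (α / 2) (fun x => (u x).re) := by
    refine ⟨MemH.of_ae ha' a.2, N, ?_⟩
    filter_upwards [hN] with x hx
    exact (Complex.abs_re_le_norm _).trans hx
  have m2 : BddH (α / 2) (fun x => (u x).im) := by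
    refine ⟨MemH.of_ae hb'' b.2, N, ?_⟩
    filter_upwards [hN] with x hx
    exact (Complex.abs_im_le_norm _).trans hx
  have hq := hQ.mem.memLp
  have hint : Integrable (fun x => (Q x : ℂ) ^ 2 * u x) volume := by
    have h1 := (hQ.bddH_sq (by linarith) hd hb).mem.1
    have := h1.integrable_mul (Lp.memLp u)
    refine this.congr (.of_forall fun x => ?_)
    simp
  have z1 : ∫ x, Q x ^ 2 * (u x).re = 0 := by
    have h1 := integral_re hint
    rw [h0] at h1
    simp only [← Complex.ofReal_pow, RCLike.re_to_complex, Complex.re_ofReal_mul,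
      Complex.zero_re] at h1
    exact h1
  have z2 : ∫ x, Q x ^ 2 * (u x).im = 0 := by
    have h1 := integral_im hint
    rw [h0] at h1
    simp only [← Complex.ofReal_pow, RCLike.im_to_complex, Complex.im_ofReal_mul,
      Complex.zero_im] at h1
    exact h1
  have f1 := hQ.form_nonneg hα hd hb m1 z1
  have f2 := hQ.form_nonneg hα hd hb m2 z2
  have e1 : rieszEnergy (α / 2) (fun x => (u x).re) = ‖rieszH hs a‖ ^ 2 := by
    rw [rieszEnergy_eq hs m1.mem]
    congr 3
    exact Subtype.ext (classL2_eq_of_ae ha')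
  have e2 : rieszEnergy (α / 2) (fun x => (u x).im) = ‖rieszH hs b‖ ^ 2 := by
    rw [rieszEnergy_eq hs m2.mem]
    congr 3
    exact Subtype.ext (classL2_eq_of_ae hb'')
  -- The parallelogram law, since conjugation preserves the norm of D^{α/2}v.
  have e3 : ‖rieszH hs a‖ ^ 2 + ‖rieszH hs b‖ ^ 2 = ‖rieszH hs v‖ ^ 2 := by
    rw [ha, hb', map_smul, map_smul, map_add, map_sub, norm_smul, norm_smul]
    have h1 := parallelogram_law_with_norm ℂ (rieszH hs v) (rieszH hs vs)
    have h2 : ‖rieszH hs vs‖ ^ 2 = ‖rieszH hs v‖ ^ 2 := norm_rieszH_star hs hstar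
    have h3 : ‖(1 / 2 : ℂ)‖ = 1 / 2 := by simp
    have h4 : ‖(-Complex.I / 2 : ℂ)‖ = 1 / 2 := by simp
    rw [h3, h4]
    nlinarith
  have i1 : Integrable (fun x => Q x * (u x).re ^ 2) volume :=
    (integrable_mul_of_bound m1.mem.memLp m1.mem.memLp hq.1 hM).congr
      (.of_forall fun x => by simp only; ring)
  have i2 : Integrable (fun x => Q x * (u x).im ^ 2) volume :=
    (integrable_mul_of_bound m2.mem.memLp m2.mem.memLp hq.1 hM).congr
      (.of_forall fun x => by simp only; ring)
  have hn : ∀ z : ℂ, ‖z‖ ^ 2 = z.re ^ 2 + z.im ^ 2 := fun z => by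
    rw [← Complex.normSq_eq_norm_sq, Complex.normSq_apply]; ring
  have e4 : ∫ x, Q x * ‖u x‖ ^ 2 = (∫ x, Q x * (u x).re ^ 2) + ∫ x, Q x * (u x).im ^ 2 := by
    rw [← integral_add i1 i2]
    refine integral_congr_ae (.of_forall fun x => ?_)
    simp only [hn]; ring
  have e5 : ‖u‖ ^ 2 = (∫ x, (u x).re ^ 2) + ∫ x, (u x).im ^ 2 := by
    rw [norm_sq_eq_integral, ← integral_add m1.mem.memLp.integrable_sq m2.mem.memLp.integrable_sq]
    refine integral_congr_ae (.of_forall fun x => ?_)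
    simp only [hn]
  rw [e4, e5, ← e3, ← e1, ← e2]
  linarith

/-- The operator `M_c` is nonnegative on functions orthogonal to `Q_c²`. -/
lemma IsGroundState.solitaryWave_form_nonneg (hα : 1 / 3 < α) (hα2 : α < 2)
    (hQ : IsGroundState α Q) {c : ℝ} (hc : 0 < c) (hs : 0 ≤ α / 2) (hs1 : α / 2 ≤ 1)
    (v : sobolev 1) (h0 : ∫ x, (solitaryWave α c Q x : ℂ) ^ 2 * (v : L2) x = 0) :
    (∫ x, solitaryWave α c Q x * ‖(v : L2) x‖ ^ 2)
      ≤ ‖rieszH hs ⟨v, sobolev_mono hs1 v.2⟩‖ ^ 2 + c * ‖(v : L2)‖ ^ 2 := by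
  have hd := hQ.fourierDecay hα hα2.le
  have hb : ∃ M, ∀ᵐ x, |Q x| ≤ M := by
    obtain ⟨q, B, hq, hqQ⟩ := hd.exists_smoothPotential hQ.mem.1
    refine ⟨B, ?_⟩
    filter_upwards [hqQ] with x hx
    rw [hx]; exact hq.bound x
  -- With k^α = c and w(x) = v(x/k), the three terms 2∫Q|w|², ∫|D^{α/2}w|² and ‖w‖² equal k/c times
  -- ∫Q_c|v|², ∫|D^{α/2}v|² and c‖v‖². The inequality for Q thus becomes the one for Q_c after
  -- division by k/c.
  set k := c ^ (1 / α) with hk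
  have hk0 : 0 < k := Real.rpow_pos_of_pos hc _
  have hki : k⁻¹ ≠ 0 := inv_ne_zero hk0.ne'
  have hkα : k ^ α = c := by
    rw [hk, ← Real.rpow_mul hc.le, one_div_mul_cancel (by linarith), Real.rpow_one]
  have hm := MemLp.comp_mul (Lp.memLp (v : L2)) hki
  have hw := hm.coeFn_toLp
  set w : L2 := hm.toLp with hwdef
  have hw1 : w ∈ sobolev 1 := sobolev_comp_mul zero_le_one v.2 hki hw
  have hwk : ∀ᵐ x, w (k * x) = (v : L2) x := by
    filter_upwards [aeeq_comp_mul hw hk0.ne'] with x hx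
    rw [hx, inv_mul_cancel_left₀ hk0.ne']
  have z : ∫ x, (Q x : ℂ) ^ 2 * w x = 0 := by
    have h1 := Measure.integral_comp_mul_left (fun x => (Q x : ℂ) ^ 2 * w x) k
    have h2 : ∫ x, (Q (k * x) : ℂ) ^ 2 * w (k * x) = 0 := by
      have h3 : (4 * c ^ 2 : ℂ) * ∫ x, (Q (k * x) : ℂ) ^ 2 * w (k * x) = 0 := by
        rw [← integral_const_mul, ← h0]
        refine integral_congr_ae ?_
        filter_upwards [hwk] with x hx
        rw [hx, solitaryWave]
        push_cast; ring
      refine (mul_eq_zero.mp h3).resolve_left ?_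
      have : (c : ℂ) ≠ 0 := by exact_mod_cast hc.ne'
      exact mul_ne_zero (by norm_num) (pow_ne_zero 2 this)
    rw [h2] at h1
    refine (smul_eq_zero.mp h1.symm).resolve_left ?_
    exact abs_ne_zero.mpr hki
  have key := hQ.complex_form_nonneg hα hd hb hs ⟨w, sobolev_mono hs1 hw1⟩
    (exists_bound_of_mem_sobolev_one hw1) z
  have e1 : ‖rieszH hs ⟨w, sobolev_mono hs1 hw1⟩‖ ^ 2
      = k / c * ‖rieszH hs ⟨v, sobolev_mono hs1 v.2⟩‖ ^ 2 := by
    have e0 : k⁻¹ ^ (2 * (α / 2)) = c⁻¹ := by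
      rw [mul_div_cancel₀ _ two_ne_zero, Real.inv_rpow hk0.le, hkα]
    rw [norm_rieszH_comp_mul hs (u := ⟨v, sobolev_mono hs1 v.2⟩) (inv_pos.mpr hk0) hw, inv_inv,
      e0, ← div_eq_mul_inv]
  have e2 : ‖w‖ ^ 2 = k * ‖(v : L2)‖ ^ 2 := by
    have h1 := Measure.integral_comp_mul_left (fun x => ‖w x‖ ^ 2) k
    rw [norm_sq_eq_integral, norm_sq_eq_integral]
    have h2 : ∫ x, ‖w (k * x)‖ ^ 2 = ∫ x, ‖(v : L2) x‖ ^ 2 := by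
      refine integral_congr_ae ?_
      filter_upwards [hwk] with x hx
      rw [hx]
    rw [← h2, h1, abs_of_pos (inv_pos.mpr hk0), smul_eq_mul, mul_inv_cancel_left₀ hk0.ne']
  have e3 : ∫ x, Q x * ‖w x‖ ^ 2
      = k / (2 * c) * ∫ x, solitaryWave α c Q x * ‖(v : L2) x‖ ^ 2 := by
    have h1 := Measure.integral_comp_mul_left (fun x => Q x * ‖w x‖ ^ 2) k
    have h2 : ∫ x, solitaryWave α c Q x * ‖(v : L2) x‖ ^ 2
        = 2 * c * ∫ x, Q (k * x) * ‖w (k * x)‖ ^ 2 := by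
      rw [← integral_const_mul]
      refine integral_congr_ae ?_
      filter_upwards [hwk] with x hx
      rw [hx, solitaryWave]
      ring
    rw [h2, h1, abs_of_pos (inv_pos.mpr hk0), smul_eq_mul]
    field_simp
  simp only at key
  rw [e1, e2, e3] at key
  have h1 : 0 < k / c := by positivity
  refine le_of_mul_le_mul_left ?_ h1
  have h2 : k / c * (c * ‖(v : L2)‖ ^ 2) = k * ‖(v : L2)‖ ^ 2 := by field_simp
  have h3 : 2 * (k / (2 * c) * ∫ x, solitaryWave α c Q x * ‖(v : L2) x‖ ^ 2)
      = k / c * ∫ x, solitaryWave α c Q x * ‖(v : L2) x‖ ^ 2 := by field_simp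
  rw [mul_add, h2, ← h3]
  exact key

end Index

/-! ### Graphs of Fourier multipliers -/

/-- `w = m(D) u`, on the Fourier side. -/
def IsMult (m : ℝ → ℂ) (u w : L2) : Prop :=
  fourierL2 w =ᵐ[volume] fun η => m (2 * Real.pi * η) * fourierL2 u η

lemma IsMult.exists_multiplier {m : ℝ → ℂ} {u w : L2} (h : IsMult m u w) :
    ∃ hu : u ∈ (multiplier m).domain, multiplier m ⟨u, hu⟩ = w := by
  have hu : u ∈ (multiplier m).domain := mem_multiplier.mpr ((Lp.memLp (fourierL2 w)).ae_eq h)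
  exact ⟨hu, fourierL2_injective_ae ((fourierL2_multiplier m ⟨u, hu⟩).trans h.symm)⟩

lemma isMult_multiplier (m : ℝ → ℂ) (u : (multiplier m).domain) :
    IsMult m u (multiplier m u) := fourierL2_multiplier m u

lemma exists_isMult {m : ℝ → ℂ} (hm : Measurable m) {s C : ℝ}
    (h : ∀ ξ, ‖m ξ‖ ≤ C * (1 + ξ ^ 2) ^ (s / 2)) {u : L2} (hu : u ∈ sobolev s) :
    ∃ w, IsMult m u w :=
  ⟨_, isMult_multiplier m ⟨u, sobolev_le_multiplier hm h hu⟩⟩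

lemma IsMult.unique {m : ℝ → ℂ} {u w w' : L2} (h : IsMult m u w) (h' : IsMult m u w') : w = w' :=
  fourierL2_injective_ae (h.trans h'.symm)

lemma IsMult.add {m : ℝ → ℂ} {u w u' w' : L2} (h : IsMult m u w) (h' : IsMult m u' w') :
    IsMult m (u + u') (w + w') := by
  filter_upwards [h, h', fourierL2_add u u', fourierL2_add w w'] with η h1 h2 h3 h4
  rw [h4, h3, h1, h2]; ring

lemma IsMult.smul {m : ℝ → ℂ} {u w : L2} (h : IsMult m u w) (a : ℂ) :
    IsMult m (a • u) (a • w) := by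
  filter_upwards [h, fourierL2_smul a u, fourierL2_smul a w] with η h1 h3 h4
  rw [h4, h3, h1]; ring

lemma IsMult.add_symbol {m m' : ℝ → ℂ} {u w w' : L2} (h : IsMult m u w) (h' : IsMult m' u w') :
    IsMult (fun ξ => m ξ + m' ξ) u (w + w') := by
  filter_upwards [h, h', fourierL2_add w w'] with η h1 h2 h4
  rw [h4, h1, h2]; ring

lemma IsMult.const (a : ℂ) (u : L2) : IsMult (fun _ => a) u (a • u) := fourierL2_smul a u

lemma IsMult.comp {m m' : ℝ → ℂ} {u v w : L2} (h : IsMult m u v) (h' : IsMult m' v w) :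
    IsMult (fun ξ => m' ξ * m ξ) u w := by
  filter_upwards [h, h'] with η h1 h2
  rw [h2, h1]; ring

/-- If `m'' = m' m` then `m''(D) u = m'(D) (m(D) u)`. -/
lemma IsMult.of_comp {m m' m'' : ℝ → ℂ} {u v w : L2} (h : IsMult m u v) (h'' : IsMult m'' u w)
    (hm : ∀ ξ, m'' ξ = m' ξ * m ξ) : IsMult m' v w := by
  filter_upwards [h, h''] with η h1 h2
  rw [h2, h1, hm]; ring

lemma IsMult.congr_symbol {m m' : ℝ → ℂ} {u w : L2} (h : IsMult m u w) (hm : ∀ ξ, m ξ = m' ξ) :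
    IsMult m' u w := by
  filter_upwards [h] with η h1
  rw [h1, hm]

/-- Ellipticity: a symbol that dominates the Bessel weight forces the corresponding regularity. -/
lemma mem_sobolev_of_isMult {m : ℝ → ℂ} {u w : L2} {s C : ℝ} (h : IsMult m u w)
    (hm : ∀ ξ, (1 + ξ ^ 2) ^ (s / 2) ≤ C * ‖m ξ‖) : u ∈ sobolev s := by
  rw [mem_sobolev]
  refine ((Lp.memLp (fourierL2 w)).const_mul (C : ℂ)).of_le
    ((Measurable.aestronglyMeasurable (by fun_prop)).mul (Lp.aestronglyMeasurable _)) ?_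
  filter_upwards [h] with η hη
  rw [hη, norm_mul, norm_weight, norm_mul, norm_mul, Complex.norm_real, ← mul_assoc]
  refine mul_le_mul_of_nonneg_right ((hm _).trans ?_) (norm_nonneg _)
  exact mul_le_mul_of_nonneg_right (Real.le_norm_self C) (norm_nonneg _)

lemma isMult_bessel (s : ℝ) (u : L2) (hu : u ∈ sobolev s) :
    IsMult (fun ξ => (((1 + ξ ^ 2) ^ (s / 2) : ℝ) : ℂ)) u (bessel s ⟨u, hu⟩) :=
  fourierL2_multiplier _ _

lemma IsMult.norm_le {m m' : ℝ → ℂ} {u w w' : L2} {C : ℝ} (hC : 0 ≤ C) (h : IsMult m u w)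
    (h' : IsMult m' u w') (hm : ∀ ξ, ‖m ξ‖ ≤ C * ‖m' ξ‖) : ‖w‖ ≤ C * ‖w'‖ := by
  rw [← fourierL2.norm_map w, ← fourierL2.norm_map w']
  have : ‖fourierL2 w‖ ≤ ‖(C : ℂ) • fourierL2 w'‖ := by
    refine Lp.norm_le_norm_of_ae_le ?_
    filter_upwards [h, h', Lp.coeFn_smul (C : ℂ) (fourierL2 w')] with η h1 h2 h3
    rw [h1, h3, Pi.smul_apply, h2, norm_smul, norm_mul, norm_mul, Complex.norm_real,
      Real.norm_of_nonneg hC, ← mul_assoc]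
    exact mul_le_mul_of_nonneg_right (hm _) (norm_nonneg _)
  rwa [norm_smul, Complex.norm_real, Real.norm_of_nonneg hC] at this

lemma IsMult.inner_eq {m : ℝ → ℂ} {u v u' v' : L2} (h : IsMult m u u')
    (h' : IsMult (fun ξ => star (m ξ)) v v') : inner ℂ v u' = inner ℂ v' u := by
  refine inner_eq_of_fourier ?_
  filter_upwards [h, h'] with η h1 h2
  rw [h1, h2]
  simp only [star_mul', star_star]
  ring

/-! ### Bounded multiplication operators and bounded multipliers -/

lemma memLp_mul_of_norm_le {b : ℝ → ℂ} (hm : AEStronglyMeasurable b volume) {C : ℝ}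
    (hC : ∀ x, ‖b x‖ ≤ C) (u : L2) : MemLp (fun x => b x * u x) 2 volume :=
  ((Lp.memLp u).const_mul (C : ℂ)).of_le (hm.mul (Lp.aestronglyMeasurable _))
    (Filter.Eventually.of_forall fun x => by
      rw [norm_mul, norm_mul, Complex.norm_real]
      exact mul_le_mul_of_nonneg_right ((hC x).trans (Real.le_norm_self C)) (norm_nonneg _))

lemma norm_toLp_mul_le {b : ℝ → ℂ} (hm : AEStronglyMeasurable b volume) {C : ℝ}
    (hC : ∀ x, ‖b x‖ ≤ C) (u : L2) : ‖(memLp_mul_of_norm_le hm hC u).toLp‖ ≤ C * ‖u‖ := by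
  have hC0 : 0 ≤ C := (norm_nonneg _).trans (hC 0)
  have : ‖(memLp_mul_of_norm_le hm hC u).toLp‖ ≤ ‖(C : ℂ) • u‖ := by
    refine Lp.norm_le_norm_of_ae_le ?_
    filter_upwards [(memLp_mul_of_norm_le hm hC u).coeFn_toLp, Lp.coeFn_smul (C : ℂ) u]
      with x h1 h2
    rw [h1, h2, Pi.smul_apply, norm_mul, norm_smul, Complex.norm_real, Real.norm_of_nonneg hC0]
    exact mul_le_mul_of_nonneg_right (hC x) (norm_nonneg _)
  rwa [norm_smul, Complex.norm_real, Real.norm_of_nonneg hC0] at this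

/-- Multiplication by a bounded measurable function. -/
def mulB (b : ℝ → ℂ) (hm : AEStronglyMeasurable b volume) (C : ℝ) (hC : ∀ x, ‖b x‖ ≤ C) :
    L2 →L[ℂ] L2 :=
  LinearMap.mkContinuous
    { toFun := fun u => (memLp_mul_of_norm_le hm hC u).toLp
      map_add' := fun u v => by
        rw [← MemLp.toLp_add]
        refine MemLp.toLp_congr _ _ ?_
        filter_upwards [Lp.coeFn_add u v] with x hx
        rw [Pi.add_apply, hx, Pi.add_apply, mul_add]
      map_smul' := fun a u => by
        rw [RingHom.id_apply, ← MemLp.toLp_const_smul]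
        refine MemLp.toLp_congr _ _ ?_
        filter_upwards [Lp.coeFn_smul a u] with x hx
        rw [Pi.smul_apply, hx, Pi.smul_apply, smul_eq_mul, smul_eq_mul, mul_left_comm] }
    C (norm_toLp_mul_le hm hC)

section

variable {b : ℝ → ℂ} {hm : AEStronglyMeasurable b volume} {C : ℝ} {hC : ∀ x, ‖b x‖ ≤ C}

lemma mulB_ae_eq (u : L2) : mulB b hm C hC u =ᵐ[volume] fun x => b x * u x :=
  (memLp_mul_of_norm_le hm hC u).coeFn_toLp

lemma norm_mulB_le (u : L2) : ‖mulB b hm C hC u‖ ≤ C * ‖u‖ := norm_toLp_mul_le hm hC u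

end

/-- The Fourier multiplier with a bounded measurable symbol. -/
def multB (b : ℝ → ℂ) (hm : Measurable b) (C : ℝ) (hC : ∀ ξ, ‖b ξ‖ ≤ C) : L2 →L[ℂ] L2 :=
  (fourierL2.symm.toContinuousLinearEquiv : L2 →L[ℂ] L2) ∘L
    mulB (fun η => b (2 * Real.pi * η))
      (hm.comp (measurable_const.mul measurable_id)).aestronglyMeasurable C (fun _ => hC _) ∘L
    (fourierL2.toContinuousLinearEquiv : L2 →L[ℂ] L2)

lemma isMult_multB {b : ℝ → ℂ} {hm : Measurable b} {C : ℝ} {hC : ∀ ξ, ‖b ξ‖ ≤ C} (u : L2) :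
    IsMult b u (multB b hm C hC u) := by
  have h1 : fourierL2 (multB b hm C hC u) = mulB (fun η => b (2 * Real.pi * η))
      (hm.comp (measurable_const.mul measurable_id)).aestronglyMeasurable C (fun _ => hC _)
      (fourierL2 u) := fourierL2.apply_symm_apply _
  rw [IsMult, h1]
  exact mulB_ae_eq _

/-! ### Weak derivatives -/

-- Fourier transformation is injective on tempered distributions and turns ∂ₓ into multiplication by
-- 2πiη, so the symbol iξ describes exactly the weak derivative. This gives access to the product
-- rule, which is not visible on the Fourier side.
open LineDeriv in
lemma isMult_deriv_iff {v z : L2} : IsMult (fun ξ => Complex.I * ξ) v z ↔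
    ∀ g : SchwartzMap ℝ ℂ, ∫ x, _root_.deriv g x * v x = -∫ x, g x * z x := by
  have hT : (∀ g : SchwartzMap ℝ ℂ, ∫ x, _root_.deriv g x * v x = -∫ x, g x * z x) ↔
      ∂_{(1 : ℝ)} (Lp.toTemperedDistribution v) = Lp.toTemperedDistribution z := by
    have e : ∀ g : SchwartzMap ℝ ℂ, (∂_{(1 : ℝ)} (Lp.toTemperedDistribution v)) g
        = -∫ x, _root_.deriv g x * v x := fun g => by
      rw [TemperedDistribution.lineDerivOp_apply_apply, map_neg, Lp.toTemperedDistribution_apply]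
      simp only [smul_eq_mul, SchwartzMap.lineDerivOp_apply_eq_fderiv, fderiv_apply_one_eq_deriv]
    constructor
    · intro h
      ext g
      rw [e, h, neg_neg, Lp.toTemperedDistribution_apply]
      rfl
    · intro h g
      have h1 := congrArg (fun T => T g) h
      simp only [e, Lp.toTemperedDistribution_apply, smul_eq_mul] at h1
      rw [← h1, neg_neg]
  rw [hT]
  have hinj : ∂_{(1 : ℝ)} (Lp.toTemperedDistribution v) = Lp.toTemperedDistribution z ↔
      𝓕 (∂_{(1 : ℝ)} (Lp.toTemperedDistribution v)) = 𝓕 (Lp.toTemperedDistribution z) := by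
    refine ⟨fun h => by rw [h], fun h => ?_⟩
    have := congrArg (fun T => 𝓕⁻ T) h
    simpa using this
  have hg1 : (fun x : ℝ => (x : ℂ)).HasTemperateGrowth := Function.Complex.hasTemperateGrowth_ofReal
  have hev : ∀ g : SchwartzMap ℝ ℂ, 𝓕 (∂_{(1 : ℝ)} (Lp.toTemperedDistribution v)) g
      = ∫ η, g η * (Complex.I * ((2 * Real.pi * η : ℝ) : ℂ) * fourierL2 v η) := fun g => by
    rw [TemperedDistribution.fourier_lineDerivOp_eq, Lp.fourier_toTemperedDistribution_eq]
    have h2 : (fun x : ℝ => ((inner ℝ x (1 : ℝ) : ℝ) : ℂ)) = fun x : ℝ => (x : ℂ) := by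
      ext x; simp
    simp only [smul_apply, smul_eq_mul,
      TemperedDistribution.smulLeftCLM_apply_apply, h2,
      Lp.toTemperedDistribution_apply, SchwartzMap.smulLeftCLM_apply_apply hg1]
    rw [← integral_const_mul]
    refine integral_congr_ae (Filter.Eventually.of_forall fun η => ?_)
    simp only
    push_cast
    have : 𝓕 v = fourierL2 v := rfl
    rw [this]
    ring
  have hev2 : ∀ g : SchwartzMap ℝ ℂ, 𝓕 (Lp.toTemperedDistribution z) g
      = ∫ η, g η * fourierL2 z η := fun g => by
    rw [Lp.fourier_toTemperedDistribution_eq, Lp.toTemperedDistribution_apply]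
    rfl
  rw [hinj]
  constructor
  · intro h
    ext g
    rw [hev, hev2]
    refine integral_congr_ae ?_
    filter_upwards [h] with η hη
    rw [hη]
  · intro h
    have hloc : LocallyIntegrable
        (fun η => Complex.I * ((2 * Real.pi * η : ℝ) : ℂ) * fourierL2 v η) volume := by
      have hc : Continuous fun η : ℝ => Complex.I * ((2 * Real.pi * η : ℝ) : ℂ) := by fun_prop
      have := (locallyIntegrable_L2 (fourierL2 v)).locallyIntegrableOn Set.univ
      rw [← locallyIntegrableOn_univ]
      exact this.continuousOn_mul hc.continuousOn isOpen_univ.isLocallyClosed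
    refine ae_eq_of_integral_contDiff_smul_eq (locallyIntegrable_L2 _) hloc fun g hg hg' => ?_
    have h1 := congrArg (fun T => T (IsTest.schwartz ⟨hg, hg'⟩)) h
    simp only [hev, hev2, IsTest.schwartz_apply] at h1
    simp only [Complex.real_smul]
    exact h1.symm

/-- Multiplication by a smooth potential. -/
def SmoothPotential.mul {q : ℝ → ℝ} {B : ℝ} (hq : SmoothPotential q B) : L2 →L[ℂ] L2 :=
  mulB (fun x => (q x : ℂ))
    (Complex.continuous_ofReal.comp hq.differentiable.continuous).aestronglyMeasurable B
    (fun x => by simpa using hq.bound x)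

/-- Multiplication by the derivative of a smooth potential. -/
def SmoothPotential.mulDeriv {q : ℝ → ℝ} {B : ℝ} (hq : SmoothPotential q B) : L2 →L[ℂ] L2 :=
  mulB (fun x => ((_root_.deriv q x : ℝ) : ℂ))
    (Complex.continuous_ofReal.comp
      (hq.growth.1.continuous_deriv (by simp))).aestronglyMeasurable B
    (fun x => by simpa using hq.bound_deriv x)

/-- The product rule. -/
lemma SmoothPotential.isMult_deriv_mul {q : ℝ → ℝ} {B : ℝ} (hq : SmoothPotential q B) {v z : L2}
    (h : IsMult (fun ξ => Complex.I * ξ) v z) :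
    IsMult (fun ξ => Complex.I * ξ) (hq.mul v) (hq.mulDeriv v + hq.mul z) := by
  rw [isMult_deriv_iff] at h ⊢
  intro g
  have hgr : (fun x : ℝ => (q x : ℂ)).HasTemperateGrowth :=
    Function.Complex.hasTemperateGrowth_ofReal.comp hq.growth
  -- The weak derivative of v is tested against q·g, which is a Schwartz function because q has
  -- temperate growth; the term containing q' is then moved to the other side.
  set k : SchwartzMap ℝ ℂ := SchwartzMap.smulLeftCLM ℂ (fun x : ℝ => (q x : ℂ)) g with hk
  have hkx : ∀ x, k x = q x * g x := fun x => by
    rw [hk, SchwartzMap.smulLeftCLM_apply_apply hgr, smul_eq_mul]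
  have hkd : ∀ x, _root_.deriv k x = (_root_.deriv q x : ℝ) * g x + q x * _root_.deriv g x := fun x => by
    have h1 : HasDerivAt (fun x => (q x : ℂ) * g x)
        ((_root_.deriv q x : ℝ) * g x + q x * _root_.deriv g x) x :=
      ((hq.differentiable x).hasDerivAt.ofReal_comp).mul (g.hasDerivAt x)
    have h2 : (k : ℝ → ℂ) = fun x => (q x : ℂ) * g x := funext hkx
    rw [h2]
    exact h1.deriv
  have h3 := h k
  have i1 : Integrable (fun x => g x * hq.mulDeriv v x) volume :=
    (g.memLp 2 volume).integrable_mul (Lp.memLp _)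
  have i2 : Integrable (fun x => g x * hq.mul z x) volume :=
    (g.memLp 2 volume).integrable_mul (Lp.memLp _)
  have i3 : Integrable (fun x => _root_.deriv g x * hq.mul v x) volume :=
    ((SchwartzMap.derivCLM ℂ ℂ g).memLp 2 volume).integrable_mul (Lp.memLp _)
  have e1 : ∫ x, g x * (hq.mulDeriv v + hq.mul z) x
      = (∫ x, g x * hq.mulDeriv v x) + ∫ x, g x * hq.mul z x := by
    rw [← integral_add i1 i2]
    refine integral_congr_ae ?_
    filter_upwards [Lp.coeFn_add (hq.mulDeriv v) (hq.mul z)] with x hx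
    rw [hx, Pi.add_apply, mul_add]
  have e2 : ∫ x, _root_.deriv k x * v x
      = (∫ x, g x * hq.mulDeriv v x) + ∫ x, _root_.deriv g x * hq.mul v x := by
    rw [← integral_add i1 i3]
    refine integral_congr_ae ?_
    filter_upwards [mulB_ae_eq (b := fun x => ((_root_.deriv q x : ℝ) : ℂ)) v,
      mulB_ae_eq (b := fun x => (q x : ℂ)) v] with x hx hx'
    rw [hkd, SmoothPotential.mulDeriv, SmoothPotential.mul, hx, hx']
    ring
  have e3 : ∫ x, k x * z x = ∫ x, g x * hq.mul z x := by
    refine integral_congr_ae ?_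
    filter_upwards [mulB_ae_eq (b := fun x => (q x : ℂ)) z] with x hx
    rw [hkx, SmoothPotential.mul, hx]
    ring
  rw [e1]
  rw [e2, e3] at h3
  linear_combination h3

/-! ### The operator `L` on `H^{2+α}` -/

section LinearPMap

variable {f g : L2 →ₗ.[ℂ] L2} {u v w : L2}

/-- Membership in the domain and the value are carried together as one existential statement, so a
composition of unbounded operators is evaluated and shown to be defined in one pass. -/
lemma pcomp_eq (hf : ∃ h, f ⟨u, h⟩ = v) (hg : ∃ h, g ⟨v, h⟩ = w) :
    ∃ h, pcomp g f ⟨u, h⟩ = w := by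
  obtain ⟨h1, rfl⟩ := hf
  obtain ⟨h2, rfl⟩ := hg
  exact ⟨⟨h1, h2⟩, rfl⟩

lemma add_eq (hf : ∃ h, f ⟨u, h⟩ = v) (hg : ∃ h, g ⟨u, h⟩ = w) :
    ∃ h, (f + g) ⟨u, h⟩ = v + w := by
  obtain ⟨h1, rfl⟩ := hf
  obtain ⟨h2, rfl⟩ := hg
  exact ⟨⟨h1, h2⟩, rfl⟩

lemma sub_eq (hf : ∃ h, f ⟨u, h⟩ = v) (hg : ∃ h, g ⟨u, h⟩ = w) :
    ∃ h, (f - g) ⟨u, h⟩ = v - w := by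
  obtain ⟨h1, rfl⟩ := hf
  obtain ⟨h2, rfl⟩ := hg
  exact ⟨⟨h1, h2⟩, rfl⟩

lemma neg_eq (hf : ∃ h, f ⟨u, h⟩ = v) : ∃ h, (-f) ⟨u, h⟩ = -v := by
  obtain ⟨h1, rfl⟩ := hf
  exact ⟨h1, rfl⟩

lemma domRestrict_eq {S : Submodule ℂ L2} (hS : u ∈ S) (hf : ∃ h, f ⟨u, h⟩ = v) :
    ∃ h, f.domRestrict S ⟨u, h⟩ = v := by
  obtain ⟨h1, rfl⟩ := hf
  exact ⟨⟨hS, h1⟩, rfl⟩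

lemma mulOp_eq {b : ℝ → ℂ} (h : v =ᵐ[volume] fun x => b x * u x) :
    ∃ h, mulOp b ⟨u, h⟩ = v := by
  have hm : MemLp (fun x => b x * u x) 2 volume := (Lp.memLp v).ae_eq h
  refine ⟨hm, Lp.ext ?_⟩
  exact (MemLp.coeFn_toLp hm).trans h.symm

end LinearPMap

/-- The symbol of the principal part of `L`. -/
def symbolL (α c : ℝ) (ξ : ℝ) : ℝ := |ξ| ^ (2 + α) + c * ξ ^ 2

lemma measurable_symbolL (α c : ℝ) : Measurable (symbolL α c) := by
  unfold symbolL; fun_prop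

lemma abs_le_weight (ξ : ℝ) {s : ℝ} (hs : 1 ≤ s) : |ξ| ≤ (1 + ξ ^ 2) ^ (s / 2) := by
  have h1 := abs_rpow_le_weight zero_le_one ξ
  rw [Real.rpow_one] at h1
  refine h1.trans (Real.rpow_le_rpow_of_exponent_le (by nlinarith [sq_nonneg ξ]) (by linarith))

lemma sq_le_weight (ξ : ℝ) {s : ℝ} (hs : 2 ≤ s) : ξ ^ 2 ≤ (1 + ξ ^ 2) ^ (s / 2) := by
  have h1 : 1 ≤ 1 + ξ ^ 2 := by nlinarith [sq_nonneg ξ]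
  calc ξ ^ 2 ≤ (1 + ξ ^ 2) ^ (1 : ℝ) := by rw [Real.rpow_one]; linarith
    _ ≤ _ := Real.rpow_le_rpow_of_exponent_le h1 (by linarith)

lemma abs_rpow_add_two (ξ : ℝ) {α : ℝ} (hα : 0 ≤ α) : |ξ| ^ (2 + α) = |ξ| ^ α * ξ ^ 2 := by
  rw [add_comm, Real.rpow_add_of_nonneg (abs_nonneg _) hα (by norm_num), Real.rpow_two, sq_abs]

lemma exists_isMult_deriv {u : L2} {s : ℝ} (hs : 1 ≤ s) (hu : u ∈ sobolev s) :
    ∃ w, IsMult (fun ξ => Complex.I * ξ) u w := by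
  refine exists_isMult (by fun_prop) (C := 1) (fun ξ => ?_) hu
  simpa using abs_le_weight ξ hs

/-- The derivative maps `H^{s+1}` to `H^s`. -/
lemma IsMult.deriv_mem_sobolev {u v : L2} {s t : ℝ} (hst : s + 1 ≤ t)
    (h : IsMult (fun ξ => Complex.I * ξ) u v) (hu : u ∈ sobolev t) : v ∈ sobolev s := by
  obtain ⟨w, hw⟩ := exists_isMult (m := fun ξ : ℝ => (((1 + ξ ^ 2) ^ (s / 2) : ℝ) : ℂ)
    * (Complex.I * ξ)) (by fun_prop) (s := t) (C := 1) (fun ξ => by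
      rw [norm_mul, Complex.norm_real, Real.norm_of_nonneg (by positivity), norm_mul,
        Complex.norm_I, one_mul, Complex.norm_real, Real.norm_eq_abs, one_mul]
      have h1 : 1 ≤ 1 + ξ ^ 2 := by nlinarith [sq_nonneg ξ]
      calc _ ≤ (1 + ξ ^ 2) ^ (s / 2) * (1 + ξ ^ 2) ^ ((1 : ℝ) / 2) :=
            mul_le_mul_of_nonneg_left (abs_le_weight ξ le_rfl) (by positivity)
        _ = (1 + ξ ^ 2) ^ (s / 2 + 1 / 2) := (Real.rpow_add (by positivity) _ _).symm
        _ ≤ _ := Real.rpow_le_rpow_of_exponent_le h1 (by linarith)) hu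
  refine mem_sobolev_of_isMult (h.of_comp hw fun ξ => rfl) (C := 1) fun ξ => ?_
  rw [Complex.norm_real, one_mul]
  exact Real.le_norm_self _

section Operator

variable {α c B : ℝ} {q Qc : ℝ → ℝ}

lemma exists_isMult_symbolL (hα : 0 ≤ α) (hc : 0 ≤ c) {u : L2} (hu : u ∈ sobolev (2 + α)) :
    ∃ w, IsMult (fun ξ => (symbolL α c ξ : ℂ)) u w := by
  refine exists_isMult (m := fun ξ => (symbolL α c ξ : ℂ))
    (Complex.measurable_ofReal.comp (measurable_symbolL α c)) (s := 2 + α)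
    (C := 1 + c) (fun ξ => ?_) hu
  have h0 : 0 ≤ symbolL α c ξ := by unfold symbolL; positivity
  rw [Complex.norm_real, Real.norm_of_nonneg h0, symbolL, add_mul, one_mul]
  exact add_le_add (abs_rpow_le_weight (by linarith) ξ)
    (mul_le_mul_of_nonneg_left (sq_le_weight ξ (by linarith)) hc)

/-- The action of `L` on `H^{2+α}`. -/
lemma opL_eq (hα : 0 ≤ α) (hq : SmoothPotential q B) (hQ : Qc =ᵐ[volume] q)
    {u P D₁ D₂ : L2} (hu : u ∈ sobolev (2 + α)) (hP : IsMult (fun ξ => (symbolL α c ξ : ℂ)) u P)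
    (h1 : IsMult (fun ξ => Complex.I * ξ) u D₁) (h2 : IsMult (fun ξ => Complex.I * ξ) D₁ D₂) :
    ∃ h, opL α c Qc ⟨u, h⟩ = P + (hq.mulDeriv D₁ + hq.mul D₂) := by
  have hb : ∀ ξ : ℝ, ‖((|ξ| ^ α : ℝ) : ℂ) * (Complex.I * ξ)‖ ≤ 1 * (1 + ξ ^ 2) ^ ((2 + α) / 2) :=
    fun ξ => by
      rw [norm_mul, Complex.norm_real, Real.norm_of_nonneg (by positivity), norm_mul,
        Complex.norm_I, one_mul, Complex.norm_real, Real.norm_eq_abs, one_mul]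
      have h1 : 1 ≤ 1 + ξ ^ 2 := by nlinarith [sq_nonneg ξ]
      calc _ ≤ (1 + ξ ^ 2) ^ (α / 2) * (1 + ξ ^ 2) ^ ((1 : ℝ) / 2) :=
            mul_le_mul (abs_rpow_le_weight hα ξ) (abs_le_weight ξ le_rfl) (abs_nonneg _)
              (by positivity)
        _ = (1 + ξ ^ 2) ^ (α / 2 + 1 / 2) := (Real.rpow_add (by positivity) _ _).symm
        _ ≤ _ := Real.rpow_le_rpow_of_exponent_le h1 (by linarith)
  -- Here r = D^α∂ₓu, obtained directly from u ∈ H^{2+α}. Its derivative has symbol |ξ|^α(iξ)² =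
  -- -|ξ|^{2+α}, which is minus `symbolL` plus cξ²; hence ∂ₓr = -P - c∂ₓ²u.
  obtain ⟨r, hr⟩ := exists_isMult (by fun_prop) hb hu
  have hr1 : IsMult (fun ξ => ((|ξ| ^ α : ℝ) : ℂ)) D₁ r := h1.of_comp hr fun ξ => rfl
  have hcu : IsMult (fun ξ => (c : ℂ) * (Complex.I * ξ * (Complex.I * ξ))) u ((c : ℂ) • D₂) :=
    ((h1.comp h2).comp (IsMult.const (c : ℂ) D₂)).congr_symbol fun ξ => rfl
  have hr2 : IsMult (fun ξ => Complex.I * ξ) r (-P - (c : ℂ) • D₂) := by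
    refine hr.of_comp (m'' := fun ξ => -1 * symbolL α c ξ
      + -1 * ((c : ℂ) * (Complex.I * ξ * (Complex.I * ξ)))) ?_ fun ξ => ?_
    · have := (hP.comp (IsMult.const (-1) P)).add_symbol (hcu.comp (IsMult.const (-1) _))
      convert this using 1
      module
    · rw [symbolL, abs_rpow_add_two ξ hα]
      push_cast
      ring_nf
      simp only [Complex.I_sq]
      ring
  have hMD : ∃ h, opM α c Qc ⟨D₁, h⟩ = r - hq.mul D₁ + (c : ℂ) • D₁ := by
    refine add_eq (sub_eq hr1.exists_multiplier (mulOp_eq ?_)) (mulOp_eq ?_)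
    · filter_upwards [mulB_ae_eq (b := fun x => (q x : ℂ)) D₁, hQ] with x h3 h4
      rw [h4]
      exact h3
    · exact Lp.coeFn_smul _ _
  have hz : IsMult (fun ξ => Complex.I * ξ) (r - hq.mul D₁ + (c : ℂ) • D₁)
      (-(P + (hq.mulDeriv D₁ + hq.mul D₂))) := by
    have := (hr2.add ((hq.isMult_deriv_mul h2).smul (-1))).add (h2.smul (c : ℂ))
    convert this using 1
    · module
    · module
  have := domRestrict_eq hu (neg_eq (pcomp_eq (pcomp_eq h1.exists_multiplier hMD)
    hz.exists_multiplier))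
  rw [neg_neg] at this
  exact this

/-- Since Q_c is smooth with bounded derivative, every composition in `opL` is defined on all of
H^{2+α}; the restriction in that definition loses nothing. -/
lemma sobolev_le_opL (hα : 0 ≤ α) (hc : 0 ≤ c) (hq : SmoothPotential q B)
    (hQ : Qc =ᵐ[volume] q) : sobolev (2 + α) ≤ (opL α c Qc).domain := by
  intro u hu
  obtain ⟨P, hP⟩ := exists_isMult_symbolL hα hc hu
  obtain ⟨D₁, h1⟩ := exists_isMult_deriv (by linarith) hu
  obtain ⟨D₂, h2⟩ := exists_isMult_deriv le_rfl (h1.deriv_mem_sobolev (by linarith) hu)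
  exact (opL_eq hα hq hQ hu hP h1 h2).1

/-- The operator `L` as a linear map on `H^{2+α}`. -/
def opLH (h : sobolev (2 + α) ≤ (opL α c Qc).domain) : sobolev (2 + α) →ₗ[ℂ] L2 where
  toFun u := opL α c Qc ⟨u, h u.2⟩
  map_add' u v := (opL α c Qc).map_add ⟨u, h u.2⟩ ⟨v, h v.2⟩
  map_smul' a u := (opL α c Qc).map_smul a ⟨u, h u.2⟩

variable (h : sobolev (2 + α) ≤ (opL α c Qc).domain)

lemma opLH_eq (hα : 0 ≤ α) (hq : SmoothPotential q B) (hQ : Qc =ᵐ[volume] q)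
    {u : sobolev (2 + α)} {P D₁ D₂ : L2}
    (hP : IsMult (fun ξ => (symbolL α c ξ : ℂ)) (u : L2) P)
    (h1 : IsMult (fun ξ => Complex.I * ξ) (u : L2) D₁)
    (h2 : IsMult (fun ξ => Complex.I * ξ) D₁ D₂) :
    opLH h u = P + (hq.mulDeriv D₁ + hq.mul D₂) :=
  (opL_eq hα hq hQ u.2 hP h1 h2).2

lemma SmoothPotential.inner_mul_comm (hq : SmoothPotential q B) (u v : L2) :
    inner ℂ u (hq.mul v) = inner ℂ (hq.mul u) v := by
  rw [inner_L2, inner_L2]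
  refine integral_congr_ae ?_
  filter_upwards [mulB_ae_eq (b := fun x => (q x : ℂ)) u,
    mulB_ae_eq (b := fun x => (q x : ℂ)) v] with x h1 h2
  rw [SmoothPotential.mul, h1, h2]
  simp only [star_mul', Complex.star_def, Complex.conj_ofReal]
  ring

lemma SmoothPotential.re_inner_mul (hq : SmoothPotential q B) (u : L2) :
    (inner ℂ u (hq.mul u)).re = ∫ x, q x * ‖u x‖ ^ 2 := by
  have h1 : inner ℂ u (hq.mul u) = ((∫ x, q x * ‖u x‖ ^ 2 : ℝ) : ℂ) := by
    rw [inner_L2, ← integral_complex_ofReal]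
    refine integral_congr_ae ?_
    filter_upwards [mulB_ae_eq (b := fun x => (q x : ℂ)) u] with x h1
    rw [SmoothPotential.mul, h1, mul_left_comm, Complex.star_def,
      ← Complex.normSq_eq_conj_mul_self, Complex.normSq_eq_norm_sq]
    push_cast; rfl
  rw [h1, Complex.ofReal_re]

/-- The sesquilinear form of `L`. -/
lemma inner_opLH (hα : 0 ≤ α) (hq : SmoothPotential q B) (hQ : Qc =ᵐ[volume] q)
    {u : sobolev (2 + α)} {P D₁ w W₁ : L2}
    (hP : IsMult (fun ξ => (symbolL α c ξ : ℂ)) (u : L2) P)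
    (h1 : IsMult (fun ξ => Complex.I * ξ) (u : L2) D₁)
    (hw : IsMult (fun ξ => Complex.I * ξ) w W₁) :
    inner ℂ w (opLH h u) = inner ℂ w P - inner ℂ W₁ (hq.mul D₁) := by
  obtain ⟨D₂, h2⟩ := exists_isMult_deriv le_rfl (h1.deriv_mem_sobolev (by linarith) u.2)
  rw [opLH_eq h hα hq hQ hP h1 h2, inner_add_right, sub_eq_add_neg, ← inner_neg_left]
  congr 1
  -- The potential part of Lu is ∂ₓ(q∂ₓu). Moving the outer derivative to w leaves only one
  -- derivative on w, so the form makes sense for w of lower regularity than u.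
  refine (hq.isMult_deriv_mul h2).inner_eq ?_
  have := hw.comp (IsMult.const (-1) W₁)
  rw [neg_one_smul] at this
  refine this.congr_symbol fun ξ => ?_
  simp

/-- The principal symbol and the potential are real, so each of the two terms of the form in
`inner_opLH` is Hermitian. -/
lemma inner_opLH_comm (hα : 0 ≤ α) (hc : 0 ≤ c) (hq : SmoothPotential q B)
    (hQ : Qc =ᵐ[volume] q) (u v : sobolev (2 + α)) :
    inner ℂ (v : L2) (opLH h u) = inner ℂ (opLH h v) (u : L2) := by
  obtain ⟨P, hP⟩ := exists_isMult_symbolL hα hc u.2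
  obtain ⟨P', hP'⟩ := exists_isMult_symbolL hα hc v.2
  obtain ⟨D, hD⟩ := exists_isMult_deriv (by linarith) u.2
  obtain ⟨D', hD'⟩ := exists_isMult_deriv (by linarith) v.2
  rw [← inner_conj_symm (opLH h v) (u : L2), inner_opLH h hα hq hQ hP hD hD',
    inner_opLH h hα hq hQ hP' hD' hD, map_sub, inner_conj_symm, inner_conj_symm,
    hq.inner_mul_comm]
  congr 1
  refine hP.inner_eq (hP'.congr_symbol fun ξ => ?_)
  simp

/-! ### Quadratic forms of multipliers -/

lemma IsMult.norm_sq {m : ℝ → ℂ} {u w : L2} (h : IsMult m u w) :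
    Integrable (fun η => ‖m (2 * Real.pi * η)‖ ^ 2 * ‖fourierL2 u η‖ ^ 2) volume ∧
      ‖w‖ ^ 2 = ∫ η, ‖m (2 * Real.pi * η)‖ ^ 2 * ‖fourierL2 u η‖ ^ 2 := by
  have e : (fun η => ‖fourierL2 w η‖ ^ 2) =ᵐ[volume]
      fun η => ‖m (2 * Real.pi * η)‖ ^ 2 * ‖fourierL2 u η‖ ^ 2 := by
    filter_upwards [h] with η hη
    rw [hη, norm_mul, mul_pow]
  exact ⟨(integrable_norm_sq _).congr e,
    (norm_sq_eq_integral_fourier w).trans (integral_congr_ae e)⟩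

lemma IsMult.re_inner {p : ℝ → ℝ} {u w : L2} (h : IsMult (fun ξ => (p ξ : ℂ)) u w) :
    Integrable (fun η => p (2 * Real.pi * η) * ‖fourierL2 u η‖ ^ 2) volume ∧
      (inner ℂ u w).re = ∫ η, p (2 * Real.pi * η) * ‖fourierL2 u η‖ ^ 2 := by
  have e : (fun η => star (fourierL2 u η) * fourierL2 w η) =ᵐ[volume]
      fun η => ((p (2 * Real.pi * η) * ‖fourierL2 u η‖ ^ 2 : ℝ) : ℂ) := by
    filter_upwards [h] with η hη
    rw [hη, mul_left_comm, Complex.star_def, ← Complex.normSq_eq_conj_mul_self,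
      Complex.normSq_eq_norm_sq]
    push_cast; rfl
  have hi : Integrable (fun η => star (fourierL2 u η) * fourierL2 w η) volume :=
    (Lp.memLp (fourierL2 u)).star.integrable_mul (Lp.memLp (fourierL2 w))
  constructor
  · exact ((hi.congr e).re).congr (.of_forall fun η => by
      simp only [RCLike.re_to_complex, Complex.ofReal_re])
  · rw [← integral_star_mul_fourierL2, integral_congr_ae e, integral_complex_ofReal,
      Complex.ofReal_re]

/-- The form of `L` in terms of `∂ₓ u`. -/
lemma re_inner_opLH (hα : 0 ≤ α) (hc : 0 ≤ c) (hq : SmoothPotential q B) (hQ : Qc =ᵐ[volume] q)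
    {u : sobolev (2 + α)} {D r : L2} (hD : IsMult (fun ξ => Complex.I * ξ) (u : L2) D)
    (hr : IsMult (fun ξ => ((|ξ| ^ (α / 2) : ℝ) : ℂ)) D r) :
    (inner ℂ (u : L2) (opLH h u)).re = ‖r‖ ^ 2 + c * ‖D‖ ^ 2 - ∫ x, q x * ‖D x‖ ^ 2 := by
  obtain ⟨P, hP⟩ := exists_isMult_symbolL hα hc u.2
  rw [inner_opLH h hα hq hQ hP hD hD, Complex.sub_re, hq.re_inner_mul]
  congr 1
  have hur := hD.comp hr
  rw [hP.re_inner.2, hur.norm_sq.2, hD.norm_sq.2, ← integral_const_mul,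
    ← integral_add hur.norm_sq.1 (hD.norm_sq.1.const_mul c)]
  refine integral_congr_ae (Filter.Eventually.of_forall fun η => ?_)
  have e1 : ∀ x : ℝ, ‖Complex.I * (x : ℂ)‖ = |x| := fun x => by
    rw [norm_mul, Complex.norm_I, one_mul, Complex.norm_real, Real.norm_eq_abs]
  simp only [norm_mul (((_ : ℝ) : ℂ)), e1, Complex.norm_real, symbolL]
  have h1 : |2 * Real.pi * η| ^ α = (|2 * Real.pi * η| ^ (α / 2)) ^ 2 := by
    rw [← Real.rpow_natCast, ← Real.rpow_mul (abs_nonneg _)]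
    congr 1; push_cast; ring
  rw [abs_rpow_add_two _ hα, h1,
    Real.norm_of_nonneg (by positivity : 0 ≤ |2 * Real.pi * η| ^ (α / 2)),
    mul_pow _ |2 * Real.pi * η|, sq_abs]
  ring

/-! ### The lower bound L ≥ λ -/

/-- The quadratic form of `M_c` is nonnegative on the orthogonal complement of some vector. -/
def IndexOne (α c : ℝ) (q : ℝ → ℝ) : Prop :=
  ∃ s : L2, ∀ v ∈ sobolev 1, ∀ r : L2, IsMult (fun ξ => ((|ξ| ^ (α / 2) : ℝ) : ℂ)) v r →
    inner ℂ s v = 0 → ∫ x, q x * ‖v x‖ ^ 2 ≤ ‖r‖ ^ 2 + c * ‖v‖ ^ 2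

/-- The negative eigenvalue of `L` is the bottom of its spectrum. -/
lemma lower_bound_opLH (hα : 0 ≤ α) (hc : 0 ≤ c) (hq : SmoothPotential q B)
    (hQ : Qc =ᵐ[volume] q) (hidx : IndexOne α c q) {l : ℝ} (hl : l < 0)
    {w : sobolev (2 + α)} (hw : (w : L2) ≠ 0) (hlw : opLH h w = (l : ℂ) • (w : L2))
    (u : sobolev (2 + α)) : l * ‖(u : L2)‖ ^ 2 ≤ (inner ℂ (u : L2) (opLH h u)).re := by
  obtain ⟨s, hs⟩ := hidx
  obtain ⟨U, hU⟩ := exists_isMult_deriv (by linarith) u.2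
  obtain ⟨W, hW⟩ := exists_isMult_deriv (by linarith) w.2
  -- The form of L at z is that of M_c at D = ∂ₓz, so it is nonnegative whenever ∂ₓz is orthogonal
  -- to s.
  have hpos : ∀ z : sobolev (2 + α), ∀ D, IsMult (fun ξ => Complex.I * ξ) (z : L2) D →
      inner ℂ s D = 0 → 0 ≤ (inner ℂ (z : L2) (opLH h z)).re := by
    intro z D hD h0
    have hD1 := hD.deriv_mem_sobolev (s := 1 + α) (by linarith) z.2
    have hD2 := hD.deriv_mem_sobolev (s := α / 2) (by linarith) z.2
    obtain ⟨r, hr⟩ := exists_isMult (m := fun ξ : ℝ => ((|ξ| ^ (α / 2) : ℝ) : ℂ)) (by fun_prop)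
      (s := α / 2) (C := 1) (fun ξ => by
        rw [Complex.norm_real, Real.norm_of_nonneg (by positivity), one_mul]
        exact abs_rpow_le_weight (by linarith) ξ) hD2
    have := hs D (sobolev_mono (by linarith) hD1) r hr h0
    rw [re_inner_opLH h hα hc hq hQ hD hr]
    linarith
  have hwn : 0 < ‖(w : L2)‖ := norm_pos_iff.mpr hw
  -- The form is negative at the eigenvector w, so ∂ₓw cannot be orthogonal to s. This makes the
  -- choice of β below possible.
  have hW0 : inner ℂ s W ≠ 0 := by
    intro h0
    have h1 := hpos w W hW h0
    rw [hlw, inner_smul_right, Complex.re_ofReal_mul, ← RCLike.re_to_complex,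
      inner_self_eq_norm_sq] at h1
    have : 0 < ‖(w : L2)‖ ^ 2 := by positivity
    nlinarith
  set β : ℂ := inner ℂ s U / inner ℂ s W with hβ
  set z : sobolev (2 + α) := u - β • w with hz
  have hzU : IsMult (fun ξ => Complex.I * ξ) (z : L2) (U - β • W) := by
    have := hU.add (hW.smul (-β))
    rw [neg_smul, ← sub_eq_add_neg, neg_smul, ← sub_eq_add_neg] at this
    exact this
  have hz0 := hpos z _ hzU (by
    rw [inner_sub_right, inner_smul_right, hβ, div_mul_cancel₀ _ hW0, sub_self])
  have hu : u = z + β • w := by rw [hz, sub_add_cancel]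
  -- Because L - l is symmetric and annihilates w, its form takes the same value at u and at z = u -
  -- βw. At z that value is at least -l‖z‖² ≥ 0.
  have e1 : inner ℂ (u : L2) (opLH h u) = inner ℂ (z : L2) (opLH h z)
      + (l : ℂ) * (inner ℂ (u : L2) (u : L2) - inner ℂ (z : L2) (z : L2)) := by
    have h2 : inner ℂ (w : L2) (opLH h z) = (l : ℂ) * inner ℂ (w : L2) (z : L2) := by
      rw [inner_opLH_comm h hα hc hq hQ, hlw, inner_smul_left, Complex.conj_ofReal]
    rw [hu, map_add, map_smul, hlw, Submodule.coe_add, Submodule.coe_smul]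
    simp only [inner_add_left, inner_add_right, inner_smul_left, inner_smul_right, h2]
    ring
  rw [e1, Complex.add_re, Complex.re_ofReal_mul, Complex.sub_re, ← RCLike.re_to_complex,
    ← RCLike.re_to_complex, ← RCLike.re_to_complex, inner_self_eq_norm_sq, inner_self_eq_norm_sq]
  rw [← RCLike.re_to_complex] at hz0
  have : 0 ≤ ‖(z : L2)‖ ^ 2 := by positivity
  nlinarith

end Operator

/-! ### Surjectivity of perturbations and of shifted semibounded operators -/

section Abstract

variable {H : Type*} [NormedAddCommGroup H] [InnerProductSpace ℂ H]
  {V : Submodule ℂ H}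

/-- Neumann series. If r is negative, the bound forces Tf = 0 and f itself is a solution. -/
lemma surjective_one_add_of_norm_le [CompleteSpace H] {T : H →ₗ[ℂ] H} {r : ℝ} (hr : r < 1)
    (hT : ∀ g, ‖T g‖ ≤ r * ‖g‖) (f : H) : ∃ g, g + T g = f := by
  rcases le_or_gt 0 r with h0 | h0
  · set S : H →L[ℂ] H := T.mkContinuous r hT
    have hS : ‖-S‖ < 1 := by
      rw [norm_neg]
      exact (T.mkContinuous_norm_le h0 hT).trans_lt hr
    refine ⟨(↑(Units.oneSub (-S) hS)⁻¹ : H →L[ℂ] H) f, ?_⟩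
    have h1 := congrArg (fun A : H →L[ℂ] H => A f) (Units.mul_inv (Units.oneSub (-S) hS))
    simp only [Units.val_oneSub, sub_neg_eq_add] at h1
    exact h1
  · refine ⟨f, ?_⟩
    have h1 : ‖T f‖ ≤ 0 := (hT f).trans (mul_nonpos_of_nonpos_of_nonneg h0.le (norm_nonneg _))
    rw [norm_le_zero_iff.mp h1, add_zero]

/-- Cauchy–Schwarz for ⟨u, (A + t)u⟩, divided by ‖u‖. -/
lemma norm_le_norm_shift {A : V →ₗ[ℂ] H} {l : ℝ}
    (hA : ∀ u : V, l * ‖(u : H)‖ ^ 2 ≤ (inner ℂ (u : H) (A u)).re) (t : ℝ) (u : V) :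
    (t + l) * ‖(u : H)‖ ≤ ‖A u + (t : ℂ) • (u : H)‖ := by
  rcases eq_or_ne (u : H) 0 with h0 | h0
  · rw [h0, norm_zero, mul_zero]
    exact norm_nonneg _
  · have hn : 0 < ‖(u : H)‖ := norm_pos_iff.mpr h0
    have h1 : (inner ℂ (u : H) (A u + (t : ℂ) • (u : H))).re
        = (inner ℂ (u : H) (A u)).re + t * ‖(u : H)‖ ^ 2 := by
      rw [inner_add_right, inner_smul_right, Complex.add_re, Complex.re_ofReal_mul,
        ← RCLike.re_to_complex, ← RCLike.re_to_complex, inner_self_eq_norm_sq]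
    have h2 := (Complex.re_le_norm _).trans (norm_inner_le_norm (𝕜 := ℂ) (u : H)
      (A u + (t : ℂ) • (u : H)))
    rw [h1] at h2
    have h3 := hA u
    refine le_of_mul_le_mul_left ?_ hn
    nlinarith

/-- If `A ≥ l` is symmetric and `A + t₁` is surjective for some `t₁`, then `A + t` is surjective
for all `t ∈ (-l, t₁]`. -/
lemma surjective_shift [CompleteSpace H] {A : V →ₗ[ℂ] H} {l t t₁ : ℝ}
    (hA : ∀ u : V, l * ‖(u : H)‖ ^ 2 ≤ (inner ℂ (u : H) (A u)).re) (ht : 0 < t + l) (h1 : t ≤ t₁)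
    (hs : ∀ f : H, ∃ u : V, A u + (t₁ : ℂ) • (u : H) = f) (f : H) :
    ∃ u : V, A u + (t : ℂ) • (u : H) = f := by
  set A₁ : V →ₗ[ℂ] H := A + (t₁ : ℂ) • V.subtype with hA₁
  have hA₁u : ∀ u, A₁ u = A u + (t₁ : ℂ) • (u : H) := fun u => rfl
  have hpos : 0 < t₁ + l := by linarith
  have hinj : Function.Injective A₁ := by
    rw [injective_iff_map_eq_zero]
    intro u hu
    have := norm_le_norm_shift hA t₁ u
    rw [← hA₁u, hu, norm_zero] at this
    have h0 : ‖(u : H)‖ ≤ 0 := by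
      by_contra hne
      push Not at hne
      nlinarith
    exact Subtype.ext (norm_le_zero_iff.mp h0)
  set e : V ≃ₗ[ℂ] H := LinearEquiv.ofBijective A₁ ⟨hinj, hs⟩
  have he : ∀ g, A₁ (e.symm g) = g := fun g => e.apply_symm_apply g
  -- A + t = (1 + (t - t₁)(A + t₁)⁻¹)(A + t₁), and the perturbation has norm at most (t₁ - t)/(t₁ +
  -- l). This is below 1 as soon as t + l > 0, so no continuation in small steps is needed.
  obtain ⟨g, hg⟩ := surjective_one_add_of_norm_le
    (T := ((t - t₁ : ℝ) : ℂ) • (V.subtype ∘ₗ e.symm.toLinearMap)) (r := (t₁ - t) / (t₁ + l))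
    (by rw [div_lt_one hpos]; linarith) (fun g => by
      have h2 := norm_le_norm_shift hA t₁ (e.symm g)
      rw [← hA₁u, he] at h2
      rw [LinearMap.smul_apply, norm_smul, Complex.norm_real, Real.norm_eq_abs,
        abs_of_nonpos (by linarith), neg_sub, div_mul_eq_mul_div, mul_div_assoc]
      refine mul_le_mul_of_nonneg_left ?_ (by linarith)
      rw [le_div_iff₀ hpos, mul_comm]
      exact h2) f
  refine ⟨e.symm g, ?_⟩
  have h3 := he g
  rw [hA₁u] at h3
  rw [eq_sub_of_add_eq h3, ← hg]
  change g - (t₁ : ℂ) • ((e.symm g : V) : H) + (t : ℂ) • ((e.symm g : V) : H)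
    = g + ((t - t₁ : ℝ) : ℂ) • ((e.symm g : V) : H)
  rw [Complex.ofReal_sub]
  module

end Abstract

/-! ### Inequalities between symbols -/

/-- Beyond r = (2b)^{1/α} the power |ξ|^{2+α} is at least 2bξ²; below r the left side is bounded by
a constant. -/
lemma exists_sq_le_rpow {α : ℝ} (hα : 0 < α) {b : ℝ} (hb : 0 ≤ b) :
    ∃ k, 0 ≤ k ∧ ∀ ξ : ℝ, b * (1 + ξ ^ 2) ≤ 1 / 2 * |ξ| ^ (2 + α) + k := by
  set r := (2 * b) ^ (1 / α) with hr
  have hr0 : 0 ≤ r := by positivity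
  refine ⟨b * (1 + r ^ 2), by positivity, fun ξ => ?_⟩
  rw [abs_rpow_add_two ξ hα.le]
  rcases le_total |ξ| r with h | h
  · have h1 : ξ ^ 2 ≤ r ^ 2 := by
      rw [← sq_abs]
      exact pow_le_pow_left₀ (abs_nonneg _) h 2
    have h2 : 0 ≤ |ξ| ^ α * ξ ^ 2 := by positivity
    nlinarith
  · have h1 : 2 * b ≤ |ξ| ^ α := by
      have h2 := Real.rpow_le_rpow hr0 h hα.le
      rwa [hr, ← Real.rpow_mul (by positivity), one_div_mul_cancel hα.ne', Real.rpow_one] at h2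
    have h3 : 0 ≤ b * r ^ 2 := by positivity
    nlinarith [mul_le_mul_of_nonneg_right h1 (sq_nonneg ξ)]

lemma weight_le_one_add_rpow {α : ℝ} (hα : 0 ≤ α) (hα2 : α ≤ 2) (ξ : ℝ) :
    (1 + ξ ^ 2) ^ ((2 + α) / 2) ≤ 4 * (1 + |ξ| ^ (2 + α)) := by
  have h0 : 0 ≤ (2 + α) / 2 := by linarith
  have h4 : (2 : ℝ) ^ ((2 + α) / 2) ≤ 4 := by
    calc (2 : ℝ) ^ ((2 + α) / 2) ≤ 2 ^ (2 : ℝ) :=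
          Real.rpow_le_rpow_of_exponent_le (by norm_num) (by linarith)
      _ = 4 := by norm_num
  have hx : (ξ ^ 2) ^ ((2 + α) / 2) = |ξ| ^ (2 + α) := by
    rw [← sq_abs, ← Real.rpow_natCast, ← Real.rpow_mul (abs_nonneg _)]
    congr 1; push_cast; ring
  have hp : 0 ≤ |ξ| ^ (2 + α) := by positivity
  rcases le_total (ξ ^ 2) 1 with h | h
  · calc (1 + ξ ^ 2) ^ ((2 + α) / 2) ≤ 2 ^ ((2 + α) / 2) :=
          Real.rpow_le_rpow (by positivity) (by linarith) h0
      _ ≤ _ := by linarith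
  · calc (1 + ξ ^ 2) ^ ((2 + α) / 2) ≤ (2 * ξ ^ 2) ^ ((2 + α) / 2) :=
          Real.rpow_le_rpow (by positivity) (by linarith) h0
      _ = 2 ^ ((2 + α) / 2) * |ξ| ^ (2 + α) := by
          rw [Real.mul_rpow (by norm_num) (by positivity), hx]
      _ ≤ 4 * |ξ| ^ (2 + α) := mul_le_mul_of_nonneg_right h4 hp
      _ ≤ _ := by linarith

lemma symbolL_nonneg {α c : ℝ} (hc : 0 ≤ c) (ξ : ℝ) : 0 ≤ symbolL α c ξ := by
  unfold symbolL; positivity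

lemma symbolL_le_weight {α c : ℝ} (hα : 0 ≤ α) (hc : 0 ≤ c) (ξ : ℝ) :
    symbolL α c ξ ≤ (1 + c) * (1 + ξ ^ 2) ^ ((2 + α) / 2) := by
  rw [symbolL, add_mul, one_mul]
  exact add_le_add (abs_rpow_le_weight (by linarith) ξ)
    (mul_le_mul_of_nonneg_left (sq_le_weight ξ (by linarith)) hc)

lemma weight_le_symbolL {α c t : ℝ} (hα : 0 ≤ α) (hα2 : α ≤ 2) (hc : 0 ≤ c) (ht : 1 ≤ t) (ξ : ℝ) :
    (1 + ξ ^ 2) ^ ((2 + α) / 2) ≤ 4 * (symbolL α c ξ + t) := by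
  refine (weight_le_one_add_rpow hα hα2 ξ).trans ?_
  have : 0 ≤ c * ξ ^ 2 := by positivity
  rw [symbolL]
  linarith

/-! ### Ellipticity of L, surjectivity of L + t and Gårding's inequality -/

section Operator

variable {α c B : ℝ} {q Qc : ℝ → ℝ} (h : sobolev (2 + α) ≤ (opL α c Qc).domain)

lemma norm_symbolL_add {t : ℝ} (hc : 0 ≤ c) (ht : 0 ≤ t) (ξ : ℝ) :
    ‖(symbolL α c ξ : ℂ) + (t : ℂ)‖ = symbolL α c ξ + t := by
  rw [← Complex.ofReal_add, Complex.norm_real,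
    Real.norm_of_nonneg (add_nonneg (symbolL_nonneg hc ξ) ht)]

/-- For large `t`, the potential terms of `L` are small relative to `|D|^{2+α} - c∂ₓ² + t`. -/
lemma exists_relative_bound (hα : 0 < α) (hc : 0 ≤ c) (hq : SmoothPotential q B)
    (hQ : Qc =ᵐ[volume] q) : ∃ t₀ : ℝ, 1 ≤ t₀ ∧ ∀ t, t₀ ≤ t → ∀ u : sobolev (2 + α), ∀ y : L2,
      IsMult (fun ξ => (symbolL α c ξ : ℂ) + (t : ℂ)) (u : L2) y →
      ‖opLH h u + (t : ℂ) • (u : L2) - y‖ ≤ 1 / 2 * ‖y‖ := by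
  have hB := hq.nonneg
  -- With b = 4(B + 1) both derivatives of u are bounded by ‖y‖/(4(B + 1)), so each of the two
  -- potential terms, q'∂ₓu and q∂ₓ²u, costs at most ‖y‖/4.
  obtain ⟨k, hk0, hk⟩ := exists_sq_le_rpow hα (b := 4 * (B + 1)) (by positivity)
  refine ⟨k + 1, by linarith, fun t ht u y hy => ?_⟩
  obtain ⟨P, hP⟩ := exists_isMult_symbolL hα.le hc u.2
  obtain ⟨D, hD⟩ := exists_isMult_deriv (by linarith) u.2
  obtain ⟨D', hD'⟩ := exists_isMult_deriv le_rfl (hD.deriv_mem_sobolev (by linarith) u.2)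
  have hyP : y = P + (t : ℂ) • (u : L2) := hy.unique (hP.add_symbol (IsMult.const _ _))
  rw [opLH_eq h hα.le hq hQ hP hD hD', hyP, show P + (hq.mulDeriv D + hq.mul D')
    + (t : ℂ) • (u : L2) - (P + (t : ℂ) • (u : L2)) = hq.mulDeriv D + hq.mul D' by abel, ← hyP]
  have hm : ∀ ξ : ℝ, 1 + ξ ^ 2 ≤ 1 / (4 * (B + 1)) * ‖(symbolL α c ξ : ℂ) + (t : ℂ)‖ := fun ξ => by
    rw [norm_symbolL_add hc (by linarith), div_mul_eq_mul_div, one_mul,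
      le_div_iff₀ (by positivity), mul_comm, symbolL]
    have h1 : 0 ≤ |ξ| ^ (2 + α) := by positivity
    have h2 : 0 ≤ c * ξ ^ 2 := by positivity
    linarith [hk ξ]
  have h1 : ‖D‖ ≤ 1 / (4 * (B + 1)) * ‖y‖ := hD.norm_le (by positivity) hy fun ξ => by
    refine le_trans ?_ (hm ξ)
    rw [norm_mul, Complex.norm_I, one_mul, Complex.norm_real, Real.norm_eq_abs, ← sq_abs]
    nlinarith [sq_nonneg (|ξ| - 1), sq_nonneg |ξ|]
  have h2 : ‖D'‖ ≤ 1 / (4 * (B + 1)) * ‖y‖ := (hD.comp hD').norm_le (by positivity) hy fun ξ => by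
    refine le_trans ?_ (hm ξ)
    rw [norm_mul, norm_mul, Complex.norm_I, one_mul, Complex.norm_real, Real.norm_eq_abs,
      abs_mul_abs_self]
    nlinarith
  have h3 : B * (1 / (4 * (B + 1)) * ‖y‖) ≤ 1 / 4 * ‖y‖ := by
    rw [← mul_assoc]
    refine mul_le_mul_of_nonneg_right ?_ (norm_nonneg _)
    rw [mul_one_div, div_le_div_iff₀ (by positivity) (by norm_num)]
    linarith
  calc ‖hq.mulDeriv D + hq.mul D'‖ ≤ B * ‖D‖ + B * ‖D'‖ :=
        (norm_add_le _ _).trans (add_le_add (norm_mulB_le _) (norm_mulB_le _))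
    _ ≤ 1 / 4 * ‖y‖ + 1 / 4 * ‖y‖ := add_le_add
        ((mul_le_mul_of_nonneg_left h1 hB).trans h3) ((mul_le_mul_of_nonneg_left h2 hB).trans h3)
    _ = 1 / 2 * ‖y‖ := by ring

/-- Elliptic regularity for `L`. -/
lemma exists_elliptic_estimate (hα : 0 < α) (hα2 : α ≤ 2) (hc : 0 ≤ c) (hq : SmoothPotential q B)
    (hQ : Qc =ᵐ[volume] q) : ∃ C : ℝ, 0 ≤ C ∧ ∀ u : sobolev (2 + α),
      ‖bessel (2 + α) u‖ ≤ C * (‖opLH h u‖ + ‖(u : L2)‖) := by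
  obtain ⟨t, ht, hb⟩ := exists_relative_bound h hα hc hq hQ
  refine ⟨8 * t, by linarith, fun u => ?_⟩
  obtain ⟨P, hP⟩ := exists_isMult_symbolL hα.le hc u.2
  have hy := hP.add_symbol (IsMult.const (t : ℂ) (u : L2))
  have h1 := hb t le_rfl u _ hy
  set y := P + (t : ℂ) • (u : L2)
  have h2 : ‖bessel (2 + α) u‖ ≤ 4 * ‖y‖ :=
    (isMult_bessel _ _ u.2).norm_le (by norm_num) hy fun ξ => by
      rw [Complex.norm_real, Real.norm_of_nonneg (by positivity),
        norm_symbolL_add hc (by linarith)]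
      exact weight_le_symbolL hα.le hα2 hc ht ξ
  have h3 : ‖y‖ ≤ ‖opLH h u + (t : ℂ) • (u : L2)‖ + 1 / 2 * ‖y‖ := by
    have := norm_sub_norm_le y (y - (opLH h u + (t : ℂ) • (u : L2)))
    rw [sub_sub_cancel, norm_sub_rev y] at this
    linarith
  have h4 : ‖opLH h u + (t : ℂ) • (u : L2)‖ ≤ t * (‖opLH h u‖ + ‖(u : L2)‖) := by
    refine (norm_add_le _ _).trans ?_
    rw [norm_smul, Complex.norm_real, Real.norm_of_nonneg (by linarith)]
    nlinarith [norm_nonneg (opLH h u)]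
  linarith

/-- The resolvent of the principal part of `L`. -/
lemma exists_parametrix (hα : 0 ≤ α) (hα2 : α ≤ 2) (hc : 0 ≤ c) {t : ℝ} (ht : 1 ≤ t) :
    ∃ G : L2 →ₗ[ℂ] sobolev (2 + α), ∀ g,
      IsMult (fun ξ => (symbolL α c ξ : ℂ) + (t : ℂ)) (G g : L2) g := by
  have hpos : ∀ ξ, 1 ≤ symbolL α c ξ + t := fun ξ => by linarith [symbolL_nonneg (α := α) hc ξ]
  have hm : Measurable fun ξ => (((symbolL α c ξ + t)⁻¹ : ℝ) : ℂ) :=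
    Complex.measurable_ofReal.comp ((measurable_symbolL α c).add_const t).inv
  have hb : ∀ ξ, ‖(((symbolL α c ξ + t)⁻¹ : ℝ) : ℂ)‖ ≤ 1 := fun ξ => by
    rw [Complex.norm_real, Real.norm_of_nonneg (inv_nonneg.mpr (by linarith [hpos ξ]))]
    exact inv_le_one_of_one_le₀ (hpos ξ)
  have hGm : ∀ g, IsMult (fun ξ => (symbolL α c ξ : ℂ) + (t : ℂ)) (multB _ hm 1 hb g) g := by
    intro g
    have h1 := IsMult.const 1 g
    rw [one_smul] at h1
    refine (isMult_multB g).of_comp h1 fun ξ => ?_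
    have := (zero_lt_one.trans_le (hpos ξ)).ne'
    rw [← Complex.ofReal_add, ← Complex.ofReal_mul, mul_inv_cancel₀ this, Complex.ofReal_one]
  have hGs : ∀ g, multB _ hm 1 hb g ∈ sobolev (2 + α) := fun g =>
    mem_sobolev_of_isMult (hGm g) (C := 4) fun ξ => by
      rw [norm_symbolL_add hc (by linarith)]
      exact weight_le_symbolL hα hα2 hc (by linarith) ξ
  exact ⟨(multB _ hm 1 hb).toLinearMap.codRestrict _ hGs, hGm⟩

/-- `L + t` maps `H^{2+α}` onto `L²` for large `t`. -/
lemma exists_surjective_opLH (hα : 0 < α) (hα2 : α ≤ 2) (hc : 0 ≤ c) (hq : SmoothPotential q B)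
    (hQ : Qc =ᵐ[volume] q) : ∃ t₀ : ℝ, ∀ t, t₀ ≤ t → ∀ f : L2,
      ∃ u : sobolev (2 + α), opLH h u + (t : ℂ) • (u : L2) = f := by
  obtain ⟨t₀, ht₀, hb⟩ := exists_relative_bound h hα hc hq hQ
  refine ⟨t₀, fun t ht f => ?_⟩
  obtain ⟨G, hG⟩ := exists_parametrix hα.le hα2 hc (ht₀.trans ht)
  -- T = (L + t)G - 1 is the error of the parametrix G. Its norm is at most 1/2, so (L + t)G is
  -- onto.
  obtain ⟨T, hT⟩ : ∃ T : L2 →ₗ[ℂ] L2, ∀ g, T g = opLH h (G g) + (t : ℂ) • (G g : L2) - g :=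
    ⟨opLH h ∘ₗ G + (t : ℂ) • (Submodule.subtype _ ∘ₗ G) - LinearMap.id, fun _ => rfl⟩
  obtain ⟨g, hg⟩ := surjective_one_add_of_norm_le (T := T) (r := 1 / 2) (by norm_num)
    (fun g => by rw [hT]; exact hb t ht (G g) g (hG g)) f
  refine ⟨G g, ?_⟩
  rw [← hg, hT, add_sub_cancel]

/-- The perturbation argument settles large shifts, and the lower bound on L carries surjectivity
down to every t > -l. -/
lemma surjective_opLH (hα : 0 < α) (hα2 : α ≤ 2) (hc : 0 ≤ c) (hq : SmoothPotential q B)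
    (hQ : Qc =ᵐ[volume] q) {l t : ℝ}
    (hl : ∀ u : sobolev (2 + α), l * ‖(u : L2)‖ ^ 2 ≤ (inner ℂ (u : L2) (opLH h u)).re)
    (ht : 0 < t + l) (f : L2) :
    ∃ u : sobolev (2 + α), opLH h u + (t : ℂ) • (u : L2) = f := by
  obtain ⟨t₀, ht₀⟩ := exists_surjective_opLH h hα hα2 hc hq hQ
  exact surjective_shift hl ht (le_max_right t₀ t) (ht₀ _ (le_max_left _ _)) f

/-- Gårding's inequality and the boundedness of the form of `L` on `H^{1+α/2}`. -/
lemma exists_form_bounds (hα : 0 < α) (hα2 : α ≤ 2) (hc : 0 ≤ c) (hq : SmoothPotential q B)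
    (hQ : Qc =ᵐ[volume] q) : ∃ k C : ℝ, 0 ≤ k ∧ 0 ≤ C ∧
      ∀ (u : sobolev (2 + α)) (hu : (u : L2) ∈ sobolev (1 + α / 2)),
        1 / 8 * ‖bessel (1 + α / 2) ⟨u, hu⟩‖ ^ 2
          ≤ (inner ℂ (u : L2) (opLH h u)).re + k * ‖(u : L2)‖ ^ 2 ∧
        ∀ w : sobolev (1 + α / 2),
          ‖inner ℂ (w : L2) (opLH h u) + k * inner ℂ (w : L2) (u : L2)‖
            ≤ C * ‖bessel (1 + α / 2) w‖ * ‖bessel (1 + α / 2) ⟨u, hu⟩‖ := by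
  have hB := hq.nonneg
  -- One eighth of the Bessel weight uses ½(1 + |ξ|^{2+α}); the other half of |ξ|^{2+α} plus k has
  -- to absorb the potential term Bξ² and that constant ½.
  obtain ⟨k, hk0, hk⟩ := exists_sq_le_rpow hα (b := B + 1) (by positivity)
  have hweight : ∀ ξ : ℝ, ((1 + ξ ^ 2) ^ ((1 + α / 2) / 2)) ^ 2 = (1 + ξ ^ 2) ^ ((2 + α) / 2) :=
    fun ξ => by
      rw [← Real.rpow_natCast, ← Real.rpow_mul (by positivity)]
      congr 1; push_cast; ring
  refine ⟨k, (1 + c) * (1 + c) + B + k, hk0, by positivity, fun u hu => ⟨?_, fun w => ?_⟩⟩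
  · obtain ⟨P, hP⟩ := exists_isMult_symbolL hα.le hc u.2
    obtain ⟨D, hD⟩ := exists_isMult_deriv (by linarith) u.2
    have hb := isMult_bessel _ _ hu
    have hi : (∫ x, q x * ‖D x‖ ^ 2) ≤ B * ‖D‖ ^ 2 := by
      have h1 : (inner ℂ D (hq.mul D)).re ≤ ‖D‖ * (B * ‖D‖) :=
        (Complex.re_le_norm _).trans ((norm_inner_le_norm (𝕜 := ℂ) _ _).trans
          (mul_le_mul_of_nonneg_left (norm_mulB_le _) (norm_nonneg _)))
      rw [hq.re_inner_mul] at h1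
      linarith
    rw [inner_opLH h hα.le hq hQ hP hD hD, Complex.sub_re, hq.re_inner_mul]
    have h1 : 1 / 8 * ‖bessel (1 + α / 2) ⟨u, hu⟩‖ ^ 2 + B * ‖D‖ ^ 2
        ≤ (inner ℂ (u : L2) P).re + k * ‖(u : L2)‖ ^ 2 := by
      rw [hb.norm_sq.2, hD.norm_sq.2, hP.re_inner.2, norm_sq_eq_integral_fourier (u : L2),
        ← integral_const_mul, ← integral_const_mul, ← integral_const_mul,
        ← integral_add (hb.norm_sq.1.const_mul _) (hD.norm_sq.1.const_mul _),
        ← integral_add hP.re_inner.1 ((integrable_norm_sq _).const_mul _)]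
      refine integral_mono ((hb.norm_sq.1.const_mul _).add (hD.norm_sq.1.const_mul _))
        (hP.re_inner.1.add ((integrable_norm_sq _).const_mul _)) fun η => ?_
      simp only
      set ξ := 2 * Real.pi * η
      rw [Complex.norm_real, Real.norm_of_nonneg (by positivity), hweight, norm_mul,
        Complex.norm_I, one_mul, Complex.norm_real, Real.norm_eq_abs, sq_abs, symbolL,
        ← mul_assoc, ← mul_assoc, ← add_mul, ← add_mul]
      refine mul_le_mul_of_nonneg_right ?_ (by positivity)
      have h2 := weight_le_one_add_rpow hα.le hα2 ξ
      have h3 := hk ξ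
      have h4 : 0 ≤ c * ξ ^ 2 := by positivity
      have h5 : 0 ≤ ξ ^ 2 := by positivity
      linarith
    linarith
  · obtain ⟨P, hP⟩ := exists_isMult_symbolL hα.le hc u.2
    obtain ⟨D, hD⟩ := exists_isMult_deriv (by linarith) u.2
    obtain ⟨W, hW⟩ := exists_isMult_deriv (by linarith) w.2
    have hbu := isMult_bessel _ _ hu
    have hbw := isMult_bessel _ _ w.2
    -- The square root of the principal symbol has order 1 + α/2. Putting one root on each argument
    -- bounds ⟨w, P⟩ by the H^{1+α/2} norms.
    have hsym : ∀ ξ, ‖((Real.sqrt (symbolL α c ξ) : ℝ) : ℂ)‖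
        ≤ (1 + c) * (1 + ξ ^ 2) ^ ((1 + α / 2) / 2) := fun ξ => by
      rw [Complex.norm_real, Real.norm_of_nonneg (Real.sqrt_nonneg _)]
      refine Real.sqrt_le_iff.mpr ⟨by positivity, ?_⟩
      rw [mul_pow, hweight]
      refine (symbolL_le_weight hα.le hc ξ).trans (mul_le_mul_of_nonneg_right ?_ (by positivity))
      nlinarith
    have hmeas : Measurable fun ξ => ((Real.sqrt (symbolL α c ξ) : ℝ) : ℂ) :=
      Complex.measurable_ofReal.comp (measurable_symbolL α c).sqrt
    obtain ⟨u', hu'⟩ := exists_isMult hmeas hsym hu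
    obtain ⟨w', hw'⟩ := exists_isMult hmeas hsym w.2
    have hsym' : ∀ ξ : ℝ, ‖((Real.sqrt (symbolL α c ξ) : ℝ) : ℂ)‖
        ≤ (1 + c) * ‖(((1 + ξ ^ 2) ^ ((1 + α / 2) / 2) : ℝ) : ℂ)‖ := fun ξ => by
      rw [Complex.norm_real ((1 + ξ ^ 2) ^ ((1 + α / 2) / 2)),
        Real.norm_of_nonneg (by positivity)]
      exact hsym ξ
    have hder : ∀ ξ : ℝ, ‖Complex.I * (ξ : ℂ)‖
        ≤ 1 * ‖(((1 + ξ ^ 2) ^ ((1 + α / 2) / 2) : ℝ) : ℂ)‖ := fun ξ => by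
      have h1 : 0 ≤ (1 + ξ ^ 2) ^ ((1 + α / 2) / 2) := by positivity
      rw [norm_mul, Complex.norm_I, one_mul, one_mul, Complex.norm_real, Complex.norm_real,
        Real.norm_of_nonneg h1, Real.norm_eq_abs]
      exact abs_le_weight ξ (by linarith)
    have hwP : inner ℂ (w : L2) P = inner ℂ w' u' := by
      refine (hu'.of_comp (m' := fun ξ => ((Real.sqrt (symbolL α c ξ) : ℝ) : ℂ)) hP
        fun ξ => ?_).inner_eq (hw'.congr_symbol fun ξ => ?_)
      · rw [← Complex.ofReal_mul, Real.mul_self_sqrt (symbolL_nonneg hc ξ)]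
      · exact (Complex.conj_ofReal _).symm
    set b₁ := ‖bessel (1 + α / 2) w‖
    set b₂ := ‖bessel (1 + α / 2) ⟨u, hu⟩‖
    have a1 : ‖inner ℂ w' u'‖ ≤ (1 + c) * b₁ * ((1 + c) * b₂) :=
      (norm_inner_le_norm _ _).trans (mul_le_mul (hw'.norm_le (by positivity) hbw hsym')
        (hu'.norm_le (by positivity) hbu hsym') (norm_nonneg _) (by positivity))
    have a2 : ‖inner ℂ W (hq.mul D)‖ ≤ 1 * b₁ * (B * (1 * b₂)) :=
      (norm_inner_le_norm _ _).trans (mul_le_mul (hW.norm_le zero_le_one hbw hder)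
        ((norm_mulB_le _).trans
          (mul_le_mul_of_nonneg_left (hD.norm_le zero_le_one hbu hder) hB))
        (norm_nonneg _) (by positivity))
    have a3 : ‖(k : ℂ) * inner ℂ (w : L2) (u : L2)‖ ≤ k * (b₁ * b₂) := by
      rw [norm_mul, Complex.norm_real, Real.norm_of_nonneg hk0]
      exact mul_le_mul_of_nonneg_left ((norm_inner_le_norm _ _).trans (mul_le_mul
        (norm_le_norm_bessel (by linarith) _ _) (norm_le_norm_bessel (by linarith) _ _)
        (norm_nonneg _) (by positivity))) hk0
    rw [inner_opLH h hα.le hq hQ hP hD hW, hwP]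
    refine (norm_add_le _ _).trans ((add_le_add (norm_sub_le _ _) le_rfl).trans
      ((add_le_add (add_le_add a1 a2) a3).trans (le_of_eq ?_)))
    ring

end Operator

/-! ### Parity -/

/-- The reflection `u ↦ u(-·)`. -/
def reflL2 : L2 →ₗ[ℂ] L2 :=
  Lp.compMeasurePreservingₗ ℂ (fun x : ℝ => -x) (Measure.measurePreserving_neg volume)

lemma reflL2_ae_eq (u : L2) : reflL2 u =ᵐ[volume] fun x => u (-x) :=
  Lp.coeFn_compMeasurePreserving u (Measure.measurePreserving_neg volume)

lemma ae_comp_neg {p : ℝ → Prop} (hp : ∀ᵐ x : ℝ, p x) : ∀ᵐ x : ℝ, p (-x) :=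
  (Measure.measurePreserving_neg (volume : Measure ℝ)).quasiMeasurePreserving.ae hp

lemma mem_oddL2_iff {u : L2} : u ∈ oddL2 ↔ reflL2 u = -u := by
  constructor
  · intro hu
    refine Lp.ext ?_
    filter_upwards [reflL2_ae_eq u, Lp.coeFn_neg u, hu] with x h1 h2 h3
    rw [h1, h2, h3, Pi.neg_apply]
  · intro hu
    have h1 := reflL2_ae_eq u
    rw [hu] at h1
    filter_upwards [h1, Lp.coeFn_neg u] with x h2 h3
    rw [← h2, h3, Pi.neg_apply]

lemma IsMult.refl {m m' : ℝ → ℂ} {u w : L2} (h : IsMult m u w) (hm : ∀ ξ, m' ξ = m (-ξ)) :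
    IsMult m' (reflL2 u) (reflL2 w) := by
  filter_upwards [ae_comp_neg h, fourierL2_comp_neg (reflL2_ae_eq u),
    fourierL2_comp_neg (reflL2_ae_eq w)] with η h1 h2 h3
  rw [h2, h3, h1, hm, mul_neg]

lemma IsMult.deriv_refl {u w : L2} (h : IsMult (fun ξ => Complex.I * ξ) u w) :
    IsMult (fun ξ => Complex.I * ξ) (reflL2 u) (-reflL2 w) := by
  have h1 := (h.refl (m' := fun ξ => -1 * (Complex.I * ξ)) fun ξ => by push_cast; ring).comp
    (IsMult.const (-1) _)
  rw [neg_one_smul] at h1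
  exact h1.congr_symbol fun ξ => by ring

lemma reflL2_mem_sobolev {s : ℝ} {u : L2} (hu : u ∈ sobolev s) : reflL2 u ∈ sobolev s := by
  refine mem_sobolev_of_isMult ((isMult_bessel s u hu).refl
    (m' := fun ξ => (((1 + ξ ^ 2) ^ (s / 2) : ℝ) : ℂ)) fun ξ => by rw [neg_sq]) (C := 1) fun ξ => ?_
  rw [Complex.norm_real, one_mul]
  exact Real.le_norm_self _

lemma mulB_reflL2 {b : ℝ → ℂ} {hm : AEStronglyMeasurable b volume} {C : ℝ} {hC : ∀ x, ‖b x‖ ≤ C}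
    {a : ℂ} (hb : ∀ x, b (-x) = a * b x) (v : L2) :
    reflL2 (mulB b hm C hC v) = a • mulB b hm C hC (reflL2 v) := by
  refine Lp.ext ?_
  filter_upwards [reflL2_ae_eq (mulB b hm C hC v), reflL2_ae_eq v,
    mulB_ae_eq (hm := hm) (hC := hC) (reflL2 v), ae_comp_neg (mulB_ae_eq (hm := hm) (hC := hC) v),
    Lp.coeFn_smul a (mulB b hm C hC (reflL2 v))] with x h1 h2 h3 h4 h5
  rw [h1, h4, h5, Pi.smul_apply, h3, h2, hb, smul_eq_mul, mul_assoc]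

section Operator

variable {α c B : ℝ} {q Qc : ℝ → ℝ} (h : sobolev (2 + α) ≤ (opL α c Qc).domain)

/-- Reflection changes the sign of ∂ₓu and of q', and preserves q, ∂ₓ²u and the even principal
symbol; in q'∂ₓu the two signs cancel. -/
lemma opLH_reflL2 (hα : 0 ≤ α) (hc : 0 ≤ c) (hq : SmoothPotential q B)
    (hQ : Qc =ᵐ[volume] q) (hev : ∀ x, q (-x) = q x) (u : sobolev (2 + α)) :
    opLH h ⟨reflL2 u, reflL2_mem_sobolev u.2⟩ = reflL2 (opLH h u) := by
  obtain ⟨P, hP⟩ := exists_isMult_symbolL hα hc u.2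
  obtain ⟨D, hD⟩ := exists_isMult_deriv (by linarith) u.2
  obtain ⟨D', hD'⟩ := exists_isMult_deriv le_rfl (hD.deriv_mem_sobolev (by linarith) u.2)
  have hD'r : IsMult (fun ξ => Complex.I * ξ) (-reflL2 D) (reflL2 D') := by
    have := hD'.deriv_refl.smul (-1)
    rwa [neg_one_smul, neg_one_smul, neg_neg] at this
  have hqd : ∀ x, _root_.deriv q (-x) = -_root_.deriv q x := fun x => by
    have h1 : (fun y => q (-y)) = q := funext hev
    have h2 := deriv_comp_neg q x
    rw [h1] at h2
    rw [h2, neg_neg]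
  have e1 : reflL2 (hq.mul D') = hq.mul (reflL2 D') := by
    have := mulB_reflL2 (b := fun x => (q x : ℂ)) (a := 1) (hm := (Complex.continuous_ofReal.comp
      hq.differentiable.continuous).aestronglyMeasurable) (hC := fun x => by simpa using hq.bound x)
      (fun x => by rw [hev, one_mul]) D'
    rwa [one_smul] at this
  have e2 : reflL2 (hq.mulDeriv D) = hq.mulDeriv (-reflL2 D) := by
    have := mulB_reflL2 (b := fun x => ((_root_.deriv q x : ℝ) : ℂ)) (a := -1)
      (hm := (Complex.continuous_ofReal.comp
        (hq.growth.1.continuous_deriv (by simp))).aestronglyMeasurable)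
      (hC := fun x => by simpa using hq.bound_deriv x)
      (fun x => by rw [hqd]; push_cast; ring) D
    rw [neg_one_smul, ← map_neg] at this
    exact this
  rw [opLH_eq h hα hq hQ hP hD hD', opLH_eq (u := ⟨reflL2 u, _⟩) h hα hq hQ
    (hP.refl fun ξ => by rw [symbolL, symbolL, abs_neg, neg_sq]) hD.deriv_refl hD'r,
    map_add, map_add, e1, e2]

/-- `L` preserves oddness. -/
lemma opLH_mem_oddL2 (hα : 0 ≤ α) (hc : 0 ≤ c) (hq : SmoothPotential q B)
    (hQ : Qc =ᵐ[volume] q) (hev : ∀ x, q (-x) = q x) {u : sobolev (2 + α)}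
    (hu : (u : L2) ∈ oddL2) : opLH h u ∈ oddL2 := by
  rw [mem_oddL2_iff] at hu ⊢
  rw [← opLH_reflL2 h hα hc hq hQ hev, ← map_neg]
  exact congrArg _ (Subtype.ext hu)

/-- A solution of `(L + t) u = f` is odd if `f` is. -/
lemma mem_oddL2_of_opLH (hα : 0 ≤ α) (hc : 0 ≤ c) (hq : SmoothPotential q B)
    (hQ : Qc =ᵐ[volume] q) (hev : ∀ x, q (-x) = q x) {l t : ℝ}
    (hl : ∀ u : sobolev (2 + α), l * ‖(u : L2)‖ ^ 2 ≤ (inner ℂ (u : L2) (opLH h u)).re)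
    (ht : 0 < t + l) {u : sobolev (2 + α)} (hu : opLH h u + (t : ℂ) • (u : L2) ∈ oddL2) :
    (u : L2) ∈ oddL2 := by
  rw [mem_oddL2_iff] at hu ⊢
  rw [map_add, map_smul, ← opLH_reflL2 h hα hc hq hQ hev] at hu
  set v : sobolev (2 + α) := ⟨reflL2 u, reflL2_mem_sobolev u.2⟩ with hv
  -- The sum of u and its reflection is annihilated by L + t, hence vanishes by the lower bound.
  have h1 := norm_le_norm_shift hl t (v + u)
  have h2 : opLH h (v + u) + (t : ℂ) • ((v + u : sobolev (2 + α)) : L2) = 0 := by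
    rw [map_add, Submodule.coe_add, smul_add, add_add_add_comm]
    exact (congrArg (· + _) hu).trans (neg_add_cancel _)
  rw [h2, norm_zero] at h1
  have h3 : ‖((v + u : sobolev (2 + α)) : L2)‖ ≤ 0 := by
    by_contra hne
    push Not at hne
    nlinarith
  exact eq_neg_of_add_eq_zero_left (norm_le_zero_iff.mp h3)

/-! ### Resolvent estimates -/

/-- The energy inequality is quadratic in (a, b) on the left and linear on the right once y is
bounded by the data; dividing by a + b gives a linear estimate. Here a = ‖W₁‖, b is the H^{1+α/2}
norm of u and y = ‖u‖. -/
lemma mul_add_le_of_energy {a b f₁ f₂ k C K M y : ℝ} (ha : 0 ≤ a) (hb : 0 ≤ b) (hf₁ : 0 ≤ f₁)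
    (hf₂ : 0 ≤ f₂) (hk : 0 ≤ k) (hC : 0 ≤ C) (hK : 0 ≤ K) (hM : 0 ≤ M) (hy : y ≤ K * (f₁ + f₂))
    (hen : M * (1 / 8 * b ^ 2 + a ^ 2) ≤ a * f₁ + k * (a * y) + C * f₂ * b) :
    M * (a + b) ≤ 16 * (1 + k * K + C) * (f₁ + f₂) := by
  have hs : 0 ≤ f₁ + f₂ := by positivity
  rcases (add_nonneg ha hb).eq_or_lt with h0 | h0
  · rw [← h0, mul_zero]
    positivity
  · refine le_of_mul_le_mul_right ?_ h0
    have h1 : k * (a * y) ≤ k * ((a + b) * (K * (f₁ + f₂))) := by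
      refine mul_le_mul_of_nonneg_left ?_ hk
      exact (mul_le_mul_of_nonneg_left hy ha).trans
        (mul_le_mul_of_nonneg_right (by linarith) (by positivity))
    have h4 : C * f₂ * b ≤ C * (f₁ + f₂) * (a + b) :=
      mul_le_mul (mul_le_mul_of_nonneg_left (by linarith) hC) (by linarith) hb (by positivity)
    have h5 : a * f₁ ≤ (a + b) * (f₁ + f₂) :=
      mul_le_mul (by linarith) (by linarith) hf₁ h0.le
    have h6 : 1 / 16 * (a + b) ^ 2 ≤ 1 / 8 * b ^ 2 + a ^ 2 := by
      nlinarith [sq_nonneg (a - b), sq_nonneg a]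
    have h7 := mul_le_mul_of_nonneg_left h6 hM
    linarith

/-- The energy estimate for `𝓛 W - iμ W = F`. -/
lemma energy_le {k μ b M : ℝ} (hk : 0 ≤ k) {F₁ F₂ W₁ : L2} {u : sobolev (2 + α)}
    (hWu : W₁ = F₂ + (Complex.I * μ) • (u : L2)) (hLu : opLH h u = F₁ + (Complex.I * μ) • W₁)
    (hg : 1 / 8 * b ^ 2 ≤ (inner ℂ (u : L2) (opLH h u)).re + k * ‖(u : L2)‖ ^ 2)
    (hf : ‖inner ℂ F₂ (opLH h u) + k * inner ℂ F₂ (u : L2)‖ ≤ M) :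
    |μ| * (1 / 8 * b ^ 2 + ‖W₁‖ ^ 2) ≤ ‖W₁‖ * ‖F₁‖ + k * (‖W₁‖ * ‖(u : L2)‖) + M := by
  set E : ℂ := inner ℂ (u : L2) (opLH h u) + k * inner ℂ (u : L2) (u : L2) with hE
  have hEre : 1 / 8 * b ^ 2 ≤ E.re := by
    rw [hE, Complex.add_re, Complex.re_ofReal_mul, ← RCLike.re_to_complex,
      ← RCLike.re_to_complex, inner_self_eq_norm_sq]
    exact hg
  -- ⟨W₁, Lu⟩ is computed once from W₁ = F₂ + iμu and once from Lu = F₁ + iμW₁. The terms with iμ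
  -- combine with equal signs because the inner product is conjugate linear on the left; k⟨W₁, u⟩ is
  -- added to make the real part of E coercive.
  have hid : -(Complex.I * μ) * (E + (‖W₁‖ ^ 2 : ℝ)) = inner ℂ W₁ F₁ + k * inner ℂ W₁ (u : L2)
      - (inner ℂ F₂ (opLH h u) + k * inner ℂ F₂ (u : L2)) := by
    have e1 : inner ℂ W₁ (opLH h u) = inner ℂ F₂ (opLH h u)
        - Complex.I * μ * inner ℂ (u : L2) (opLH h u) := by
      conv_lhs => rw [hWu]
      rw [inner_add_left, inner_smul_left, map_mul, Complex.conj_I, Complex.conj_ofReal]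
      ring
    have e2 : inner ℂ W₁ (u : L2) = inner ℂ F₂ (u : L2)
        - Complex.I * μ * inner ℂ (u : L2) (u : L2) := by
      conv_lhs => rw [hWu]
      rw [inner_add_left, inner_smul_left, map_mul, Complex.conj_I, Complex.conj_ofReal]
      ring
    have e3 : inner ℂ W₁ (opLH h u) = inner ℂ W₁ F₁ + Complex.I * μ * (‖W₁‖ ^ 2 : ℝ) := by
      rw [hLu, inner_add_right, inner_smul_right, inner_self_eq_norm_sq_to_K]
      push_cast
      rfl
    rw [hE]
    linear_combination e3 - e1 - k * e2
  have h1 : |μ| * (1 / 8 * b ^ 2 + ‖W₁‖ ^ 2) ≤ ‖-(Complex.I * μ) * (E + (‖W₁‖ ^ 2 : ℝ))‖ := by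
    rw [norm_mul, norm_neg, norm_mul, Complex.norm_I, one_mul, Complex.norm_real,
      Real.norm_eq_abs]
    refine mul_le_mul_of_nonneg_left ?_ (abs_nonneg _)
    refine le_trans ?_ (Complex.re_le_norm _)
    rw [Complex.add_re, Complex.ofReal_re]
    linarith
  refine h1.trans ?_
  rw [hid]
  refine (norm_sub_le _ _).trans (add_le_add ((norm_add_le _ _).trans (add_le_add
    (norm_inner_le_norm _ _) ?_)) hf)
  rw [norm_mul, Complex.norm_real, Real.norm_of_nonneg hk]
  exact mul_le_mul_of_nonneg_left (norm_inner_le_norm _ _) hk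

/-- Estimates for the solution `(W₁, u)` of `𝓛 W - iμ W = F`. -/
lemma exists_resolvent_bound (hα : 0 < α) (hα2 : α ≤ 2) (hc : 0 ≤ c) (hq : SmoothPotential q B)
    (hQ : Qc =ᵐ[volume] q) {l : ℝ} (hl0 : l < 0)
    (hl : ∀ u : sobolev (2 + α), l * ‖(u : L2)‖ ^ 2 ≤ (inner ℂ (u : L2) (opLH h u)).re) :
    ∃ C : ℝ, 0 ≤ C ∧ ∀ μ : ℝ, 4 * |l| ≤ μ ^ 2 → ∀ (F₁ W₁ : L2) (u : sobolev (2 + α))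
      (F₂ : sobolev (1 + α / 2)) (hW₁ : W₁ ∈ sobolev (1 + α / 2))
      (hu : (u : L2) ∈ sobolev (1 + α / 2)), W₁ = F₂ + (Complex.I * μ) • (u : L2) →
      opLH h u = F₁ + (Complex.I * μ) • W₁ →
      |μ| * (‖W₁‖ + ‖bessel (1 + α / 2) ⟨u, hu⟩‖) ≤ C * (‖F₁‖ + ‖bessel (1 + α / 2) F₂‖) ∧
      ‖bessel (1 + α / 2) ⟨W₁, hW₁⟩‖ + ‖bessel (2 + α) u‖
        ≤ C * (‖F₁‖ + ‖bessel (1 + α / 2) F₂‖) := by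
  obtain ⟨k, C₁, hk, hC₁, hform⟩ := exists_form_bounds h hα hα2 hc hq hQ
  obtain ⟨C₂, hC₂, hell⟩ := exists_elliptic_estimate h hα hα2 hc hq hQ
  -- A lower bound for all admissible |μ|: it lets negative powers of |μ| be replaced by constants.
  set m := 2 * Real.sqrt |l| with hm
  have hmpos : 0 < m := by
    have : 0 < |l| := abs_pos.mpr hl0.ne
    positivity
  set C₃ := 1 + k * (4 / 3 * (1 / m ^ 2 + 1 / m)) + C₁ with hC₃
  have hC₃0 : 0 ≤ C₃ := by positivity
  set C₄ := 16 * C₃ with hC₄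
  have hC₄0 : 0 ≤ C₄ := by positivity
  refine ⟨C₄ + (1 + C₄ + C₂ * (1 + C₄ + C₄ / m)), by positivity, ?_⟩
  intro μ hμ F₁ W₁ u F₂ hW₁ hu hWu hLu
  obtain ⟨hg, hf⟩ := hform u hu
  set a := ‖W₁‖ with ha
  set b := ‖bessel (1 + α / 2) ⟨u, hu⟩‖ with hb
  set f₁ := ‖F₁‖ with hf₁
  set f₂ := ‖bessel (1 + α / 2) F₂‖ with hf₂
  have ha0 : 0 ≤ a := norm_nonneg _
  have hb0 : 0 ≤ b := norm_nonneg _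
  have hf10 : 0 ≤ f₁ := norm_nonneg _
  have hf20 : 0 ≤ f₂ := norm_nonneg _
  have hF₂ : ‖(F₂ : L2)‖ ≤ f₂ := norm_le_norm_bessel (by linarith) _ F₂.2
  have hub : ‖(u : L2)‖ ≤ b := norm_le_norm_bessel (by linarith) _ hu
  have hmμ : m ≤ |μ| := by
    refine abs_le_of_sq_le_sq' ?_ (abs_nonneg _) |>.2
    rw [hm, mul_pow, Real.sq_sqrt (abs_nonneg _), sq_abs]
    linarith
  have hμ0 : 0 < |μ| := hmpos.trans_le hmμ
  -- Eliminating W₁ gives (L + μ²)u = F₁ + iμF₂, and l + μ² ≥ ¾μ² because μ² ≥ 4|l|.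
  have hun : ‖(u : L2)‖ ≤ 4 / 3 * (1 / m ^ 2 + 1 / m) * (f₁ + f₂) := by
    have h1 := norm_le_norm_shift hl (μ ^ 2) u
    have h2 : opLH h u + ((μ ^ 2 : ℝ) : ℂ) • (u : L2) = F₁ + (Complex.I * μ) • (F₂ : L2) := by
      have e : Complex.I * μ * (Complex.I * μ) = -((μ ^ 2 : ℝ) : ℂ) := by
        push_cast
        linear_combination (μ : ℂ) ^ 2 * Complex.I_mul_I
      rw [hLu, hWu, smul_add, smul_smul, e, neg_smul]
      abel
    rw [h2] at h1
    have h3 : ‖F₁ + (Complex.I * μ) • (F₂ : L2)‖ ≤ f₁ + |μ| * f₂ := by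
      refine (norm_add_le _ _).trans (add_le_add le_rfl ?_)
      rw [norm_smul, norm_mul, Complex.norm_I, one_mul, Complex.norm_real, Real.norm_eq_abs]
      exact mul_le_mul_of_nonneg_left hF₂ (abs_nonneg _)
    have h4 : 3 / 4 * |μ| ^ 2 * ‖(u : L2)‖ ≤ f₁ + |μ| * f₂ := by
      refine le_trans (mul_le_mul_of_nonneg_right ?_ (norm_nonneg _)) (h1.trans h3)
      rw [abs_of_neg hl0] at hμ
      rw [sq_abs]
      linarith
    have h5 : ‖(u : L2)‖ ≤ 4 / 3 * (1 / |μ| ^ 2 * f₁ + 1 / |μ| * f₂) := by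
      have h6 : 4 / 3 * (1 / |μ| ^ 2 * f₁ + 1 / |μ| * f₂) = (f₁ + |μ| * f₂) / (3 / 4 * |μ| ^ 2) := by
        field_simp
      rw [h6, le_div_iff₀ (by positivity), mul_comm]
      exact h4
    refine h5.trans ?_
    rw [mul_assoc]
    refine mul_le_mul_of_nonneg_left ?_ (by norm_num)
    have h7 : 1 / |μ| ^ 2 ≤ 1 / m ^ 2 :=
      one_div_le_one_div_of_le (by positivity) (pow_le_pow_left₀ hmpos.le hmμ 2)
    have h8 : 1 / |μ| ≤ 1 / m := one_div_le_one_div_of_le hmpos hmμ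
    have h9 : 0 ≤ 1 / m ^ 2 := by positivity
    have h10 : 0 ≤ 1 / m := by positivity
    have h11 := mul_le_mul_of_nonneg_right h7 hf10
    have h12 := mul_le_mul_of_nonneg_right h8 hf20
    have h13 := mul_nonneg h9 hf20
    have h14 := mul_nonneg h10 hf10
    linarith
  have hen : |μ| * (1 / 8 * b ^ 2 + a ^ 2) ≤ a * f₁ + k * (a * ‖(u : L2)‖) + C₁ * f₂ * b :=
    energy_le h hk hWu hLu hg (hf F₂)
  have hab : |μ| * (a + b) ≤ C₄ * (f₁ + f₂) :=
    mul_add_le_of_energy ha0 hb0 hf10 hf20 hk hC₁ (by positivity) hμ0.le hun hen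
  have hba : b + a ≤ C₄ / m * (f₁ + f₂) := by
    rw [div_mul_eq_mul_div, le_div_iff₀ hmpos, mul_comm, add_comm b]
    exact (mul_le_mul_of_nonneg_right hmμ (add_nonneg ha0 hb0)).trans hab
  have hs0 : 0 ≤ f₁ + f₂ := by positivity
  have hX0 : 0 ≤ 1 + C₄ + C₂ * (1 + C₄ + C₄ / m) := by positivity
  refine ⟨hab.trans (mul_le_mul_of_nonneg_right (by linarith) hs0), ?_⟩
  have hLn : ‖opLH h u‖ ≤ f₁ + |μ| * a := by
    rw [hLu]
    refine (norm_add_le _ _).trans (le_of_eq ?_)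
    rw [norm_smul, norm_mul, Complex.norm_I, one_mul, Complex.norm_real, Real.norm_eq_abs]
  have hμa : |μ| * a ≤ C₄ * (f₁ + f₂) :=
    (mul_le_mul_of_nonneg_left (by linarith) hμ0.le).trans hab
  have hμb : |μ| * b ≤ C₄ * (f₁ + f₂) :=
    (mul_le_mul_of_nonneg_left (by linarith) hμ0.le).trans hab
  -- Elliptic regularity bounds u in H^{2+α} by ‖Lu‖ + ‖u‖, and ‖Lu‖ ≤ ‖F₁‖ + |μ|‖W₁‖. The factor
  -- |μ| is the one gained in `hab`.
  have hu2 : ‖bessel (2 + α) u‖ ≤ C₂ * ((1 + C₄ + C₄ / m) * (f₁ + f₂)) := by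
    refine (hell u).trans (mul_le_mul_of_nonneg_left ?_ hC₂)
    linarith
  have hW : ‖bessel (1 + α / 2) ⟨W₁, hW₁⟩‖ ≤ f₂ + |μ| * b := by
    have e : bessel (1 + α / 2) ⟨W₁, hW₁⟩
        = bessel (1 + α / 2) F₂ + (Complex.I * μ) • bessel (1 + α / 2) ⟨u, hu⟩ := by
      have e1 : (⟨W₁, hW₁⟩ : sobolev (1 + α / 2)) = F₂ + (Complex.I * μ) • ⟨u, hu⟩ :=
        Subtype.ext hWu
      exact (congrArg (bessel (1 + α / 2)) e1).trans (((bessel (1 + α / 2)).map_add _ _).trans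
        (congrArg (bessel (1 + α / 2) F₂ + ·) ((bessel (1 + α / 2)).map_smul _ _)))
    rw [e]
    refine (norm_add_le _ _).trans (le_of_eq ?_)
    rw [norm_smul, norm_mul, Complex.norm_I, one_mul, Complex.norm_real, Real.norm_eq_abs]
  have := mul_nonneg hC₄0 hs0
  linarith

end Operator

/-! ### The solitary wave as a potential -/

/-- Collects all that the operator theory uses about the ground state: an everywhere even, smooth
representative of Q_c, and the single orthogonality condition under which M_c ≥ 0. -/
lemma IsGroundState.exists_potential {α c : ℝ} {Q : ℝ → ℝ} (hQ : IsGroundState α Q)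
    (hα : 1 / 3 < α) (hα2 : α < 2) (hc : 0 < c) :
    ∃ (q : ℝ → ℝ) (B : ℝ), SmoothPotential q B ∧ solitaryWave α c Q =ᵐ[volume] q ∧
      (∀ x, q (-x) = q x) ∧ IndexOne α c q := by
  obtain ⟨p, B, hp, hpQ⟩ := (hQ.fourierDecay hα hα2.le).exists_smoothPotential hQ.mem.1
  set k := c ^ (1 / α) with hk
  have hk0 : 0 < k := Real.rpow_pos_of_pos hc _
  have hae : solitaryWave α c Q =ᵐ[volume] fun x => 2 * c * p (k * x) := by
    have h1 := aeeq_comp_mul (u := fun x => (Q x : ℂ)) (v := fun x => (p x : ℂ))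
      (by filter_upwards [hpQ] with x hx; rw [hx]) hk0.ne'
    filter_upwards [h1] with x hx
    rw [solitaryWave, Complex.ofReal_injective hx]
  -- Q is even only almost everywhere; continuity of p makes the identity pointwise.
  have hev : ∀ x, p (-x) = p x := by
    have h1 : (fun x => p (-x)) =ᵐ[volume] p := by
      filter_upwards [hpQ, ae_comp_neg hpQ, hQ.even] with x h1 h2 h3
      rw [← h2, h3, h1]
    have hpc := hp.differentiable.continuous
    exact congrFun (((hpc.comp continuous_neg).ae_eq_iff_eq volume hpc).mp h1)
  have hd := hp.dilate (2 * c) k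
  refine ⟨_, _, hd, hae, fun x => by rw [mul_neg, hev], ?_⟩
  have hm : MemLp (fun x => (solitaryWave α c Q x : ℂ)) 2 volume := by
    refine ((MemLp.comp_mul hQ.mem.1 hk0.ne').const_mul (2 * c : ℂ)).ae_eq (.of_forall fun x => ?_)
    simp only [solitaryWave]
    push_cast; rfl
  -- The vector s is the class of Q_c², written as q times the class of Q_c.
  refine ⟨hd.mul hm.toLp, fun v hv r hr h0 => ?_⟩
  have hs0 : 0 ≤ α / 2 := by linarith
  have hz : ∫ x, (solitaryWave α c Q x : ℂ) ^ 2 * v x = 0 := by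
    rw [← h0, inner_L2]
    refine integral_congr_ae ?_
    filter_upwards [mulB_ae_eq (b := fun x => ((2 * c * p (k * x) : ℝ) : ℂ)) hm.toLp,
      hm.coeFn_toLp, hae] with x h1 h2 h3
    rw [SmoothPotential.mul, h1, h2, ← h3, ← Complex.ofReal_mul, Complex.star_def,
      Complex.conj_ofReal]
    push_cast; ring
  have key := hQ.solitaryWave_form_nonneg hα hα2 hc hs0 (by linarith) ⟨v, hv⟩ hz
  have hr' : rieszH hs0 ⟨v, sobolev_mono (by linarith) hv⟩ = r :=
    IsMult.unique (m := fun ξ => ((|ξ| ^ (α / 2) : ℝ) : ℂ)) (u := v)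
      (fourierL2_rieszH hs0 ⟨v, sobolev_mono (by linarith) hv⟩) hr
  rw [hr'] at key
  refine le_of_eq_of_le (integral_congr_ae ?_) key
  filter_upwards [hae] with x hx
  rw [hx]

/-! ### The resolvent of `𝓛` -/

lemma HOdd.toL2_injective (s : ℝ) : Function.Injective (HOdd.toL2 s) := Subtype.val_injective

lemma HOdd.toL2_mk {s : ℝ} {u : L2} (hu : u ∈ sobolev s ⊓ oddL2) :
    HOdd.toL2 s (⟨u, hu⟩ : ↥(sobolev s ⊓ oddL2)) = u := rfl

lemma HOdd.norm_eq {s : ℝ} (u : HOdd s) :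
    ‖u‖ = ‖FKP.bessel s ⟨HOdd.toL2 s u, u.2.1⟩‖ := rfl

/-- The lower bound makes A + t injective. Only an algebraic inverse is needed, since the norms are
controlled by the resolvent estimates. -/
lemma exists_shift_inverse {H : Type*} [NormedAddCommGroup H] [InnerProductSpace ℂ H]
    {V : Submodule ℂ H} {A : V →ₗ[ℂ] H} {l t : ℝ}
    (hA : ∀ u : V, l * ‖(u : H)‖ ^ 2 ≤ (inner ℂ (u : H) (A u)).re) (ht : 0 < t + l)
    (hs : ∀ f : H, ∃ u : V, A u + (t : ℂ) • (u : H) = f) :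
    ∃ S : H →ₗ[ℂ] V, (∀ f, A (S f) + (t : ℂ) • (S f : H) = f) ∧
      ∀ u : V, S (A u + (t : ℂ) • (u : H)) = u := by
  have hinj : Function.Injective (A + (t : ℂ) • V.subtype) := by
    rw [injective_iff_map_eq_zero]
    intro u hu
    have h1 := norm_le_norm_shift hA t u
    rw [show A u + (t : ℂ) • (u : H) = 0 from hu, norm_zero] at h1
    have h0 : ‖(u : H)‖ ≤ 0 := by
      by_contra hne
      push Not at hne
      nlinarith
    exact Subtype.ext (norm_le_zero_iff.mp h0)
  set e : V ≃ₗ[ℂ] H := LinearEquiv.ofBijective (A + (t : ℂ) • V.subtype) ⟨hinj, hs⟩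
  exact ⟨e.symm.toLinearMap, fun f => e.apply_symm_apply f, fun u => e.symm_apply_apply u⟩

lemma X.ext {α : ℝ} {U V : X α} (h1 : (U.fst : L2) = V.fst)
    (h2 : HOdd.toL2 _ U.snd = HOdd.toL2 _ V.snd) : U = V :=
  congrArg (WithLp.toLp 1) (Prod.ext (Subtype.ext h1) (HOdd.toL2_injective _ h2))

lemma ZtoX_fst {α : ℝ} (hα : 0 < α) (V : Z α) :
    ((ZtoX hα V).fst : L2) = HOdd.toL2 _ V.fst := rfl

lemma ZtoXₗ_snd {α : ℝ} (hα : 0 < α) (V : Z α) :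
    HOdd.toL2 _ (ZtoXₗ hα V).snd = HOdd.toL2 _ V.snd := HOdd.toL2_mk _

lemma ZtoX_apply {α : ℝ} (hα : 0 < α) (V : Z α) : ZtoX hα V = ZtoXₗ hα V := rfl

lemma ZtoX_snd {α : ℝ} (hα : 0 < α) (V : Z α) :
    HOdd.toL2 _ (ZtoX hα V).snd = HOdd.toL2 _ V.snd := by
  rw [ZtoX_apply, ZtoXₗ_snd]

/-- The first component, as a map from `X` to `L²`. -/
def X.fstL2 (α : ℝ) : X α →ₗ[ℂ] L2 where
  toFun W := W.fst
  map_add' _ _ := rfl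
  map_smul' _ _ := rfl

/-- The second component, as a map from `X` to `L²`. -/
def X.sndL2 (α : ℝ) : X α →ₗ[ℂ] L2 where
  toFun W := HOdd.toL2 _ W.snd
  map_add' _ _ := rfl
  map_smul' _ _ := rfl

lemma X.fst_sub_smul {α : ℝ} (a : ℂ) (U V : X α) :
    ((U - a • V).fst : L2) = U.fst - a • (V.fst : L2) := rfl

lemma X.snd_sub_smul {α : ℝ} (a : ℂ) (U V : X α) :
    HOdd.toL2 _ (U - a • V).snd = HOdd.toL2 _ U.snd - a • HOdd.toL2 _ V.snd := rfl

/-- The map to `Z` with given components. -/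
def Z.ofL2 {α : ℝ} {E : Type*} [AddCommGroup E] [Module ℂ E] (f g : E →ₗ[ℂ] L2)
    (hf : ∀ x, f x ∈ sobolev (1 + α / 2) ⊓ oddL2) (hg : ∀ x, g x ∈ sobolev (2 + α) ⊓ oddL2) :
    E →ₗ[ℂ] Z α where
  toFun x := WithLp.toLp 1 (⟨f x, hf x⟩, ⟨g x, hg x⟩)
  map_add' x y := congrArg (WithLp.toLp 1)
    (Prod.ext (Subtype.ext (f.map_add x y)) (Subtype.ext (g.map_add x y)))
  map_smul' a x := congrArg (WithLp.toLp 1)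
    (Prod.ext (Subtype.ext (f.map_smul a x)) (Subtype.ext (g.map_smul a x)))

section Operator

variable {α c B : ℝ} {q Qc : ℝ → ℝ} (h : sobolev (2 + α) ≤ (opL α c Qc).domain)

/-- The domain of `𝓛` is `Z`. -/
lemma domain_opCalL (hα : 0 < α)
    (hodd : ∀ u : sobolev (2 + α), (u : L2) ∈ oddL2 → opLH h u ∈ oddL2) :
    ((opCalL α c Qc).domain : Set (X α)) = Set.range (ZtoX hα) := by
  ext W
  constructor
  · rintro ⟨h1, h2, -⟩
    have h3 : HOdd.toL2 _ W.snd ∈ sobolev (2 + α) ⊓ oddL2 := ⟨h2.1, W.snd.2.2⟩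
    refine ⟨WithLp.toLp 1 (⟨W.fst, h1, W.fst.2⟩, ⟨_, h3⟩), X.ext ?_ ?_⟩
    · rw [ZtoX_fst]
      exact HOdd.toL2_mk _
    · rw [ZtoX_snd]
      exact HOdd.toL2_mk _
  · rintro ⟨V, rfl⟩
    have h1 : ((ZtoX hα V).fst : L2) ∈ sobolev (1 + α / 2) := by
      rw [ZtoX_fst]; exact V.fst.2.1
    have h2 : HOdd.toL2 _ (ZtoX hα V).snd ∈ sobolev (2 + α) := by
      rw [ZtoX_snd]; exact V.snd.2.1
    exact ⟨h1, h h2, hodd ⟨_, h2⟩ (ZtoX hα V).snd.2.2⟩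

lemma opCalL_fst (W : (opCalL α c Qc).domain) {u : sobolev (2 + α)}
    (hu : (u : L2) = HOdd.toL2 _ W.1.snd) : ((opCalL α c Qc W).fst : L2) = opLH h u := by
  obtain ⟨u, hu'⟩ := u
  subst hu
  rfl

lemma opCalL_snd (W : (opCalL α c Qc).domain) :
    HOdd.toL2 _ (opCalL α c Qc W).snd = (W.1.fst : L2) := HOdd.toL2_mk _

/-- The resolvent of `𝓛` at `iμ` is bounded as soon as the solution operator of `L + μ²` is. -/
lemma exists_isResolvent (hα : 0 < α)
    (hodd : ∀ u : sobolev (2 + α), (u : L2) ∈ oddL2 → opLH h u ∈ oddL2) {μ K K' : ℝ}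
    (hK : 0 ≤ K) (hK' : 0 ≤ K') {S : L2 →ₗ[ℂ] sobolev (2 + α)}
    (hS : ∀ f, opLH h (S f) + ((μ ^ 2 : ℝ) : ℂ) • (S f : L2) = f)
    (hS' : ∀ u : sobolev (2 + α), S (opLH h u + ((μ ^ 2 : ℝ) : ℂ) • (u : L2)) = u)
    (hSodd : ∀ f ∈ oddL2, (S f : L2) ∈ oddL2)
    (hest : ∀ (F₁ W₁ : L2) (u : sobolev (2 + α)) (F₂ : sobolev (1 + α / 2))
      (hW₁ : W₁ ∈ sobolev (1 + α / 2)) (hu : (u : L2) ∈ sobolev (1 + α / 2)),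
      W₁ = F₂ + (Complex.I * μ) • (u : L2) → opLH h u = F₁ + (Complex.I * μ) • W₁ →
      ‖W₁‖ + ‖bessel (1 + α / 2) ⟨u, hu⟩‖ ≤ K * (‖F₁‖ + ‖bessel (1 + α / 2) F₂‖) ∧
      ‖bessel (1 + α / 2) ⟨W₁, hW₁⟩‖ + ‖bessel (2 + α) u‖
        ≤ K' * (‖F₁‖ + ‖bessel (1 + α / 2) F₂‖)) :
    ∃ R : X α →L[ℂ] Z α, IsResolvent hα (opCalL α c Qc) (Complex.I * μ) R ∧
      ‖(ZtoX hα).comp R‖ ≤ K ∧ ‖R‖ ≤ K' := by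
  have hI : Complex.I * μ * (Complex.I * μ) = -((μ ^ 2 : ℝ) : ℂ) := by
    push_cast
    linear_combination (μ : ℂ) ^ 2 * Complex.I_mul_I
  -- The second component of the solution: U F solves (L + μ²)u = F₁ + iμF₂. The first component is
  -- then F₂ + iμ(U F).
  set U : X α →ₗ[ℂ] sobolev (2 + α) := S ∘ₗ (X.fstL2 α + (Complex.I * μ) • X.sndL2 α) with hUdef
  have hU : ∀ F, U F = S ((F.fst : L2) + (Complex.I * μ) • HOdd.toL2 _ F.snd) := fun _ => rfl
  clear_value U
  have hUodd : ∀ F, (U F : L2) ∈ oddL2 := fun F => by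
    rw [hU]
    exact hSodd _ (add_mem F.fst.2 (Submodule.smul_mem _ _ F.snd.2.2))
  have hUs : ∀ F, (U F : L2) ∈ sobolev (1 + α / 2) := fun F =>
    sobolev_mono (by linarith) (U F).2
  have hL : ∀ F, opLH h (U F) = F.fst
      + (Complex.I * μ) • (HOdd.toL2 _ F.snd + (Complex.I * μ) • (U F : L2)) := fun F => by
    have h1 := hS ((F.fst : L2) + (Complex.I * μ) • HOdd.toL2 _ F.snd)
    rw [← hU] at h1
    rw [smul_add, smul_smul, hI, neg_smul, ← add_assoc, ← h1]
    abel
  have hW : ∀ F : X α, HOdd.toL2 _ F.snd + (Complex.I * μ) • (U F : L2) ∈ sobolev (1 + α / 2) :=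
    fun F => add_mem F.snd.2.1 (Submodule.smul_mem _ _ (hUs F))
  have hWo : ∀ F : X α, HOdd.toL2 _ F.snd + (Complex.I * μ) • (U F : L2) ∈ oddL2 :=
    fun F => add_mem F.snd.2.2 (Submodule.smul_mem _ _ (hUodd F))
  set R : X α →ₗ[ℂ] Z α := Z.ofL2 (X.sndL2 α + (Complex.I * μ) • (Submodule.subtype _ ∘ₗ U))
    (Submodule.subtype _ ∘ₗ U) (fun F => ⟨hW F, hWo F⟩) (fun F => ⟨(U F).2, hUodd F⟩) with hRdef
  have hR : ∀ F, R F = WithLp.toLp 1 (⟨_, hW F, hWo F⟩, ⟨U F, (U F).2, hUodd F⟩) := fun _ => rfl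
  clear_value R
  have hdom := domain_opCalL h hα hodd
  have hR1 : ∀ F, HOdd.toL2 _ (R F).fst
      = HOdd.toL2 _ F.snd + (Complex.I * μ) • (U F : L2) := fun F => by rw [hR]; rfl
  have hR2 : ∀ F, HOdd.toL2 _ (R F).snd = U F := fun F => by rw [hR]; rfl
  have hF : ∀ F : X α, ‖F‖ = ‖(F.fst : L2)‖
      + ‖bessel (1 + α / 2) ⟨HOdd.toL2 _ F.snd, F.snd.2.1⟩‖ := fun F => by
    rw [WithLp.prod_norm_eq_of_L1, HOdd.norm_eq]
    rfl
  have hb : ∀ F, ‖R F‖ ≤ K' * ‖F‖ := fun F => by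
    rw [hF, hR, WithLp.prod_norm_eq_of_L1]
    exact (hest F.fst _ (U F) ⟨_, F.snd.2.1⟩ (hW F) (hUs F) rfl (hL F)).2
  obtain ⟨T, hT, hTn⟩ : ∃ T : X α →L[ℂ] Z α, (∀ F, T F = R F) ∧ ‖T‖ ≤ K' :=
    ⟨R.mkContinuous K' hb, fun _ => rfl, R.mkContinuous_norm_le hK' hb⟩
  refine ⟨T, ⟨fun F => ?_, fun W => ?_⟩, ?_, hTn⟩
  · rw [hT]
    have hm : ZtoX hα (R F) ∈ (opCalL α c Qc).domain := hdom.symm.subset (Set.mem_range_self (R F))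
    have h2 : (U F : L2) = HOdd.toL2 _ (ZtoX hα (R F)).snd := by rw [ZtoX_snd, hR2]
    refine ⟨hm, X.ext ?_ ?_⟩
    · rw [X.fst_sub_smul, opCalL_fst h ⟨_, hm⟩ h2, ZtoX_fst, hR1, hL,
        add_sub_cancel_right]
    · rw [X.snd_sub_smul, opCalL_snd, ZtoX_fst, ZtoX_snd, hR1, hR2,
        add_sub_cancel_right]
  · have hw : HOdd.toL2 _ W.1.snd ∈ sobolev (2 + α) := W.2.2.1.1
    have hUF : U (opCalL α c Qc W - (Complex.I * μ) • (W : X α)) = ⟨_, hw⟩ := by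
      rw [hU, X.fst_sub_smul, X.snd_sub_smul, opCalL_fst h W (u := ⟨_, hw⟩) rfl, opCalL_snd]
      refine Eq.trans (congrArg S ?_) (hS' ⟨_, hw⟩)
      rw [smul_sub, smul_smul, hI, neg_smul]
      abel
    rw [hT]
    refine X.ext ?_ ?_
    · rw [ZtoX_fst, hR1, hUF, X.snd_sub_smul, opCalL_snd, sub_add_cancel]
    · rw [ZtoX_snd, hR2, hUF]
  · refine ContinuousLinearMap.opNorm_le_bound _ hK fun F => ?_
    rw [hF, ContinuousLinearMap.comp_apply, hT, hR,
      WithLp.prod_norm_eq_of_L1]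
    exact (hest F.fst _ (U F) ⟨_, F.snd.2.1⟩ (hW F) (hUs F) rfl (hL F)).1

end Operator

end FKP

end

/-! ### The theorem -/

theorem mainTheorem4 (α c : ℝ) (hα : 1 / 3 < α) (hα' : α < 2) (hc : 0 < c)
    (Q : ℝ → ℝ) (hQ : FKP.IsGroundState α Q)
    (l : ℝ) (hl : l < 0)
    (hl' : FKP.IsEigenvalue (FKP.opL α c (FKP.solitaryWave α c Q)) (l : ℂ)) :
    ((FKP.opCalL α c (FKP.solitaryWave α c Q)).domain : Set (FKP.X α))
        = Set.range (FKP.ZtoX (α := α) (by linarith)) ∧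
      ∃ C : ℝ, ∀ n : ℤ, 1 < |n| →
        ∃ R : FKP.X α →L[ℂ] FKP.Z α,
          FKP.IsResolvent (by linarith) (FKP.opCalL α c (FKP.solitaryWave α c Q))
            (Complex.I * n * (Real.sqrt |l| : ℂ)) R ∧
          ‖(FKP.ZtoX (by linarith)).comp R‖ ≤ C / |(n : ℝ)| ∧
          ‖R‖ ≤ C := by
  have hα0 : 0 < α := by linarith
  obtain ⟨q, B, hq, hqQ, hev, hidx⟩ := hQ.exists_potential hα hα' hc
  have h := FKP.sobolev_le_opL hα0.le hc.le hq hqQ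
  have hodd : ∀ u : FKP.sobolev (2 + α), (u : FKP.L2) ∈ FKP.oddL2 → FKP.opLH h u ∈ FKP.oddL2 :=
    fun u hu => FKP.opLH_mem_oddL2 h hα0.le hc.le hq hqQ hev hu
  refine ⟨FKP.domain_opCalL h hα0 hodd, ?_⟩
  obtain ⟨w, hw0, hw⟩ := hl'
  have hlow := FKP.lower_bound_opLH h hα0.le hc.le hq hqQ hidx hl (w := ⟨w, w.2.1⟩) hw0 hw
  obtain ⟨C, hC, hest⟩ := FKP.exists_resolvent_bound h hα0 hα'.le hc.le hq hqQ hl hlow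
  have hl0 : 0 < |l| := abs_pos.mpr hl.ne
  have hsq : 0 < Real.sqrt |l| := Real.sqrt_pos.mpr hl0
  -- The estimates give C/|μ| on X and C from X to Z. Since |μ| = |n|√|l|, the first is
  -- (C/√|l|)/|n|; the sum serves for both.
  refine ⟨C + C / Real.sqrt |l|, fun n hn => ?_⟩
  -- For integers |n| > 1 means |n| ≥ 2; this gives μ² ≥ 4|l|, which keeps μ² + l away from zero.
  have hn2 : (2 : ℝ) ≤ |(n : ℝ)| := by exact_mod_cast hn
  have hn0 : 0 < |(n : ℝ)| := by linarith
  set μ : ℝ := n * Real.sqrt |l| with hμ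
  have hμabs : |μ| = |(n : ℝ)| * Real.sqrt |l| := by rw [hμ, abs_mul, abs_of_pos hsq]
  have hμpos : 0 < |μ| := by rw [hμabs]; positivity
  have hμsq : 4 * |l| ≤ μ ^ 2 := by
    rw [hμ, mul_pow, Real.sq_sqrt hl0.le, ← sq_abs (n : ℝ)]
    exact mul_le_mul_of_nonneg_right (by nlinarith) hl0.le
  have ht : 0 < μ ^ 2 + l := by
    rw [abs_of_neg hl] at hμsq
    linarith
  obtain ⟨S, hS, hS'⟩ := FKP.exists_shift_inverse hlow ht
    (FKP.surjective_opLH h hα0 hα'.le hc.le hq hqQ hlow ht)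
  obtain ⟨R, hR, hR1, hR2⟩ := FKP.exists_isResolvent h hα0 hodd (μ := μ) (K := C / |μ|) (K' := C)
    (by positivity) hC hS hS'
    (fun f hf => FKP.mem_oddL2_of_opLH h hα0.le hc.le hq hqQ hev hlow ht (by rw [hS]; exact hf))
    (fun F₁ W₁ u F₂ hW₁ hu e1 e2 => by
      obtain ⟨h1, h2⟩ := hest μ hμsq F₁ W₁ u F₂ hW₁ hu e1 e2
      refine ⟨?_, h2⟩
      rw [div_mul_eq_mul_div, le_div_iff₀ hμpos, mul_comm]
      exact h1)
  refine ⟨R, ?_, hR1.trans ?_, hR2.trans ?_⟩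
  · have e : Complex.I * n * (Real.sqrt |l| : ℂ) = Complex.I * (μ : ℂ) := by
      rw [hμ]; push_cast; ring
    rw [e]
    exact hR
  · rw [hμabs, mul_comm |(n : ℝ)|, ← div_div]
    exact div_le_div_of_nonneg_right (by linarith) hn0.le
  · have : 0 ≤ C / Real.sqrt |l| := by positivity
    linarith
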